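/- Let $\Sigma$ be a compact Riemann surface with a smooth Riemannian metric $g$ compatible with its complex structure, let $\bar K=(T^*\Sigma)^{0,1}$, and let $E\to\Sigma$ be a holomorphic vector bundle of rank $r$ with a smooth Hermitian metric $\langle\cdot,\cdot\rangle$, conjugate linear in the second argument; $\bar KE=\bar K\otimes E$ carries the induced metric. A smooth section $\bar\mu\in\Gamma(\bar K\otimes_{\mathbb C}\mathrm{Sym}^2_{\mathbb C}E)$, locally $\bar\mu=\bar k\,\mu^{ij}e_i\otimes e_j$, defines a conjugate-linear bundle map $\mu:E\to\bar KE$, $\mu(\xi)=\bar k\,\langle e_i,\xi\rangle\mu^{ij}e_j$; let $\mu^*:\bar KE\to E$ be its adjoint for the real inner products $\mathrm{Re}\langle\cdot,\cdot\rangle$, and let $$\mathcal A=\begin{pmatrix}0&\mu^*\\ \mu&0\end{pmatrix}\in\mathrm{End}_{\mathbb R}(E\oplus\bar KE),\qquad Z_{\mathcal A}=\{x\in\Sigma:\ \ker\mathcal A(x)\neq0\}.$$ The top exterior power of the complex-linear map $E^*\cong E\xrightarrow{\mu}\bar KE$ is a section $\det\mu$ of the complex line bundle $L=\bar K^r\otimes\Lambda^rE\otimes\Lambda^rE$;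 locally it is $\det(\mu^{ij})$. A zero $p$ of $\det\mu$ is transverse if $\nabla(\det\mu):T_p\Sigma\to L_p$ is an isomorphism, and it is then called positive or negative according as this isomorphism preserves or reverses the (complex) orientations. For a real covector $u$ let $c(u)=u^{0,1}\wedge\,\cdot\,:E\to\bar KE$ and $c(u)=-(u^{0,1}\wedge\,\cdot\,)^*:\bar KE\to E$. For $p\in Z_{\mathcal A}$, connections $\nabla$ on $E$ and $\bar KE$, and an orthonormal frame $e_1,e_2$ of $T_p\Sigma$ with dual frame $e^1,e^2$, let $$M_\alpha=-c(e^\alpha)\nabla_{e_\alpha}\mu:\ker\mu_p\to\ker\mu_p,\qquad \hat M_\alpha=-c(e^\alpha)\nabla_{e_\alpha}\mu^*:\ker\mu_p^*\to\ker\mu_p^*$$ (composed with the orthogonal projections onto $\ker\mu_p$, $\ker\mu_p^*$), and let $\mathcal K_p=\bigcap_\alpha K_\alpha^+$, where $K_\alpha^+$ is the sum of the eigenspaces of $M_\alpha$ with positive eigenvalue; $\hat{\mathcal K}_p$ is defined in the same way from $\hat M_1,\hat M_2$. The frame is called commuting if $M_1M_2=M_2M_1$ and $\hat M_1\hat M_2=\hat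 M_2\hat M_1$. Then the set of $\bar\mu$ for which all zeros of $\det\mu$ are transverse is open and dense in $\Gamma(\bar K\otimes\mathrm{Sym}^2E)$ with the $C^\infty$ topology. For every such $\bar\mu$ the set $Z_{\mathcal A}$ is finite and equals the zero set of $\det\mu$, and each $p\in Z_{\mathcal A}$ is positive or negative. For every $p\in Z_{\mathcal A}$ and every choice of the connections: commuting orthonormal frames of $T_p\Sigma$ exist; every orthonormal frame is commuting if $p$ is non-degenerate, in the sense that there is a positive-definite symmetric endomorphism $M$ of $\ker\mu_p$ for which the orthogonal projection to $\ker\mu_p^*$ of $(\nabla_v\mu)k$ has square norm $|v|^2\,\mathrm{Re}\langle Mk,k\rangle$ for all $v\in T_p\Sigma$, $k\in\ker\mu_p$; and for every commuting orthonormal frame * if $p$ is positive, then $\mathcal K_p\cong\mathbb R$ and $\hat{\mathcal K}_p=0$; * if $p$ is negative, then $\mathcal K_p=0$ and $\hat{\mathcal K}_p\cong\mathbb R$. -/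

import Mathlib

open scoped Manifold ContDiff Bundle InnerProductSpace TensorProduct UniformConvergence
open Bundle

/-- The smooth real surface underlying a Riemann surface. -/
instance instIsManifoldRealOfComplex (S : Type*) [TopologicalSpace S] [ChartedSpace ℂ S]
    [IsManifold 𝓘(ℂ, ℂ) ω S] : IsManifold 𝓘(ℝ, ℂ) ∞ S := by
  apply isManifold_of_contDiffOn
  intro e e' he he'
  have h := (contDiffGroupoid ω 𝓘(ℂ, ℂ)).compatible he he'
  have h1 : e.symm ≫ₕ e' ∈ contDiffGroupoid ∞ 𝓘(ℂ, ℂ) := contDiffGroupoid_le le_top h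
  rw [contDiffGroupoid, mem_groupoid_of_pregroupoid] at h1
  exact (show ContDiffOn ℂ ∞ _ _ from h1.1).restrict_scalars ℝ

noncomputable section

namespace CrrLemma

-- On a Hermitian space the real inner product is `Re⟨·,·⟩`.
attribute [local instance] InnerProductSpace.complexToReal

/-- The model fibre of a complex vector bundle of rank `r`. -/
abbrev Fib (r : ℕ) : Type := EuclideanSpace ℂ (Fin r)

section Base

variable (S : Type*) [TopologicalSpace S] [ChartedSpace ℂ S] [IsManifold 𝓘(ℂ, ℂ) ω S]

/-- Smooth Riemannian metrics on the underlying real surface. -/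
abbrev SurfaceMetric : Type _ :=
  ContMDiffRiemannianMetric 𝓘(ℝ, ℂ) ∞ ℂ (fun x : S => TangentSpace 𝓘(ℝ, ℂ) x)

variable {S}

/-- The holomorphic tangent line at `x`. The real tangent space `TangentSpace 𝓘(ℝ, ℂ) x` is the
same additive group (both are `ℂ`, through the preferred chart at `x`), so multiplication by `i`
here is the complex structure of the surface. -/
abbrev Tan (x : S) : Type := TangentSpace 𝓘(ℂ, ℂ) x

/-- The tangent vector `1` at `x` in the preferred chart at `x`. -/
def tanOne (x : S) : Tan x := (1 : ℂ)

/-- The real inner product of two tangent vectors. -/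
def metricAt (g : SurfaceMetric S) (x : S) (v w : Tan x) : ℝ :=
  g.inner x (show TangentSpace 𝓘(ℝ, ℂ) x from v) (show TangentSpace 𝓘(ℝ, ℂ) x from w)

/-- The metric is compatible with the complex structure. -/
def IsCompatible (g : SurfaceMetric S) : Prop :=
  ∀ (x : S) (v w : Tan x), metricAt g x (Complex.I • v) (Complex.I • w) = metricAt g x v w

/-- `e` is an orthonormal frame of the real tangent plane at `x`. -/
def IsOrthonormalFrame (g : SurfaceMetric S) (x : S) (e : Fin 2 → Tan x) : Prop :=
  ∀ i j, metricAt g x (e i) (e j) = if i = j then 1 else 0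

/-- The coordinate vector field `∂/∂z` at `x`, for the preferred chart `z` at `p`. -/
def coordVec (p x : S) : Tan x :=
  (trivializationAt ℂ (fun y : S => TangentSpace 𝓘(ℂ, ℂ) y) p).symmL ℂ x (1 : ℂ)

end Base

/-- `Sym²V`, the symmetric tensors in `V ⊗ V`. -/
def symTensors (V : Type*) [AddCommGroup V] [Module ℂ V] : Submodule ℂ (V ⊗[ℂ] V) :=
  LinearMap.ker ((TensorProduct.comm ℂ V V).toLinearMap - LinearMap.id)

section Fibres

variable {S : Type*} [TopologicalSpace S] [ChartedSpace ℂ S] [IsManifold 𝓘(ℂ, ℂ) ω S]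
  (g : SurfaceMetric S) (E : S → Type*) [∀ x, NormedAddCommGroup (E x)]
  [∀ x, InnerProductSpace ℂ (E x)]

/-- The fibre of `K̄ ⊗ Sym²E` at `x`: conjugate-linear maps from the holomorphic tangent line
to `Sym²(E x)`. -/
abbrev QuadFibre (x : S) : Type _ := Tan x →ₛₗ[starRingEnd ℂ] symTensors (E x)

/-- The fibre of `K̄E = K̄ ⊗ E` at `x`: conjugate-linear maps from the holomorphic tangent line
to `E x`. (The metric `g` is recorded in the type because it enters the inner product.) -/
def KbarE (_g : SurfaceMetric S) (E : S → Type*) [∀ x, NormedAddCommGroup (E x)]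
    [∀ x, InnerProductSpace ℂ (E x)] (x : S) : Type _ :=
  Tan x →ₛₗ[starRingEnd ℂ] E x

instance (x : S) : AddCommGroup (KbarE g E x) :=
  inferInstanceAs (AddCommGroup (Tan x →ₛₗ[starRingEnd ℂ] E x))

instance (x : S) : Module ℂ (KbarE g E x) :=
  inferInstanceAs (Module ℂ (Tan x →ₛₗ[starRingEnd ℂ] E x))

variable {g E}

/-- Regard a conjugate-linear map on the tangent line as an element of `K̄E`. -/
def KbarE.mk {x : S} (f : Tan x →ₛₗ[starRingEnd ℂ] E x) : KbarE g E x := f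

/-- Evaluation of an `E`-valued `(0,1)`-form on a tangent vector. -/
def KbarE.ev {x : S} (v : Tan x) : KbarE g E x →ₗ[ℂ] E x where
  toFun η := (show Tan x →ₛₗ[starRingEnd ℂ] E x from η) v
  map_add' _ _ := rfl
  map_smul' _ _ := rfl

theorem KbarE.ext_one {x : S} {η : KbarE g E x} (h : KbarE.ev (tanOne x) η = 0) : η = 0 := by
  refine LinearMap.ext (σ := starRingEnd ℂ) (f := show Tan x →ₛₗ[starRingEnd ℂ] E x from η)
    (g := 0) fun v => ?_
  have hv : v = (show ℂ from v) • tanOne x := (mul_one (show ℂ from v)).symm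
  rw [hv, LinearMap.map_smulₛₗ]
  have h' : (show Tan x →ₛₗ[starRingEnd ℂ] E x from η) (tanOne x) = 0 := h
  rw [h']
  simp

theorem metricAt_tanOne_pos (g : SurfaceMetric S) (x : S) :
    0 < metricAt g x (tanOne x) (tanOne x) :=
  g.pos x _ (show (1 : ℂ) ≠ 0 from one_ne_zero)

/-- The Hermitian inner product on `K̄E` induced by the metrics of the surface and of `E`. With
`z` a coordinate for which `∂/∂x` has length `a`, one has `|dz̄|² = 2 / a²`. -/
@[reducible]
def KbarE.core (g : SurfaceMetric S) (E : S → Type*) [∀ x, NormedAddCommGroup (E x)]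
    [∀ x, InnerProductSpace ℂ (E x)] (x : S) : InnerProductSpace.Core ℂ (KbarE g E x) where
  inner η ζ := ((2 / metricAt g x (tanOne x) (tanOne x) : ℝ) : ℂ) *
    inner ℂ (KbarE.ev (tanOne x) η) (KbarE.ev (tanOne x) ζ)
  conj_inner_symm η ζ := by
    rw [map_mul, Complex.conj_ofReal, inner_conj_symm]
  re_inner_nonneg η := by
    have h := (metricAt_tanOne_pos g x).le
    have h2 : 0 ≤ 2 / metricAt g x (tanOne x) (tanOne x) := by positivity
    have := inner_self_nonneg (𝕜 := ℂ) (x := KbarE.ev (tanOne x) η)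
    rw [RCLike.re_eq_complex_re] at this ⊢
    rw [Complex.re_ofReal_mul]
    exact mul_nonneg h2 this
  add_left η ζ χ := by rw [map_add, inner_add_left, mul_add]
  smul_left η ζ a := by rw [map_smul, inner_smul_left]; ring
  definite η h := by
    have h0 := metricAt_tanOne_pos g x
    have h2 : ((2 / metricAt g x (tanOne x) (tanOne x) : ℝ) : ℂ) ≠ 0 := by
      exact_mod_cast (div_pos two_pos h0).ne'
    exact KbarE.ext_one (inner_self_eq_zero.1 ((mul_eq_zero.1 h).resolve_left h2))

instance (x : S) : NormedAddCommGroup (KbarE g E x) :=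
  (KbarE.core g E x).toNormedAddCommGroup

instance (x : S) : InnerProductSpace ℂ (KbarE g E x) :=
  InnerProductSpace.ofCore (KbarE.core g E x).toCore

instance (x : S) [FiniteDimensional ℂ (E x)] : FiniteDimensional ℂ (KbarE g E x) :=
  FiniteDimensional.of_injective (KbarE.ev (g := g) (E := E) (tanOne x))
    ((injective_iff_map_eq_zero _).2 fun _ h => KbarE.ext_one h)

/-- Contraction of a symmetric tensor `∑ a ⊗ b` with `ξ` through the Hermitian metric:
`∑ ⟨a, ξ⟩ b`, where `⟨a, ξ⟩` is linear in `a` and conjugate linear in `ξ` (this is Mathlib's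
`inner ℂ ξ a`). -/
def contract {V : Type*} [NormedAddCommGroup V] [InnerProductSpace ℂ V] :
    V →ₛₗ[starRingEnd ℂ] (V ⊗[ℂ] V) →ₗ[ℂ] V where
  toFun ξ := (TensorProduct.lid ℂ V).toLinearMap ∘ₗ LinearMap.rTensor V (innerₛₗ ℂ ξ)
  map_add' ξ ζ := by
    ext a b
    simp
  map_smul' c ξ := by
    ext a b
    simp

/-- The conjugate-linear map `μ : E → K̄E` determined by an element of `K̄ ⊗ Sym²E` and the
Hermitian metric of `E`. -/
def mu {x : S} (s : QuadFibre E x) : E x →ₛₗ[starRingEnd ℂ] KbarE g E x where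
  toFun ξ := KbarE.mk (((contract ξ).comp (symTensors (E x)).subtype).comp s)
  map_add' ξ ζ := by
    refine LinearMap.ext (σ := starRingEnd ℂ) fun v => ?_
    change contract (ξ + ζ) (s v : E x ⊗[ℂ] E x) = contract ξ (s v : E x ⊗[ℂ] E x) + contract ζ _
    rw [map_add]; rfl
  map_smul' c ξ := by
    refine LinearMap.ext (σ := starRingEnd ℂ) fun v => ?_
    change contract (c • ξ) (s v : E x ⊗[ℂ] E x) = (starRingEnd ℂ c) • contract ξ _
    rw [LinearMap.map_smulₛₗ]; rfl

variable (g) in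
/-- `μ` as a real-linear map. -/
def muR {x : S} (s : QuadFibre E x) : E x →ₗ[ℝ] KbarE g E x where
  toFun ξ := mu s ξ
  map_add' := map_add _
  map_smul' c ξ := by
    have h : c • ξ = (c : ℂ) • ξ := (RCLike.real_smul_eq_coe_smul (K := ℂ) c ξ)
    have h' : c • (mu s ξ : KbarE g E x) = (c : ℂ) • (mu s ξ : KbarE g E x) :=
      (RCLike.real_smul_eq_coe_smul (K := ℂ) c _)
    rw [RingHom.id_apply, h', h, LinearMap.map_smulₛₗ, Complex.conj_ofReal]

variable [∀ x, FiniteDimensional ℂ (E x)]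

variable (g) in
/-- The adjoint `μ* : K̄E → E` with respect to the real inner products `Re⟨·,·⟩`. -/
def muAdj {x : S} (s : QuadFibre E x) : KbarE g E x →ₗ[ℝ] E x :=
  LinearMap.adjoint (muR g s)

variable (g) in
/-- `𝒜 = (0 μ*; μ 0)`, a real endomorphism of `E ⊕ K̄E`. -/
def bigA {x : S} (s : QuadFibre E x) : (E x × KbarE g E x) →ₗ[ℝ] (E x × KbarE g E x) :=
  LinearMap.prod (muAdj g s ∘ₗ LinearMap.snd ℝ _ _) (muR g s ∘ₗ LinearMap.fst ℝ _ _)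

/-- For a tangent vector `v`, the complex-linear map `E* → E`, `φ ↦ μ(φ♯)(v)`, where `φ♯` is the
vector with `φ = ⟨·, φ♯⟩`. -/
def muSharp {x : S} (g : SurfaceMetric S) (s : QuadFibre E x) (v : Tan x) :
    Module.Dual ℂ (E x) →ₗ[ℂ] E x where
  toFun φ := KbarE.ev v
    (mu s ((InnerProductSpace.toDual ℂ (E x)).symm (LinearMap.toContinuousLinearMap φ)) :
      KbarE g E x)
  map_add' φ ψ := by simp
  map_smul' c φ := by
    rw [map_smul, LinearIsometryEquiv.map_smulₛₗ, LinearMap.map_smulₛₗ, map_smul]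
    simp

/-- The section `det μ` of `L = K̄^r ⊗ Λ^r E ⊗ Λ^r E` at `x`, given as the map sending a tangent
vector `v` to `Λ^r E* → Λ^r E`, the top exterior power of `E* → E`, `φ ↦ μ(φ♯)(v)`. (It is
homogeneous of degree `r` in `v̄`, whence the factor `K̄^r`.) -/
def detMu {x : S} (r : ℕ) (g : SurfaceMetric S) (s : QuadFibre E x) (v : Tan x) :
    (⋀[ℂ]^r (Module.Dual ℂ (E x))) →ₗ[ℂ] (⋀[ℂ]^r (E x)) :=
  exteriorPower.map r (muSharp g s v)

/-! ### Clifford multiplication -/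

/-- The `(0,1)`-part `½(u + i u∘J)` of the real covector `u = g(w, ·)`. -/
def form01 (g : SurfaceMetric S) {x : S} (w : Tan x) (v : Tan x) : ℂ :=
  ((metricAt g x w v : ℂ) + Complex.I * (metricAt g x w (Complex.I • v) : ℂ)) / 2

theorem metricAt_add (g : SurfaceMetric S) {x : S} (w v v' : Tan x) :
    metricAt g x w (v + v') = metricAt g x w v + metricAt g x w v' :=
  map_add (g.inner x (show TangentSpace 𝓘(ℝ, ℂ) x from w)) _ _

theorem metricAt_smul (g : SurfaceMetric S) {x : S} (w v : Tan x) (c : ℂ) :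
    metricAt g x w (c • v) =
      c.re * metricAt g x w v + c.im * metricAt g x w (Complex.I • v) := by
  have h : (show ℂ from c • v) =
      c.re • (show ℂ from v) + c.im • (show ℂ from (Complex.I • v : Tan x)) := by
    have key : ∀ t : ℂ, c * t = c.re • t + c.im • (Complex.I * t) := fun t => by
      conv_lhs => rw [← Complex.re_add_im c]
      simp only [Complex.real_smul]
      ring
    exact key v
  have h2 := congrArg (fun t : ℂ => g.inner x (show TangentSpace 𝓘(ℝ, ℂ) x from w)
    (show TangentSpace 𝓘(ℝ, ℂ) x from t)) h
  refine h2.trans ?_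
  exact (map_add (g.inner x (show TangentSpace 𝓘(ℝ, ℂ) x from w)) _ _).trans
    (congrArg₂ (· + ·)
      (map_smul (g.inner x (show TangentSpace 𝓘(ℝ, ℂ) x from w)) c.re _)
      (map_smul (g.inner x (show TangentSpace 𝓘(ℝ, ℂ) x from w)) c.im _))

theorem form01_add (g : SurfaceMetric S) {x : S} (w v v' : Tan x) :
    form01 g w (v + v') = form01 g w v + form01 g w v' := by
  simp only [form01, smul_add, metricAt_add]
  push_cast
  ring

theorem form01_smul (g : SurfaceMetric S) {x : S} (w v : Tan x) (c : ℂ) :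
    form01 g w (c • v) = starRingEnd ℂ c * form01 g w v := by
  have h1 := metricAt_smul g w v c
  have h2 := metricAt_smul g w v (Complex.I * c)
  rw [mul_smul] at h2
  simp only [form01, h1, h2]
  apply Complex.ext <;> simp <;> ring

/-- Clifford multiplication `c(u) : E → K̄E` by the real covector `u = g(w, ·)`, namely
`ξ ↦ u^{0,1} ∧ ξ`. -/
def cliffUp (g : SurfaceMetric S) {x : S} (w : Tan x) : E x →ₗ[ℂ] KbarE g E x where
  toFun ξ := KbarE.mk
    { toFun := fun v => form01 g w v • ξ
      map_add' := fun v v' => by rw [form01_add, add_smul]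
      map_smul' := fun c v => by rw [form01_smul, mul_smul] }
  map_add' ξ ζ := LinearMap.ext (σ := starRingEnd ℂ) fun v => smul_add (form01 g w v) ξ ζ
  map_smul' c ξ := LinearMap.ext (σ := starRingEnd ℂ) fun v => smul_comm (form01 g w v) c ξ

/-- Clifford multiplication `c(u) : K̄E → E` by the real covector `u = g(w, ·)`, namely
`η ↦ -ι_u η`, where `ι_u` is the adjoint of `u^{0,1} ∧`. -/
def cliffDown (g : SurfaceMetric S) {x : S} (w : Tan x) : KbarE g E x →ₗ[ℂ] E x :=
  -LinearMap.adjoint (cliffUp g w)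

end Fibres

section Bundles

variable {S : Type*} [TopologicalSpace S] [ChartedSpace ℂ S] [IsManifold 𝓘(ℂ, ℂ) ω S]
  (r : ℕ) {E : S → Type*} [TopologicalSpace (TotalSpace (Fib r) E)]
  [∀ x, NormedAddCommGroup (E x)] [∀ x, InnerProductSpace ℂ (E x)]
  [FiberBundle (Fib r) E] [VectorBundle ℂ (Fib r) E]

/-- The preferred local trivialization of `E` near `p`, on the fibre over `x`. -/
def toFib (E : S → Type*) [TopologicalSpace (TotalSpace (Fib r) E)]
    [∀ x, NormedAddCommGroup (E x)] [∀ x, InnerProductSpace ℂ (E x)]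
    [FiberBundle (Fib r) E] [VectorBundle ℂ (Fib r) E] (p x : S) : E x →L[ℂ] Fib r :=
  (trivializationAt (Fib r) E p).continuousLinearMapAt ℂ x

/-- The inverse of `toFib`. -/
def ofFib (E : S → Type*) [TopologicalSpace (TotalSpace (Fib r) E)]
    [∀ x, NormedAddCommGroup (E x)] [∀ x, InnerProductSpace ℂ (E x)]
    [FiberBundle (Fib r) E] [VectorBundle ℂ (Fib r) E] (p x : S) : Fib r →L[ℂ] E x :=
  (trivializationAt (Fib r) E p).symmL ℂ x

/-- The open set of `ℂ`, in the preferred chart at `p`, over which the preferred trivialization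
of `E` at `p` is defined. -/
def chartDomain (E : S → Type*) [TopologicalSpace (TotalSpace (Fib r) E)]
    [∀ x, NormedAddCommGroup (E x)] [∀ x, InnerProductSpace ℂ (E x)]
    [FiberBundle (Fib r) E] [VectorBundle ℂ (Fib r) E] (p : S) : Set ℂ :=
  (chartAt ℂ p).target ∩ (chartAt ℂ p).symm ⁻¹' (trivializationAt (Fib r) E p).baseSet

/-- The Hermitian metric of `E` is smooth: in the local frames its matrix is smooth. -/
def IsSmoothHermitian (E : S → Type*) [TopologicalSpace (TotalSpace (Fib r) E)]
    [∀ x, NormedAddCommGroup (E x)] [∀ x, InnerProductSpace ℂ (E x)]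
    [FiberBundle (Fib r) E] [VectorBundle ℂ (Fib r) E] : Prop :=
  ∀ (p : S) (a b : Fib r), ContDiffOn ℝ ∞ (fun z : ℂ =>
    (inner ℂ (ofFib r E p ((chartAt ℂ p).symm z) a) (ofFib r E p ((chartAt ℂ p).symm z) b) : ℂ))
    (chartDomain r E p)

/-- The `i`-th covector at `x` of the frame of `E*` dual to the local frame at `p`. -/
def coframe (E : S → Type*) [TopologicalSpace (TotalSpace (Fib r) E)]
    [∀ x, NormedAddCommGroup (E x)] [∀ x, InnerProductSpace ℂ (E x)]
    [FiberBundle (Fib r) E] [VectorBundle ℂ (Fib r) E] (p x : S) (i : Fin r) :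
    Module.Dual ℂ (E x) :=
  ((EuclideanSpace.proj i : Fib r →L[ℂ] ℂ) ∘L toFib r E p x).toLinearMap

/-- The coefficients `s^{ij}` of a section `s = ∑ s^{ij} dz̄ ⊗ e_i ⊗ e_j` of `K̄ ⊗ Sym²E` with
respect to the coordinate and the frame at `p`, as functions of the coordinate. -/
def coeff (s : ∀ x, QuadFibre E x) (p : S) (z : ℂ) : Fin r → Fin r → ℂ := fun i j =>
  TensorProduct.lid ℂ ℂ (TensorProduct.map (coframe r E p ((chartAt ℂ p).symm z) i)
    (coframe r E p ((chartAt ℂ p).symm z) j)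
    (s ((chartAt ℂ p).symm z) (coordVec p ((chartAt ℂ p).symm z)) : _ ⊗[ℂ] _))

/-- Smooth sections of `K̄ ⊗ Sym²E`. -/
def QuadSection (E : S → Type*) [TopologicalSpace (TotalSpace (Fib r) E)]
    [∀ x, NormedAddCommGroup (E x)] [∀ x, InnerProductSpace ℂ (E x)]
    [FiberBundle (Fib r) E] [VectorBundle ℂ (Fib r) E] : Type _ :=
  {s : ∀ x, QuadFibre E x // ∀ p : S, ContDiffOn ℝ ∞ (coeff r s p) (chartDomain r E p)}

/-- The `C^∞` topology on smooth sections: uniform convergence of all derivatives of the local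
coefficients, on compact subsets of the coordinate domains. -/
instance : TopologicalSpace (QuadSection r E) :=
  ⨅ (p : S) (n : ℕ), TopologicalSpace.induced
    (fun s : QuadSection r E =>
      UniformOnFun.ofFun {K : Set ℂ | IsCompact K ∧ K ⊆ chartDomain r E p}
        (iteratedFDeriv ℝ n (coeff r s.1 p)))
    inferInstance

variable {r} [∀ x, FiniteDimensional ℂ (E x)]

/-- The singular set `Z_𝒜 = {x | ker 𝒜(x) ≠ 0}`. -/
def singularSet (g : SurfaceMetric S) (s : QuadSection r E) : Set S :=
  {x | LinearMap.ker (bigA g (s.1 x)) ≠ ⊥}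

/-- The zeros of the section `det μ` of `L`. -/
def detZeros (g : SurfaceMetric S) (s : QuadSection r E) : Set S :=
  {x | ∀ v : Tan x, detMu r g (s.1 x) v = 0}

/-- The coefficient of `det μ` with respect to the frame
`dz̄^r ⊗ (e_1 ∧ … ∧ e_r) ⊗ (e_1 ∧ … ∧ e_r)` of `L` at `p`, as a function of the coordinate. -/
def detCoeff (g : SurfaceMetric S) (s : QuadSection r E) (p : S) (z : ℂ) : ℂ :=
  exteriorPower.alternatingMapLinearEquiv
    ((EuclideanSpace.basisFun (Fin r) ℂ).toBasis.det)
    (exteriorPower.map r (toFib r E p ((chartAt ℂ p).symm z)).toLinearMap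
      (detMu r g (s.1 ((chartAt ℂ p).symm z)) (coordVec p ((chartAt ℂ p).symm z))
        (exteriorPower.ιMulti ℂ r (coframe r E p ((chartAt ℂ p).symm z)))))

/-- The derivative `∇(det μ) : T_pΣ → L_p` at a zero `p` of `det μ`, in the oriented coordinate
and the complex frame of `L` at `p`. -/
def detDeriv (g : SurfaceMetric S) (s : QuadSection r E) (p : S) : ℂ →L[ℝ] ℂ :=
  fderiv ℝ (detCoeff g s p) (chartAt ℂ p p)

/-- All zeros of `det μ` are transverse. -/
def HasTransverseZeros (g : SurfaceMetric S) (s : QuadSection r E) : Prop :=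
  ∀ p ∈ detZeros g s, Function.Bijective (detDeriv g s p)

/-- The derivative of `det μ` at `p` preserves orientation. -/
def IsPositive (g : SurfaceMetric S) (s : QuadSection r E) (p : S) : Prop :=
  0 < LinearMap.det (detDeriv g s p : ℂ →ₗ[ℝ] ℂ)

/-- The derivative of `det μ` at `p` reverses orientation. -/
def IsNegative (g : SurfaceMetric S) (s : QuadSection r E) (p : S) : Prop :=
  LinearMap.det (detDeriv g s p : ℂ →ₗ[ℝ] ℂ) < 0

/-! ### Covariant derivatives of `μ` and `μ*` -/

/-- The local trivialization of `K̄E` at `p`: the coefficient of `dz̄`, in the frame of `E`. -/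
def toFibK (g : SurfaceMetric S) (E : S → Type*) [TopologicalSpace (TotalSpace (Fib r) E)]
    [∀ x, NormedAddCommGroup (E x)] [∀ x, InnerProductSpace ℂ (E x)]
    [FiberBundle (Fib r) E] [VectorBundle ℂ (Fib r) E] (p x : S) : KbarE g E x →ₗ[ℂ] Fib r :=
  (toFib r E p x).toLinearMap ∘ₗ KbarE.ev (coordVec p x)

/-- The inverse of `toFibK`, at the points where the coordinate is defined. -/
def ofFibK (g : SurfaceMetric S) (E : S → Type*) [TopologicalSpace (TotalSpace (Fib r) E)]
    [∀ x, NormedAddCommGroup (E x)] [∀ x, InnerProductSpace ℂ (E x)]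
    [FiberBundle (Fib r) E] [VectorBundle ℂ (Fib r) E] (p x : S) : Fib r →ₗ[ℂ] KbarE g E x where
  toFun a := KbarE.mk
    { toFun := fun v => starRingEnd ℂ ((show ℂ from v) / (show ℂ from coordVec p x)) •
        ofFib r E p x a
      map_add' := fun v w => by
        rw [← add_smul, ← map_add, ← add_div]; rfl
      map_smul' := fun c v => by
        rw [← mul_smul, ← map_mul, ← mul_div_assoc]; rfl }
  map_add' a b := LinearMap.ext (σ := starRingEnd ℂ) fun v => by
    have key : ∀ t : ℂ, t • ofFib r E p x (a + b) =
        t • ofFib r E p x a + t • ofFib r E p x b := fun t => by rw [map_add, smul_add]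
    exact key _
  map_smul' c a := LinearMap.ext (σ := starRingEnd ℂ) fun v => by
    have key : ∀ t : ℂ, t • ofFib r E p x (c • a) = c • (t • ofFib r E p x a) := fun t => by
      rw [map_smul, smul_comm]
    exact key _

/-- `μ` in the local trivializations of `E` and `K̄E` at `p`. -/
def muLocal (g : SurfaceMetric S) (s : QuadSection r E) (p : S) (z : ℂ) : Fib r →L[ℝ] Fib r :=
  LinearMap.toContinuousLinearMap
    ((toFibK g E p ((chartAt ℂ p).symm z)).restrictScalars ℝ ∘ₗ
      muR g (s.1 ((chartAt ℂ p).symm z)) ∘ₗ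
        (ofFib r E p ((chartAt ℂ p).symm z)).toLinearMap.restrictScalars ℝ)

/-- `μ*` in the local trivializations of `K̄E` and `E` at `p`. -/
def muAdjLocal (g : SurfaceMetric S) (s : QuadSection r E) (p : S) (z : ℂ) :
    Fib r →L[ℝ] Fib r :=
  LinearMap.toContinuousLinearMap
    ((toFib r E p ((chartAt ℂ p).symm z)).toLinearMap.restrictScalars ℝ ∘ₗ
      muAdj g (s.1 ((chartAt ℂ p).symm z)) ∘ₗ
        (ofFibK g E p ((chartAt ℂ p).symm z)).restrictScalars ℝ)

/-- Real connections on `E` and on `K̄E` at the point `p`: their connection forms at `p` with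
respect to the local trivializations at `p`, so that `∇ξ = dξ + a ξ` on `E` and `∇η = dη + b η`
on `K̄E`. Every pair of connections is of this form at `p`. -/
structure ConnectionsAt (g : SurfaceMetric S) (E : S → Type*) [∀ x, NormedAddCommGroup (E x)]
    [∀ x, InnerProductSpace ℂ (E x)] (p : S) where
  /-- connection form on `E` -/
  a : Tan p →+ (E p →ₗ[ℝ] E p)
  /-- connection form on `K̄E` -/
  b : Tan p →+ (KbarE g E p →ₗ[ℝ] KbarE g E p)
  a_smul (t : ℝ) (v : Tan p) : a ((t : ℂ) • v) = t • a v
  b_smul (t : ℝ) (v : Tan p) : b ((t : ℂ) • v) = t • b v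

/-- `∇_v μ : E_p → (K̄E)_p`. -/
def nablaMu (g : SurfaceMetric S) (s : QuadSection r E) {p : S} (A : ConnectionsAt g E p)
    (v : Tan p) : E p →ₗ[ℝ] KbarE g E p :=
  ((ofFibK g E p p).restrictScalars ℝ ∘ₗ
      (fderiv ℝ (muLocal g s p) (chartAt ℂ p p) (show ℂ from v)).toLinearMap ∘ₗ
        (toFib r E p p).toLinearMap.restrictScalars ℝ)
    + A.b v ∘ₗ muR g (s.1 p) - muR g (s.1 p) ∘ₗ A.a v

/-- `∇_v μ* : (K̄E)_p → E_p`. -/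
def nablaMuAdj (g : SurfaceMetric S) (s : QuadSection r E) {p : S} (A : ConnectionsAt g E p)
    (v : Tan p) : KbarE g E p →ₗ[ℝ] E p :=
  ((ofFib r E p p).toLinearMap.restrictScalars ℝ ∘ₗ
      (fderiv ℝ (muAdjLocal g s p) (chartAt ℂ p p) (show ℂ from v)).toLinearMap ∘ₗ
        (toFibK g E p p).restrictScalars ℝ)
    + A.a v ∘ₗ muAdj g (s.1 p) - muAdj g (s.1 p) ∘ₗ A.b v

/-- `ker μ_p`, as a real vector space. -/
abbrev kerMu (g : SurfaceMetric S) (s : QuadSection r E) (p : S) : Submodule ℝ (E p) :=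
  LinearMap.ker (muR g (s.1 p))

/-- `ker μ_p*`, as a real vector space. -/
abbrev kerMuAdj (g : SurfaceMetric S) (s : QuadSection r E) (p : S) :
    Submodule ℝ (KbarE g E p) :=
  LinearMap.ker (muAdj g (s.1 p))

/-- `M_α = -c(e^α) ∇_{e_α} μ : ker μ_p → ker μ_p`, where `e^α = g(e_α, ·)` is the dual coframe.
The orthogonal projection onto `ker μ_p` makes the map land in the kernel. -/
def opM (g : SurfaceMetric S) (s : QuadSection r E) {p : S} (A : ConnectionsAt g E p)
    (e : Fin 2 → Tan p) (α : Fin 2) : Module.End ℝ (kerMu g s p) :=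
  (kerMu g s p).orthogonalProjectionOnto.toLinearMap ∘ₗ
    (-((cliffDown g (e α)).restrictScalars ℝ ∘ₗ nablaMu g s A (e α))) ∘ₗ (kerMu g s p).subtype

/-- `M̂_α = -c(e^α) ∇_{e_α} μ* : ker μ_p* → ker μ_p*`. -/
def opMHat (g : SurfaceMetric S) (s : QuadSection r E) {p : S} (A : ConnectionsAt g E p)
    (e : Fin 2 → Tan p) (α : Fin 2) : Module.End ℝ (kerMuAdj g s p) :=
  (kerMuAdj g s p).orthogonalProjectionOnto.toLinearMap ∘ₗ
    (-((cliffUp g (e α)).restrictScalars ℝ ∘ₗ nablaMuAdj g s A (e α))) ∘ₗ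
      (kerMuAdj g s p).subtype

/-- The sum of the eigenspaces of `M` with positive eigenvalues. -/
def positiveSpace {V : Type*} [AddCommGroup V] [Module ℝ V] (M : Module.End ℝ V) :
    Submodule ℝ V :=
  ⨆ t : {t : ℝ // 0 < t}, M.eigenspace t.1

/-- `𝒦_p = ⋂_α K_α⁺ ⊆ ker μ_p`. -/
def calK (g : SurfaceMetric S) (s : QuadSection r E) {p : S} (A : ConnectionsAt g E p)
    (e : Fin 2 → Tan p) : Submodule ℝ (kerMu g s p) :=
  ⨅ α, positiveSpace (opM g s A e α)

/-- `𝒦̂_p ⊆ ker μ_p*`. -/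
def calKHat (g : SurfaceMetric S) (s : QuadSection r E) {p : S} (A : ConnectionsAt g E p)
    (e : Fin 2 → Tan p) : Submodule ℝ (kerMuAdj g s p) :=
  ⨅ α, positiveSpace (opMHat g s A e α)

/-- Each of the two families `{M_α}` and `{M̂_α}` commutes. -/
def IsCommutingFrame (g : SurfaceMetric S) (s : QuadSection r E) {p : S}
    (A : ConnectionsAt g E p) (e : Fin 2 → Tan p) : Prop :=
  (∀ α β, Commute (opM g s A e α) (opM g s A e β)) ∧
    ∀ α β, Commute (opMHat g s A e α) (opMHat g s A e β)

/-- Non-degeneracy of the zero `p`, that is `𝒜*𝒜|_K = r² M + O(r³)` with `M` symmetric and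
positive definite, expressed through the leading coefficient: for `k ∈ ker μ_p` the part of
`(∇_v μ) k` in `ker μ_p*` has square length `|v|² ⟨M k, k⟩`. -/
def IsNondegenerate (g : SurfaceMetric S) (s : QuadSection r E) {p : S}
    (A : ConnectionsAt g E p) : Prop :=
  ∃ M : Module.End ℝ (kerMu g s p), M.IsSymmetric ∧
    (∀ k, k ≠ 0 → 0 < (inner ℝ (M k) k : ℝ)) ∧
    ∀ (v : Tan p) (k : kerMu g s p),
      ‖(kerMuAdj g s p).orthogonalProjectionOnto (nablaMu g s A v k)‖ ^ 2 =
        metricAt g p v v * inner ℝ (M k) k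

end Bundles

end CrrLemma

end

set_option linter.unusedSectionVars false

/-! In a local coordinate and frame a section is a symmetric matrix function `N(z)`. The kernel of
`μ` corresponds to the kernel of `N` through `ξ ↦ (⟨e_i, ξ⟩)`, and `det μ` is `det N`. A change of
coordinate and frame replaces `N` by a nonzero scalar times `T N Tᵀ`, so transversality of a zero is
independent of these choices.

Openness: transversality over a compact set is an open condition on the 1-jet of `N`. Density is a
parametric Sard argument with constant symmetric perturbations `B`, cut off by a bump function. A
symmetric `N` with `N k = 0` and `k_j = 1` is `Pᵀ X P`, where `P` projects along `k` and only the
block of `X` off the index `j` matters. This block, the remaining entries of `k` and the base point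
`z` together fill exactly one symmetric matrix of parameters. So `perturbMap`, which sends these
data to `Pᵀ X P - m(z)`, maps a space to itself; its critical values form a null set
(`ae_planeDet_ne_zero`), and a `B` outside them makes all zeros transverse
(`planeDet_ne_zero_of_regular`). Compactness of the surface leaves finitely many such sets to
intersect (`isOpen_and_dense_hasTransverseZeros`).

At a transverse zero the adjugate of `N` is nonzero, so `ker μ` is a complex line `ℂ k`, and `ker
μ*` is the line of `dz̄ ⊗ k`. On these lines `∇_v μ` and `∇_v μ*` both act as `l ↦ D(v) l̄`, with
one real-linear `D : ℂ → ℂ` that does not see the connections (`inner_nablaMu`, `inner_nablaMuAdj`).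
The derivative of `det μ` is a nonzero complex multiple of `D` (`exists_kernel_line`), so `det D`
has the sign of the zero.

With Clifford multiplication, `M_α` becomes `l ↦ c_α l̄` and `M̂_α` becomes `l ↦ ĉ_α l̄`, where
`c_α` is a positive multiple of `conj(e_α) D(e_α)` and `ĉ_α` is the same multiple of `-e_α D(e_α)`.
A conjugate-linear map `l ↦ c l̄` with `c ≠ 0` has eigenvalues `±|c|`, each on a real line. Two of
them commute iff `c_0 c̄_1` is real; their positive lines then coincide if this number is positive
and meet in zero if it is negative. For an orthonormal frame `ĉ_0 conj(ĉ_1) = -c_0 c̄_1`, and the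
real part of `c_0 c̄_1` is a positive multiple of `det D`. This gives the dichotomy
(`calK_of_planeDet`). The imaginary part is a positive multiple of `Re (D(v) conj(D(iv)))` with `v =
e_0`, a trace-free quadratic form in `v`, which vanishes in some direction, and in every direction
if `D` is conformal. -/

noncomputable section

namespace CrrLemma

attribute [local instance] InnerProductSpace.complexToReal

/-! ### Determinants of real-linear maps of the plane -/

section PlaneMaps

/-- The determinant of a real-linear map of the complex plane. -/
def planeDet (L : ℂ → ℂ) : ℝ := (starRingEnd ℂ (L 1) * L Complex.I).im

theorem det_eq_planeDet (L : ℂ →ₗ[ℝ] ℂ) : LinearMap.det L = planeDet L := by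
  rw [← LinearMap.det_toMatrix Complex.basisOneI, Matrix.det_fin_two]
  simp [LinearMap.toMatrix_apply, planeDet]
  ring

theorem bijective_iff_det_ne_zero (L : ℂ →L[ℝ] ℂ) :
    Function.Bijective L ↔ LinearMap.det (L : ℂ →ₗ[ℝ] ℂ) ≠ 0 := by
  rw [← isUnit_iff_ne_zero, ← LinearMap.isUnit_iff_isUnit_det, Module.End.isUnit_iff]
  rfl

theorem surjective_iff_planeDet_ne_zero (L : ℂ →L[ℝ] ℂ) :
    Function.Surjective L ↔ planeDet L ≠ 0 := by
  rw [← ContinuousLinearMap.coe_coe, ← det_eq_planeDet, ← bijective_iff_det_ne_zero]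
  exact ⟨fun h => ⟨(LinearMap.injective_iff_surjective (f := (L : ℂ →ₗ[ℝ] ℂ))).2 h, h⟩,
    fun h => h.2⟩

/-- Multiplication by `c` is a similarity, so it keeps the sign of the determinant when `c ≠ 0`. -/
theorem planeDet_smul (c : ℂ) (L : ℂ → ℂ) :
    planeDet (fun v => c * L v) = ‖c‖ ^ 2 * planeDet L := by
  simp only [planeDet, map_mul]
  rw [← Complex.normSq_eq_norm_sq, ← Complex.im_ofReal_mul, ← Complex.mul_conj]
  congr 1
  ring

end PlaneMaps

/-! ### Adjugate and determinant derivative at a singular symmetric matrix -/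

section Matrices

variable {ι : Type*} [Fintype ι] [DecidableEq ι]

/-- The value `kᵀ H k` of the bilinear form with matrix `H`. -/
def quadVal (k : ι → ℂ) (H : ι → ι → ℂ) : ℂ := ∑ a, ∑ b, k a * H a b * k b

theorem quadVal_eq (k : ι → ℂ) (H : ι → ι → ℂ) : quadVal k H = k ⬝ᵥ (Matrix.of H).mulVec k := by
  simp [quadVal, dotProduct, Matrix.mulVec, Finset.mul_sum, mul_assoc]

/-- The derivative of the determinant. -/
theorem hasFDerivAt_det {F : Type*} [NormedAddCommGroup F] [NormedSpace ℝ F]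
    {m : F → ι → ι → ℂ} {m' : F →L[ℝ] ι → ι → ℂ} {z : F} (hm : HasFDerivAt m m' z) :
    ∃ L : F →L[ℝ] ℂ, HasFDerivAt (fun z => (Matrix.of (m z)).det) L z ∧
      ∀ v, L v = ∑ a, ∑ b, (Matrix.of (m z)).adjugate b a * m' v a b := by
  let f : ContinuousMultilinearMap ℂ (fun _ : ι => ι → ℂ) ℂ :=
    { (Matrix.detRowAlternating (n := ι) (R := ℂ)).toMultilinearMap with
      cont := by
        change Continuous fun A : ι → ι → ℂ => (Matrix.of A).det
        exact Continuous.matrix_det continuous_id }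
  have h := ((f.hasFDerivAt (x := m z)).restrictScalars ℝ).comp z hm
  refine ⟨_, h, fun v => ?_⟩
  simp only [ContinuousLinearMap.comp_apply, ContinuousLinearMap.coe_restrictScalars',
    ContinuousMultilinearMap.linearDeriv_apply]
  refine Finset.sum_congr rfl fun a _ => ?_
  change ((Matrix.of (m z)).updateRow a (m' v a)).det = _
  rw [← Matrix.cramer_transpose_apply, Matrix.cramer_eq_adjugate_mulVec, Matrix.mulVec,
    dotProduct]
  simp [← Matrix.adjugate_transpose]

/-- The diagonal cofactor is the determinant of `N` with row `j` replaced by the unit row. That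
matrix annihilates `w - w j • k`, so a nonzero cofactor makes the kernel a line. -/
theorem eq_smul_of_adjugate_ne_zero {N : Matrix ι ι ℂ} {k : ι → ℂ} {j : ι}
    (hk : k j = 1) (hNk : N.mulVec k = 0) (h : N.adjugate j j ≠ 0) {w : ι → ℂ}
    (hw : N.mulVec w = 0) : w = w j • k := by
  by_contra hne
  refine h ?_
  rw [Matrix.adjugate_apply, ← Matrix.exists_mulVec_eq_zero_iff]
  refine ⟨w - w j • k, sub_ne_zero.2 hne, funext fun i => ?_⟩
  rcases eq_or_ne i j with rfl | hi
  · simp [Matrix.mulVec, hk]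
  · have : N.mulVec (w - w j • k) i = 0 := by
      rw [Matrix.mulVec_sub, Matrix.mulVec_smul, hw, hNk]; simp
    simpa [Matrix.mulVec, Matrix.updateRow_ne hi] using this

/-- A kernel vector `w` of the row-replaced matrix has `w j = 0` and satisfies every equation of `N`
except the `j`-th. The missing one follows from `kᵀ N w = 0`, which is symmetry, and `k j = 1`. -/
theorem exists_ker_of_adjugate_eq_zero {N : Matrix ι ι ℂ} (hN : N.IsSymm) {k : ι → ℂ} {j : ι}
    (hk : k j = 1) (hNk : N.mulVec k = 0) (h : N.adjugate j j = 0) :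
    ∃ w : ι → ℂ, w ≠ 0 ∧ w j = 0 ∧ N.mulVec w = 0 := by
  rw [Matrix.adjugate_apply, ← Matrix.exists_mulVec_eq_zero_iff] at h
  obtain ⟨w, hw0, hw⟩ := h
  have hwj : w j = 0 := by
    have := congrFun hw j
    simpa [Matrix.mulVec] using this
  have hi : ∀ i, i ≠ j → N.mulVec w i = 0 := fun i hi => by
    have := congrFun hw i
    simpa [Matrix.mulVec, Matrix.updateRow_ne hi] using this
  refine ⟨w, hw0, hwj, funext fun i => ?_⟩
  rcases eq_or_ne i j with rfl | hij
  · have h1 : k ⬝ᵥ N.mulVec w = 0 := by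
      rw [Matrix.dotProduct_mulVec, ← Matrix.mulVec_transpose, hN.eq, hNk, zero_dotProduct]
    rw [dotProduct, Finset.sum_eq_single i (fun b _ hb => by rw [hi b hb, mul_zero])
      (by simp), hk, one_mul] at h1
    exact h1
  · exact hi i hij

/-- The adjugate of a singular symmetric matrix. -/
theorem adjugate_apply_of_ker {N : Matrix ι ι ℂ} (hN : N.IsSymm) {k : ι → ℂ} {j : ι}
    (hk : k j = 1) (hNk : N.mulVec k = 0) (a b : ι) :
    N.adjugate a b = N.adjugate j j * (k a * k b) := by
  -- If the cofactor vanishes, the kernel contains the independent vectors `k` and `w`, hence for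
  -- each `a` a nonzero vector with vanishing `a`-th entry, and every cofactor is zero. Otherwise
  -- the columns of the adjugate lie in the kernel line, and symmetry determines the factors.
  by_cases h : N.adjugate j j = 0
  · obtain ⟨w, hw0, hwj, hw⟩ := exists_ker_of_adjugate_eq_zero hN hk hNk h
    rw [h, zero_mul, Matrix.adjugate_apply, ← Matrix.exists_mulVec_eq_zero_iff]
    obtain ⟨u, hu0, hua, hu⟩ : ∃ u : ι → ℂ, u ≠ 0 ∧ u a = 0 ∧ N.mulVec u = 0 := by
      by_cases hwa : w a = 0
      · exact ⟨w, hw0, hwa, hw⟩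
      · refine ⟨k - (k a / w a) • w, fun h0 => ?_, ?_, ?_⟩
        · have := congrFun h0 j
          simp [hk, hwj] at this
        · simp [hwa]
        · rw [Matrix.mulVec_sub, Matrix.mulVec_smul, hw, hNk]; simp
    refine ⟨u, hu0, funext fun i => ?_⟩
    rcases eq_or_ne i b with rfl | hi
    · simp [Matrix.mulVec, hua]
    · have := congrFun hu i
      simpa [Matrix.mulVec, Matrix.updateRow_ne hi] using this
  · have hdet : N.det = 0 := by
      rw [← Matrix.exists_mulVec_eq_zero_iff]
      exact ⟨k, fun h0 => by simp [h0] at hk, hNk⟩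
    have hcol : ∀ a b, N.adjugate a b = N.adjugate j b * k a := fun a b => by
      have h1 : N.mulVec (fun i => N.adjugate i b) = 0 := by
        have := N.mul_adjugate
        rw [hdet, zero_smul] at this
        funext i
        exact congrFun (congrFun this i) b
      exact congrFun (eq_smul_of_adjugate_ne_zero hk hNk h h1) a
    have hsym : N.adjugate j b = N.adjugate b j := by
      have := N.adjugate_transpose
      rw [hN.eq] at this
      exact congrFun (congrFun this b) j
    rw [hcol a b, hsym, hcol b j]
    ring

/-- The derivative of the determinant at a singular symmetric matrix. -/
theorem hasFDerivAt_det_of_ker {F : Type*} [NormedAddCommGroup F] [NormedSpace ℝ F]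
    {m : F → ι → ι → ℂ} {m' : F →L[ℝ] ι → ι → ℂ} {z : F}
    (hm : HasFDerivAt m m' z) (hN : (Matrix.of (m z)).IsSymm) {k : ι → ℂ} {j : ι}
    (hk : k j = 1) (hNk : (Matrix.of (m z)).mulVec k = 0) :
    ∃ L : F →L[ℝ] ℂ, HasFDerivAt (fun z => (Matrix.of (m z)).det) L z ∧
      ∀ v, L v = (Matrix.of (m z)).adjugate j j * quadVal k (m' v) := by
  obtain ⟨L, hL, h⟩ := hasFDerivAt_det hm
  refine ⟨L, hL, fun v => ?_⟩
  rw [h, quadVal, Finset.mul_sum]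
  refine Finset.sum_congr rfl fun a _ => ?_
  rw [Finset.mul_sum]
  refine Finset.sum_congr rfl fun b _ => ?_
  rw [adjugate_apply_of_ker hN hk hNk]
  ring

end Matrices

/-! ### Sard's argument for families of symmetric matrices -/

section GenericSymmetric

open Matrix

variable {ι : Type*} [Fintype ι] [DecidableEq ι]

/-- The symmetric matrix with entries `x s(a, b)`. -/
def symMat (x : Sym2 ι → ℂ) : Matrix ι ι ℂ := Matrix.of fun a b => x s(a, b)

theorem symMat_isSymm (x : Sym2 ι → ℂ) : (symMat x).IsSymm :=
  Matrix.ext fun _ _ => congrArg x Sym2.eq_swap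

/-- The symmetric part of a matrix. -/
def symPart : (ι → ι → ℂ) →L[ℝ] (Sym2 ι → ℂ) :=
  LinearMap.toContinuousLinearMap
    { toFun := fun M e => e.lift ⟨fun a b => (M a b + M b a) / 2, fun a b =>
        congrArg (· / 2) (add_comm (M a b) (M b a))⟩
      map_add' := fun M N => funext fun e => by
        induction e using Sym2.ind
        simp only [Sym2.lift_mk, Pi.add_apply]
        ring
      map_smul' := fun c M => funext fun e => by
        induction e using Sym2.ind
        simp only [Sym2.lift_mk, Pi.smul_apply, Complex.real_smul, RingHom.id_apply]
        ring }

theorem symPart_apply (M : ι → ι → ℂ) (a b : ι) : symPart M s(a, b) = (M a b + M b a) / 2 := rfl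

theorem symPart_symMat (x : Sym2 ι → ℂ) : symPart (fun a b => symMat x a b) = x := by
  funext e
  induction e using Sym2.ind with
  | _ a b =>
    rw [symPart_apply]
    simp only [symMat, Matrix.of_apply, Sym2.eq_swap (a := b)]
    ring

/-- A vector with `j`-th entry `1`, whose other entries are read off from the `j`-th column. -/
def kerVec (j : ι) (x : Sym2 ι → ℂ) : ι → ℂ := fun a => if a = j then 1 else x s(a, j)

/-- The projection along `kerVec j x` onto the vectors with vanishing `j`-th entry. -/
def kerProj (j : ι) (x : Sym2 ι → ℂ) : Matrix ι ι ℂ :=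
  1 - Matrix.vecMulVec (kerVec j x) (Pi.single j 1)

/-- A parametrization of the symmetric matrices that annihilate some vector with `j`-th
entry `1`. -/
def singularParam (j : ι) (x : Sym2 ι → ℂ) : Matrix ι ι ℂ :=
  (kerProj j x)ᵀ * symMat x * kerProj j x

theorem kerVec_self (j : ι) (x : Sym2 ι → ℂ) : kerVec j x j = 1 := by simp [kerVec]

theorem kerProj_mulVec (j : ι) (x : Sym2 ι → ℂ) (w : ι → ℂ) :
    kerProj j x *ᵥ w = w - w j • kerVec j x := by
  rw [kerProj, Matrix.sub_mulVec, Matrix.one_mulVec, Matrix.vecMulVec_mulVec]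
  simp

theorem kerProj_row (j : ι) (x : Sym2 ι → ℂ) (a : ι) : kerProj j x j a = 0 := by
  simp [kerProj, Matrix.vecMulVec_apply, kerVec_self, Matrix.one_apply, Pi.single_apply, eq_comm]

/-- The `j`-th row of the projection is zero. Hence the `j`-th row and column of the middle factor
do not matter, and these entries are free to encode the kernel vector and the base point. -/
theorem singularParam_congr {j : ι} (x : Sym2 ι → ℂ) {X Y : Matrix ι ι ℂ}
    (h : ∀ a b, a ≠ j → b ≠ j → X a b = Y a b) :
    (kerProj j x)ᵀ * X * kerProj j x = (kerProj j x)ᵀ * Y * kerProj j x := by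
  ext a b
  simp only [Matrix.mul_apply, Matrix.transpose_apply, Finset.sum_mul]
  refine Finset.sum_congr rfl fun d _ => Finset.sum_congr rfl fun c _ => ?_
  rcases eq_or_ne c j with rfl | hc
  · simp [kerProj_row]
  rcases eq_or_ne d j with rfl | hd
  · simp [kerProj_row]
  rw [h c d hc hd]

theorem singularParam_mulVec (j : ι) (x : Sym2 ι → ℂ) : singularParam j x *ᵥ kerVec j x = 0 := by
  rw [singularParam, ← Matrix.mulVec_mulVec, kerProj_mulVec, kerVec_self, one_smul, sub_self,
    Matrix.mulVec_zero]

theorem singularParam_isSymm (j : ι) (x : Sym2 ι → ℂ) : (singularParam j x).IsSymm := by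
  rw [Matrix.IsSymm, singularParam, Matrix.transpose_mul, Matrix.transpose_mul,
    Matrix.transpose_transpose, (symMat_isSymm x).eq, Matrix.mul_assoc]

/-- Every symmetric matrix with a kernel vector is parametrized, and one entry of the parameter is
free. -/
theorem exists_singularParam {N : Matrix ι ι ℂ} (hN : N.IsSymm) {k : ι → ℂ} {j : ι}
    (hk : k j = 1) (hNk : N *ᵥ k = 0) (z : ℂ) :
    ∃ x, x s(j, j) = z ∧ kerVec j x = k ∧ singularParam j x = N := by
  -- The entry `(j, j)` stores `z`, the rest of the `j`-th column stores `k`, and the remaining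
  -- block is that of `N`.
  let x : Sym2 ι → ℂ := fun e => e.lift ⟨fun a b =>
    if a = j then (if b = j then z else k b) else if b = j then k a else N a b, fun a b => by
      dsimp only
      split_ifs <;> simp_all [hN.apply a b]⟩
  have hx : ∀ a b, x s(a, b) =
    if a = j then (if b = j then z else k b) else if b = j then k a else N a b := fun _ _ => rfl
  have hkx : kerVec j x = k := by
    funext a
    by_cases h : a = j <;> simp [kerVec, hx, h, hk]
  refine ⟨x, by simp [hx], hkx, ?_⟩
  -- The projection is along a kernel vector of `N`, so it changes nothing on the right, nor, by
  -- transposition, on the left.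
  have hNP : N * kerProj j x = N := by
    rw [kerProj, Matrix.mul_sub, Matrix.mul_one, Matrix.mul_vecMulVec, hkx, hNk]
    simp
  have hPN : (kerProj j x)ᵀ * N = N := by
    have := congrArg Matrix.transpose hNP
    rwa [Matrix.transpose_mul, hN.eq] at this
  have h : (kerProj j x)ᵀ * symMat x * kerProj j x = (kerProj j x)ᵀ * N * kerProj j x :=
    singularParam_congr x fun a b ha hb => by simp [symMat, hx, ha, hb]
  rw [singularParam, h, hPN, hNP]

theorem kerProj_add_smul (j : ι) (x y : Sym2 ι → ℂ) (t : ℝ) :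
    kerProj j (x + t • y) = kerProj j x -
      (t : ℂ) • Matrix.vecMulVec (fun a => if a = j then 0 else y s(a, j)) (Pi.single j 1) := by
  have h : kerVec j (x + t • y) =
      kerVec j x + (t : ℂ) • (fun a => if a = j then 0 else y s(a, j)) := by
    funext a
    by_cases h : a = j <;> simp [kerVec, h]
  rw [kerProj, h, Matrix.add_vecMulVec, Matrix.smul_vecMulVec, kerProj]
  abel

/-- The moved projection sends the old kernel vector to a vector of order `t`, and it occurs on both
sides. So the tangent directions to the singular matrices are invisible to `kᵀ · k`. -/
theorem dotProduct_singularParam_add_smul (j : ι) (x y : Sym2 ι → ℂ) (t : ℝ) :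
    kerVec j x ⬝ᵥ (singularParam j (x + t • y) *ᵥ kerVec j x) =
      (t : ℂ) ^ 2 * ((fun a => if a = j then 0 else y s(a, j)) ⬝ᵥ
        (symMat (x + t • y) *ᵥ (fun a => if a = j then 0 else y s(a, j)))) := by
  have h : kerProj j (x + t • y) *ᵥ kerVec j x =
      (-(t : ℂ)) • (fun a => if a = j then 0 else y s(a, j)) := by
    rw [kerProj_add_smul, Matrix.sub_mulVec, kerProj_mulVec, kerVec_self, Matrix.smul_mulVec,
      Matrix.vecMulVec_mulVec]
    simp [kerVec_self]
  rw [singularParam, Matrix.mul_assoc, ← Matrix.mulVec_mulVec, ← Matrix.mulVec_mulVec, h,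
    Matrix.dotProduct_mulVec, ← Matrix.mulVec_transpose, Matrix.transpose_transpose, h,
    Matrix.mulVec_smul, smul_dotProduct, dotProduct_smul]
  simp only [smul_eq_mul]
  ring

/-- The direction `y` only tilts the kernel vector by `w`. The linear terms contain `Pᵀ X w`, which
equals `N w = 0` because `P w = w`; what survives is quadratic in `t`. -/
theorem singularParam_add_smul_of_ker {j : ι} {x : Sym2 ι → ℂ} {w : ι → ℂ} (hwj : w j = 0)
    (hw : singularParam j x *ᵥ w = 0) {y : Sym2 ι → ℂ}
    (hy : ∀ a b, y s(a, b) = w a * (if b = j then 1 else 0) + (if a = j then 1 else 0) * w b)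
    (t : ℝ) :
    singularParam j (x + t • y) = singularParam j x +
      (t ^ 2 : ℂ) • (Matrix.vecMulVec (Pi.single j 1) w * symMat x *
        Matrix.vecMulVec w (Pi.single j 1)) := by
  have hyw : (fun a => if a = j then 0 else y s(a, j)) = w := by
    funext a
    by_cases h : a = j <;> simp [hy, h, hwj]
  have h0 : singularParam j (x + t • y) =
      (kerProj j (x + t • y))ᵀ * symMat x * kerProj j (x + t • y) :=
    singularParam_congr _ fun a b ha hb => by simp [symMat, hy, ha, hb]
  have h1 : ((kerProj j x)ᵀ * symMat x) *ᵥ w = 0 := by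
    rw [singularParam, ← Matrix.mulVec_mulVec, kerProj_mulVec, hwj, zero_smul, sub_zero] at hw
    exact hw
  have h2 : (kerProj j x)ᵀ * symMat x * Matrix.vecMulVec w (Pi.single j 1) = 0 := by
    rw [Matrix.mul_vecMulVec, h1]
    simp
  have h3 : Matrix.vecMulVec (Pi.single j 1) w * symMat x * kerProj j x = 0 := by
    have := congrArg Matrix.transpose h2
    rwa [Matrix.transpose_mul, Matrix.transpose_mul, Matrix.transpose_transpose,
      (symMat_isSymm x).eq, Matrix.transpose_vecMulVec, ← Matrix.mul_assoc,
      Matrix.transpose_zero] at this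
  rw [h0, kerProj_add_smul, hyw, Matrix.transpose_sub, Matrix.transpose_smul,
    Matrix.transpose_vecMulVec, Matrix.sub_mul, Matrix.sub_mul, Matrix.mul_sub, Matrix.mul_sub,
    Matrix.mul_smul, h2, Matrix.smul_mul, Matrix.smul_mul, h3, Matrix.smul_mul, Matrix.mul_smul,
    smul_smul, singularParam]
  simp [sq]

theorem differentiable_singularParam (j : ι) :
    Differentiable ℝ (fun x : Sym2 ι → ℂ => (fun a b => singularParam j x a b)) := by
  have hk : ∀ a, Differentiable ℝ fun x : Sym2 ι → ℂ => kerVec j x a := fun a => by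
    by_cases h : a = j
    · simp [kerVec, h]
    · simp only [kerVec, h, if_false]
      fun_prop
  have hP : ∀ a b, Differentiable ℝ fun x : Sym2 ι → ℂ => kerProj j x a b := fun a b => by
    simp only [kerProj, Matrix.sub_apply, Matrix.vecMulVec_apply]
    exact (differentiable_const _).sub ((hk a).mul (differentiable_const _))
  refine differentiable_pi.2 fun a => differentiable_pi.2 fun b => ?_
  simp only [singularParam, Matrix.mul_apply, Matrix.transpose_apply, symMat, Matrix.of_apply]
  refine Differentiable.fun_sum fun d _ => Differentiable.mul ?_ (hP _ _)
  exact Differentiable.fun_sum fun c _ => (hP _ _).mul (by fun_prop)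

/-- The map whose critical values are the bad perturbations of `m`. -/
def perturbMap (m : ℂ → ι → ι → ℂ) (j : ι) (x : Sym2 ι → ℂ) : Sym2 ι → ℂ :=
  symPart (fun a b => singularParam j x a b) - symPart (m (x s(j, j)))

theorem differentiableAt_perturbMap {m : ℂ → ι → ι → ℂ} {j : ι} {x : Sym2 ι → ℂ}
    (hm : DifferentiableAt ℝ m (x s(j, j))) :
    DifferentiableAt ℝ (perturbMap m j) x := by
  have h1 : DifferentiableAt ℝ (fun x : Sym2 ι → ℂ => x s(j, j)) x := by fun_prop
  exact (symPart.differentiableAt.comp x (differentiable_singularParam j x)).sub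
    (symPart.differentiableAt.comp x (hm.comp x h1))

theorem hasDerivAt_sq_mul {F : Type*} [NormedAddCommGroup F] [NormedSpace ℂ F] {q : ℝ → F}
    (hq : DifferentiableAt ℝ q 0) : HasDerivAt (fun t : ℝ => ((t : ℂ) ^ 2) • q t) 0 0 := by
  have h1 : HasDerivAt (fun t : ℝ => (t : ℂ) ^ 2) 0 0 := by
    have h := (Complex.ofRealCLM.hasDerivAt (x := (0 : ℝ))).fun_pow 2
    refine h.congr_deriv ?_
    simp
  refine (h1.fun_smul hq.hasDerivAt).congr_deriv ?_
  simp

/-- At a regular point of `perturbMap m j` the determinant of the perturbed family has a transverse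
zero. -/
theorem planeDet_ne_zero_of_regular {m : ℂ → ι → ι → ℂ} {j : ι} {x B : Sym2 ι → ℂ}
    (hm : DifferentiableAt ℝ m (x s(j, j)))
    (hN : (Matrix.of (m (x s(j, j))) + symMat B) = singularParam j x)
    (hreg : (fderiv ℝ (perturbMap m j) x).det ≠ 0) :
    planeDet (fderiv ℝ (fun z => (Matrix.of (m z) + symMat B).det) (x s(j, j))) ≠ 0 := by
  set L := fderiv ℝ (perturbMap m j) x with hL
  have hbij : Function.Bijective L := by
    have : IsUnit (LinearMap.det (L : (Sym2 ι → ℂ) →ₗ[ℝ] (Sym2 ι → ℂ))) :=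
      isUnit_iff_ne_zero.2 hreg
    rw [← LinearMap.isUnit_iff_isUnit_det, Module.End.isUnit_iff] at this
    exact this
  have hline : ∀ y, HasDerivAt (fun t : ℝ => perturbMap m j (x + t • y)) (L y) 0 := fun y =>
    (differentiableAt_perturbMap hm).hasFDerivAt.hasLineDerivAt y
  have hk := kerVec_self j x
  have hNk := singularParam_mulVec j x
  have hsym := singularParam_isSymm j x
  have hmd := hm.hasFDerivAt
  set m' := fderiv ℝ m (x s(j, j)) with hm'
  have hmB : HasFDerivAt (fun z a b => m z a b + symMat B a b) m' (x s(j, j)) :=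
    hmd.add_const (fun a b => symMat B a b)
  have hNB : (Matrix.of fun a b => m (x s(j, j)) a b + symMat B a b) = singularParam j x := hN
  obtain ⟨D, hD, hDv⟩ := hasFDerivAt_det_of_ker hmB (by rw [hNB]; exact hsym) hk
    (by rw [hNB]; exact hNk)
  rw [hNB] at hDv
  -- the kernel is a line
  have hadj : (singularParam j x).adjugate j j ≠ 0 := by
    intro h0
    -- With a second kernel vector `w`, tilting `k` towards `w` fixes the base point and moves the
    -- matrix only to second order. This direction `y` is then a nonzero vector in the kernel of
    -- `L`.
    obtain ⟨w, hw0, hwj, hw⟩ := exists_ker_of_adjugate_eq_zero hsym hk hNk h0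
    let y : Sym2 ι → ℂ := fun e => e.lift ⟨fun a b =>
      w a * (if b = j then 1 else 0) + (if a = j then 1 else 0) * w b, fun a b => by
        dsimp only; ring⟩
    have hy : ∀ a b, y s(a, b) =
      w a * (if b = j then 1 else 0) + (if a = j then 1 else 0) * w b := fun _ _ => rfl
    have hyj : y s(j, j) = 0 := by simp [hy, hwj]
    have hconst : HasDerivAt (fun t : ℝ => perturbMap m j (x + t • y)) 0 0 := by
      set C : Matrix ι ι ℂ := Matrix.vecMulVec (Pi.single j 1) w * symMat x *
        Matrix.vecMulVec w (Pi.single j 1)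
      have h1 : HasDerivAt (fun t : ℝ => perturbMap m j x + symPart
          (((t : ℂ) ^ 2) • fun a b => C a b)) 0 0 := by
        have := symPart.hasFDerivAt.comp_hasDerivAt (0 : ℝ)
          (hasDerivAt_sq_mul (differentiableAt_const (fun a b => C a b)))
        simpa using this.const_add (perturbMap m j x)
      refine h1.congr_of_eventuallyEq (Filter.Eventually.of_forall fun t => ?_)
      have hxj : (x + t • y) s(j, j) = x s(j, j) := by simp [hyj]
      simp only [perturbMap]
      rw [hxj, singularParam_add_smul_of_ker hwj hw hy t, sub_add_eq_add_sub, ← map_add]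
      rfl
    have hLy : L y = 0 := (hline y).unique hconst
    have hy0 : y = 0 := hbij.1 (hLy.trans (map_zero L).symm)
    refine hw0 (funext fun a => ?_)
    have := congrFun hy0 s(a, j)
    rcases eq_or_ne a j with rfl | ha
    · exact hwj
    · simpa [hy, ha] using this
  -- the derivative of the kernel value is onto
  let Φ : (Sym2 ι → ℂ) →L[ℝ] ℂ := LinearMap.toContinuousLinearMap
    { toFun := fun y => quadVal (kerVec j x) fun a b => y s(a, b)
      map_add' := fun y y' => by
        simp only [quadVal, Pi.add_apply, mul_add, add_mul, Finset.sum_add_distrib]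
      map_smul' := fun c y => by
        simp only [quadVal, Pi.smul_apply, Complex.real_smul, RingHom.id_apply, Finset.mul_sum]
        exact Finset.sum_congr rfl fun a _ => Finset.sum_congr rfl fun b _ => by ring }
  have hΦ : ∀ M : ι → ι → ℂ, Φ (symPart M) = quadVal (kerVec j x) M := fun M => by
    change ∑ a, ∑ b, kerVec j x a * symPart M s(a, b) * kerVec j x b = _
    have : quadVal (kerVec j x) M =
        (quadVal (kerVec j x) M + ∑ a, ∑ b, kerVec j x a * M b a * kerVec j x b) / 2 := by
      have h : quadVal (kerVec j x) M = ∑ a, ∑ b, kerVec j x a * M b a * kerVec j x b := by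
        rw [quadVal, Finset.sum_comm]
        exact Finset.sum_congr rfl fun a _ => Finset.sum_congr rfl fun b _ => by ring
      rw [← h]; ring
    rw [this, quadVal, ← Finset.sum_add_distrib, Finset.sum_div]
    refine Finset.sum_congr rfl fun a _ => ?_
    rw [← Finset.sum_add_distrib, Finset.sum_div]
    refine Finset.sum_congr rfl fun b _ => ?_
    rw [symPart_apply]
    ring
  -- Under `kᵀ · k` the singular part contributes only at order `t ^ 2`, which leaves the derivative
  -- of `m` in the direction of the base point.
  have hΦL : ∀ y, Φ (L y) = -quadVal (kerVec j x) (m' (y s(j, j))) := fun y => by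
    have h1 := Φ.hasFDerivAt.comp_hasDerivAt (0 : ℝ) (hline y)
    have h2 : HasDerivAt (fun t : ℝ => m (x s(j, j) + t • y s(j, j))) (m' (y s(j, j))) 0 :=
      hmd.hasLineDerivAt _
    have h3 := (Φ.comp symPart).hasFDerivAt.comp_hasDerivAt (0 : ℝ) h2
    have h4 : DifferentiableAt ℝ (fun t : ℝ => (fun a => if a = j then 0 else y s(a, j)) ⬝ᵥ
        (symMat (x + t • y) *ᵥ (fun a => if a = j then 0 else y s(a, j)))) 0 := by
      simp only [dotProduct, Matrix.mulVec, symMat, Matrix.of_apply, Pi.add_apply, Pi.smul_apply]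
      fun_prop
    have h5 := (hasDerivAt_sq_mul h4).sub h3
    refine (h1.unique (h5.congr_of_eventuallyEq (Filter.Eventually.of_forall fun t => ?_))).trans ?_
    · simp only [Function.comp_apply, ContinuousLinearMap.comp_apply, perturbMap, map_sub,
        Pi.sub_apply, smul_eq_mul]
      rw [← dotProduct_singularParam_add_smul, hΦ, hΦ, hΦ, quadVal_eq]
      rfl
    · simp [hΦ]
  -- The target is a matrix supported at `(j, j)`, on which `kᵀ · k` reads off the entry because `k
  -- j = 1`. The base-point entry of its preimage under `L` is the required direction.
  have hsurj : Function.Surjective D := fun c => by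
    obtain ⟨y, hy⟩ := hbij.2 (fun e => if e = s(j, j) then
      -(c / (singularParam j x).adjugate j j) else 0)
    refine ⟨y s(j, j), ?_⟩
    have h1 := hΦL y
    rw [hy] at h1
    have h2 : Φ (fun e => if e = s(j, j) then
        -(c / (singularParam j x).adjugate j j) else 0) =
        -(c / (singularParam j x).adjugate j j) := by
      change ∑ a, ∑ b, kerVec j x a * _ * kerVec j x b = _
      rw [Finset.sum_eq_single j, Finset.sum_eq_single j]
      · simp [hk]
      · intro b _ hb; simp [hb]
      · simp
      · intro a _ ha; simp [ha]
      · simp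
    rw [h2, neg_inj] at h1
    rw [hDv, ← h1]
    field_simp
  have hD' : fderiv ℝ (fun z => (Matrix.of (m z) + symMat B).det) (x s(j, j)) = D := hD.fderiv
  rw [hD']
  exact (surjective_iff_planeDet_ne_zero D).1 hsurj

open MeasureTheory in
/-- Almost every constant symmetric perturbation of a family of symmetric matrices over a plane
domain makes all zeros of its determinant transverse. -/
theorem ae_planeDet_ne_zero {m : ℂ → ι → ι → ℂ} {Ω : Set ℂ} (hm : ∀ z ∈ Ω, DifferentiableAt ℝ m z)
    (hsym : ∀ z ∈ Ω, (Matrix.of (m z)).IsSymm) :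
    ∀ᵐ B : Sym2 ι → ℂ, ∀ z ∈ Ω, (Matrix.of (m z) + symMat B).det = 0 →
      planeDet (fderiv ℝ (fun z => (Matrix.of (m z) + symMat B).det) z) ≠ 0 := by
  -- Source and target have equal dimension, so critical values are null by mere differentiability.
  -- Finitely many `j` suffice to normalize every kernel vector.
  let crit : ι → Set (Sym2 ι → ℂ) := fun j =>
    {x | x s(j, j) ∈ Ω ∧ (fderiv ℝ (perturbMap m j) x).det = 0}
  have hnull : ∀ j, volume (perturbMap m j '' crit j) = 0 := fun j =>
    addHaar_image_eq_zero_of_det_fderivWithin_eq_zero volume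
      (fun x hx => (differentiableAt_perturbMap (hm _ hx.1)).hasFDerivAt.hasFDerivWithinAt)
      (fun x hx => hx.2)
  have hae : ∀ᵐ B : Sym2 ι → ℂ, ∀ j, B ∉ perturbMap m j '' crit j :=
    ae_all_iff.2 fun j => measure_eq_zero_iff_ae_notMem.1 (hnull j)
  filter_upwards [hae] with B hB z hz hdet
  obtain ⟨k, hk0, hk⟩ := Matrix.exists_mulVec_eq_zero_iff.2 hdet
  obtain ⟨j, hj⟩ : ∃ j, k j ≠ 0 := by
    by_contra! h
    exact hk0 (funext h)
  have hN : (Matrix.of (m z) + symMat B).IsSymm := (hsym z hz).add (symMat_isSymm B)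
  -- With the free entry set to `z`, the perturbation `B` is the value of `perturbMap` at `x`, so
  -- `x` is a regular point.
  obtain ⟨x, hxz, -, hx⟩ := exists_singularParam hN (k := (k j)⁻¹ • k) (j := j) (by simp [hj])
    (by rw [Matrix.mulVec_smul, hk, smul_zero]) z
  subst hxz
  refine planeDet_ne_zero_of_regular (hm _ hz) hx.symm fun h0 => hB j ⟨x, ⟨hz, h0⟩, ?_⟩
  have : (fun a b => singularParam j x a b) =
      m (x s(j, j)) + (fun a b => symMat B a b) := by
    rw [hx]; rfl
  rw [perturbMap, this, map_add, symPart_symMat, add_sub_cancel_left]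

end GenericSymmetric

/-! ### Local frames and coefficient matrices -/

section Local

variable {S : Type*} [TopologicalSpace S] [ChartedSpace ℂ S] [IsManifold 𝓘(ℂ, ℂ) ω S]
  {r : ℕ} {E : S → Type*} [TopologicalSpace (TotalSpace (Fib r) E)]
  [∀ x, NormedAddCommGroup (E x)] [∀ x, InnerProductSpace ℂ (E x)]
  [FiberBundle (Fib r) E] [VectorBundle ℂ (Fib r) E]

theorem contract_tmul {V : Type*} [NormedAddCommGroup V] [InnerProductSpace ℂ V] (ξ a b : V) :
    contract ξ (a ⊗ₜ[ℂ] b) = (inner ℂ ξ a : ℂ) • b := rfl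

theorem ev_mu (g : SurfaceMetric S) {x : S} (s : QuadFibre E x) (ξ : E x) (v : Tan x) :
    KbarE.ev v (mu s ξ : KbarE g E x) = contract ξ (s v : E x ⊗[ℂ] E x) := rfl

theorem ofFib_toFib {p x : S} (hx : x ∈ (trivializationAt (Fib r) E p).baseSet) (ξ : E x) :
    ofFib r E p x (toFib r E p x ξ) = ξ :=
  (trivializationAt (Fib r) E p).symmL_continuousLinearMapAt hx ξ

theorem toFib_ofFib {p x : S} (hx : x ∈ (trivializationAt (Fib r) E p).baseSet) (a : Fib r) :
    toFib r E p x (ofFib r E p x a) = a :=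
  (trivializationAt (Fib r) E p).continuousLinearMapAt_symmL hx a

/-- The local frame of `E` at `p`. -/
def frame (r : ℕ) (E : S → Type*) [TopologicalSpace (TotalSpace (Fib r) E)]
    [∀ x, NormedAddCommGroup (E x)] [∀ x, InnerProductSpace ℂ (E x)]
    [FiberBundle (Fib r) E] [VectorBundle ℂ (Fib r) E] (p x : S) (i : Fin r) : E x :=
  ofFib r E p x (EuclideanSpace.single i 1)

theorem coframe_apply (p x : S) (i : Fin r) (ξ : E x) :
    coframe r E p x i ξ = toFib r E p x ξ i := rfl

theorem coframe_frame {p x : S} (hx : x ∈ (trivializationAt (Fib r) E p).baseSet) (i j : Fin r) :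
    coframe r E p x i (frame r E p x j) = if i = j then 1 else 0 := by
  rw [coframe_apply, frame, toFib_ofFib hx]
  simp

theorem sum_single_eq (a : Fib r) : ∑ i, a i • EuclideanSpace.single i (1 : ℂ) = a := by
  ext j
  simp [Pi.single_apply]

theorem ofFib_eq_sum (p x : S) (a : Fib r) : ofFib r E p x a = ∑ i, a i • frame r E p x i := by
  conv_lhs => rw [← sum_single_eq a]
  simp [frame]

theorem sum_coframe_smul_frame {p x : S} (hx : x ∈ (trivializationAt (Fib r) E p).baseSet)
    (ξ : E x) : ∑ i, coframe r E p x i ξ • frame r E p x i = ξ := by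
  conv_rhs => rw [← ofFib_toFib hx ξ, ofFib_eq_sum]
  rfl

variable (r) in
/-- The coefficients of a tensor in the local frame. -/
def tensorCoeff (p x : S) (t : E x ⊗[ℂ] E x) (i j : Fin r) : ℂ :=
  TensorProduct.lid ℂ ℂ (TensorProduct.map (coframe r E p x i) (coframe r E p x j) t)

theorem coeff_eq (s : ∀ x, QuadFibre E x) (p : S) (z : ℂ) (i j : Fin r) :
    coeff r s p z i j = tensorCoeff r p ((chartAt ℂ p).symm z)
      (s ((chartAt ℂ p).symm z) (coordVec p ((chartAt ℂ p).symm z)) :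
        E ((chartAt ℂ p).symm z) ⊗[ℂ] E ((chartAt ℂ p).symm z)) i j := rfl

theorem tensorCoeff_tmul (p x : S) (a b : E x) (i j : Fin r) :
    tensorCoeff r p x (a ⊗ₜ[ℂ] b) i j = coframe r E p x i a * coframe r E p x j b := by
  simp [tensorCoeff]

theorem tensorCoeff_add (p x : S) (t u : E x ⊗[ℂ] E x) (i j : Fin r) :
    tensorCoeff r p x (t + u) i j = tensorCoeff r p x t i j + tensorCoeff r p x u i j := by
  simp [tensorCoeff]

theorem tensorCoeff_smul (p x : S) (c : ℂ) (t : E x ⊗[ℂ] E x) (i j : Fin r) :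
    tensorCoeff r p x (c • t) i j = c * tensorCoeff r p x t i j := by
  simp [tensorCoeff]

theorem tensorCoeff_zero (p x : S) (i j : Fin r) :
    tensorCoeff r p x (0 : E x ⊗[ℂ] E x) i j = 0 := by
  simp [tensorCoeff]

theorem tensorCoeff_symm {p x : S} {t : E x ⊗[ℂ] E x} (ht : t ∈ symTensors (E x)) (i j : Fin r) :
    tensorCoeff r p x t i j = tensorCoeff r p x t j i := by
  have h : TensorProduct.comm ℂ (E x) (E x) t = t := by
    have := LinearMap.mem_ker.1 ht
    rwa [LinearMap.sub_apply, sub_eq_zero] at this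
  have key : ∀ u : E x ⊗[ℂ] E x, tensorCoeff r p x (TensorProduct.comm ℂ (E x) (E x) u) i j =
      tensorCoeff r p x u j i := fun u => by
    induction u with
    | zero => simp [tensorCoeff_zero]
    | tmul a b => rw [TensorProduct.comm_tmul, tensorCoeff_tmul, tensorCoeff_tmul, mul_comm]
    | add u v hu hv => rw [map_add, tensorCoeff_add, tensorCoeff_add, hu, hv]
  conv_lhs => rw [← h]
  exact key t

theorem coeff_symm (s : ∀ x, QuadFibre E x) (p : S) (z : ℂ) :
    (Matrix.of (coeff r s p z)).IsSymm :=
  Matrix.ext fun _ _ => tensorCoeff_symm (Subtype.prop _) _ _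

theorem sum_tensorCoeff {p x : S} (hx : x ∈ (trivializationAt (Fib r) E p).baseSet)
    (t : E x ⊗[ℂ] E x) :
    ∑ i, ∑ j, tensorCoeff r p x t i j • (frame r E p x i ⊗ₜ[ℂ] frame r E p x j) = t := by
  induction t with
  | zero => simp [tensorCoeff_zero]
  | tmul a b =>
    conv_rhs => rw [← sum_coframe_smul_frame hx a, ← sum_coframe_smul_frame hx b,
      TensorProduct.sum_tmul]
    refine Finset.sum_congr rfl fun i _ => ?_
    rw [TensorProduct.tmul_sum]
    refine Finset.sum_congr rfl fun j _ => ?_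
    rw [tensorCoeff_tmul, TensorProduct.smul_tmul_smul]
  | add u v hu hv =>
    simp only [tensorCoeff_add, add_smul, Finset.sum_add_distrib]
    rw [hu, hv]

theorem coframe_contract {p x : S} (hx : x ∈ (trivializationAt (Fib r) E p).baseSet) (ξ : E x)
    (t : E x ⊗[ℂ] E x) (j : Fin r) :
    coframe r E p x j (contract ξ t) =
      ∑ i, inner ℂ ξ (frame r E p x i) * tensorCoeff r p x t i j := by
  induction t with
  | zero => simp [tensorCoeff_zero]
  | tmul a b =>
    rw [contract_tmul, map_smul, smul_eq_mul]
    conv_lhs => rw [← sum_coframe_smul_frame hx a, inner_sum, Finset.sum_mul]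
    refine Finset.sum_congr rfl fun i _ => ?_
    rw [tensorCoeff_tmul, inner_smul_right]
    ring
  | add u v hu hv => simp only [map_add, hu, hv, tensorCoeff_add, mul_add, Finset.sum_add_distrib]

theorem eq_zero_of_inner_frame {p x : S} (hx : x ∈ (trivializationAt (Fib r) E p).baseSet)
    {ξ : E x} (h : ∀ i, inner ℂ ξ (frame r E p x i) = (0 : ℂ)) : ξ = 0 := by
  rw [← inner_self_eq_zero (𝕜 := ℂ)]
  conv_lhs => rhs; rw [← sum_coframe_smul_frame hx ξ]
  simp [inner_sum, inner_smul_right, h]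

theorem eq_zero_of_coframe {p x : S} (hx : x ∈ (trivializationAt (Fib r) E p).baseSet)
    {ξ : E x} (h : ∀ i, coframe r E p x i ξ = 0) : ξ = 0 := by
  rw [← sum_coframe_smul_frame hx ξ]
  simp [h]

theorem exists_inner_frame [∀ x, FiniteDimensional ℂ (E x)] {p x : S}
    (hx : x ∈ (trivializationAt (Fib r) E p).baseSet) (w : Fin r → ℂ) :
    ∃ ξ : E x, ∀ i, inner ℂ ξ (frame r E p x i) = w i := by
  let φ : Module.Dual ℂ (E x) := ∑ i, w i • coframe r E p x i
  refine ⟨(InnerProductSpace.toDual ℂ (E x)).symm (LinearMap.toContinuousLinearMap φ), fun i => ?_⟩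
  rw [InnerProductSpace.toDual_symm_apply]
  simp [φ, coframe_frame hx]

section Coordinate

theorem coordVec_ne_zero {p x : S} (hx : x ∈ (chartAt ℂ p).source) : coordVec p x ≠ 0 := by
  intro h
  have h1 := (trivializationAt ℂ (fun y : S => TangentSpace 𝓘(ℂ, ℂ) y)
    p).continuousLinearMapAt_symmL (R := ℂ) (b := x) hx (1 : ℂ)
  change (trivializationAt ℂ (fun y : S => TangentSpace 𝓘(ℂ, ℂ) y)
    p).continuousLinearMapAt ℂ x (coordVec p x) = 1 at h1
  rw [h, map_zero] at h1
  exact zero_ne_one h1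

theorem exists_smul_coordVec {p x : S} (hx : x ∈ (chartAt ℂ p).source) (v : Tan x) :
    ∃ c : ℂ, v = c • coordVec p x := by
  refine ⟨(show ℂ from v) / (show ℂ from coordVec p x), ?_⟩
  exact (div_mul_cancel₀ (show ℂ from v) (show (show ℂ from coordVec p x) ≠ 0 from
    coordVec_ne_zero hx)).symm

theorem coordVec_self (p : S) : coordVec p p = tanOne p := by
  unfold coordVec
  rw [TangentBundle.symmL_trivializationAt_eq_core (mem_chart_source ℂ p)]
  exact (tangentBundleCore 𝓘(ℂ, ℂ) S).coordChange_self _ _ (mem_chart_source ℂ p) _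

end Coordinate

/-! ### Kernel of `μ`, zeros of `det μ` and the singular set -/

section Zeros

variable [∀ x, FiniteDimensional ℂ (E x)]

/-- The set over which both the coordinate and the local frame at `p` are defined. -/
def locDomain (r : ℕ) (E : S → Type*) [TopologicalSpace (TotalSpace (Fib r) E)]
    [∀ x, NormedAddCommGroup (E x)] [∀ x, InnerProductSpace ℂ (E x)]
    [FiberBundle (Fib r) E] [VectorBundle ℂ (Fib r) E] (p : S) : Set S :=
  (chartAt ℂ p).source ∩ (trivializationAt (Fib r) E p).baseSet

theorem mem_locDomain_self (p : S) : p ∈ locDomain r E p :=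
  ⟨mem_chart_source ℂ p, mem_baseSet_trivializationAt (Fib r) E p⟩

theorem isOpen_locDomain (p : S) : IsOpen (locDomain r E p) :=
  (chartAt ℂ p).open_source.inter (trivializationAt (Fib r) E p).open_baseSet

theorem isOpen_chartDomain (p : S) : IsOpen (chartDomain r E p) :=
  (chartAt ℂ p).isOpen_inter_preimage_symm (trivializationAt (Fib r) E p).open_baseSet

theorem chart_mem_chartDomain {p x : S} (hx : x ∈ locDomain r E p) :
    chartAt ℂ p x ∈ chartDomain r E p :=
  ⟨(chartAt ℂ p).map_source hx.1, by
    rw [Set.mem_preimage, (chartAt ℂ p).left_inv hx.1]; exact hx.2⟩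

theorem chart_symm_mem_locDomain {p : S} {z : ℂ} (hz : z ∈ chartDomain r E p) :
    (chartAt ℂ p).symm z ∈ locDomain r E p :=
  ⟨(chartAt ℂ p).map_target hz.1, hz.2⟩

variable (r) in
/-- The coefficient matrix of `s` with respect to the coordinate and frame at `p`, at the
point `x`. -/
def coeffAt (s : ∀ x, QuadFibre E x) (p x : S) : Matrix (Fin r) (Fin r) ℂ :=
  Matrix.of fun i j => tensorCoeff r p x (s x (coordVec p x) : E x ⊗[ℂ] E x) i j

theorem of_coeff (s : ∀ x, QuadFibre E x) (p : S) (z : ℂ) :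
    Matrix.of (coeff r s p z) = coeffAt r s p ((chartAt ℂ p).symm z) := rfl

theorem toFib_muSharp (g : SurfaceMetric S) {x : S} (s : QuadFibre E x) (p : S) (v : Tan x)
    (i j : Fin r) :
    toFib r E p x (muSharp g s v (coframe r E p x i)) j =
      tensorCoeff r p x (s v : E x ⊗[ℂ] E x) i j := by
  change coframe r E p x j (contract _ (s v : E x ⊗[ℂ] E x)) = _
  generalize (s v : E x ⊗[ℂ] E x) = t
  induction t with
  | zero => simp [tensorCoeff_zero]
  | tmul a b =>
    rw [contract_tmul, InnerProductSpace.toDual_symm_apply, map_smul, tensorCoeff_tmul]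
    rfl
  | add u v hu hv => simp only [map_add, hu, hv, tensorCoeff_add]

theorem detCoeff_eq (g : SurfaceMetric S) (s : QuadSection r E) (p : S) (z : ℂ) :
    detCoeff g s p z = (Matrix.of (coeff r s.1 p z)).det := by
  rw [detCoeff, detMu, exteriorPower.map_apply_ιMulti, exteriorPower.map_apply_ιMulti,
    exteriorPower.alternatingMapLinearEquiv_apply_ιMulti, Module.Basis.det_apply,
    ← Matrix.det_transpose]
  congr 1
  ext i j
  simp only [Matrix.transpose_apply, Module.Basis.toMatrix_apply, Matrix.of_apply, coeff_eq,
    Function.comp_apply]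
  rw [← toFib_muSharp g]
  simp

/-- On `a ⊗ b` the two sides differ by exchanging the factors. This symmetry makes `μ*` a positive
multiple of `μ` in coordinates and makes the image of `μ` orthogonal to the kernel of `μ*`. -/
theorem inner_contract_symm {V : Type*} [NormedAddCommGroup V] [InnerProductSpace ℂ V]
    {t : V ⊗[ℂ] V} (ht : t ∈ symTensors V) (ξ ζ : V) :
    (inner ℂ ζ (contract ξ t) : ℂ) = inner ℂ ξ (contract ζ t) := by
  have h : TensorProduct.comm ℂ V V t = t := by
    have := LinearMap.mem_ker.1 ht
    rwa [LinearMap.sub_apply, sub_eq_zero] at this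
  have key : ∀ u : V ⊗[ℂ] V, (inner ℂ ζ (contract ξ (TensorProduct.comm ℂ V V u)) : ℂ) =
      inner ℂ ξ (contract ζ u) := fun u => by
    induction u with
    | zero => simp
    | tmul a b =>
      rw [TensorProduct.comm_tmul, contract_tmul, contract_tmul, inner_smul_right,
        inner_smul_right, mul_comm]
    | add u v hu hv => simp only [map_add, inner_add_right, hu, hv]
  conv_lhs => rw [← h]
  exact key t

theorem inner_kbarE (g : SurfaceMetric S) {x : S} (η ζ : KbarE g E x) :
    (inner ℂ η ζ : ℂ) = ((2 / metricAt g x (tanOne x) (tanOne x) : ℝ) : ℂ) *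
      inner ℂ (KbarE.ev (tanOne x) η) (KbarE.ev (tanOne x) ζ) := rfl

/-- The real adjoint of `μ`. -/
theorem muAdj_apply (g : SurfaceMetric S) {x : S} (s : QuadFibre E x) (η : KbarE g E x) :
    muAdj g s η = ((2 / metricAt g x (tanOne x) (tanOne x) : ℝ) : ℂ) •
      contract (KbarE.ev (tanOne x) η) (s (tanOne x) : E x ⊗[ℂ] E x) := by
  refine ext_inner_right ℝ fun ξ => ?_
  rw [muAdj, LinearMap.adjoint_inner_left, real_inner_eq_re_inner ℂ, real_inner_eq_re_inner ℂ,
    inner_smul_left, inner_kbarE, Complex.conj_ofReal, ← inner_conj_symm (contract _ _) ξ]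
  change RCLike.re (_ * inner ℂ _ (contract ξ (s (tanOne x) : E x ⊗[ℂ] E x))) = _
  rw [inner_contract_symm (s (tanOne x)).2, RCLike.re_eq_complex_re, Complex.re_ofReal_mul,
    Complex.re_ofReal_mul, Complex.conj_re]

theorem mu_eq_zero_iff (g : SurfaceMetric S) {x : S} (s : QuadFibre E x) (ξ : E x) {v : Tan x}
    (hv : ∃ c : ℂ, tanOne x = c • v) :
    (mu s ξ : KbarE g E x) = 0 ↔ contract ξ (s v : E x ⊗[ℂ] E x) = 0 := by
  refine ⟨fun h => by rw [← ev_mu g, h, map_zero], fun h => KbarE.ext_one ?_⟩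
  obtain ⟨c, hc⟩ := hv
  rw [ev_mu, hc, LinearMap.map_smulₛₗ, Submodule.coe_smul, map_smul, h, smul_zero]

theorem contract_eq_zero_iff {p x : S} (hx : x ∈ (trivializationAt (Fib r) E p).baseSet)
    {t : E x ⊗[ℂ] E x} (ht : t ∈ symTensors (E x)) (ξ : E x) :
    contract ξ t = 0 ↔ (Matrix.of (tensorCoeff r p x t)).mulVec
      (fun i => inner ℂ ξ (frame r E p x i)) = 0 := by
  have h : ∀ j, (Matrix.of (tensorCoeff r p x t)).mulVec
      (fun i => inner ℂ ξ (frame r E p x i)) j = coframe r E p x j (contract ξ t) := fun j => by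
    rw [coframe_contract hx, Matrix.mulVec, dotProduct]
    refine Finset.sum_congr rfl fun i _ => ?_
    rw [Matrix.of_apply, tensorCoeff_symm ht, mul_comm]
  refine ⟨fun h0 => funext fun j => ?_, fun h0 => eq_zero_of_coframe hx fun j => ?_⟩
  · rw [h, h0, map_zero]; rfl
  · rw [← h, h0]; rfl

/-- In the local frame at `p`, the kernel of `μ` is the kernel of the coefficient matrix. -/
theorem mu_eq_zero_iff_mulVec (g : SurfaceMetric S) (s : QuadSection r E) {p x : S}
    (hx : x ∈ locDomain r E p) (ξ : E x) :
    (mu (s.1 x) ξ : KbarE g E x) = 0 ↔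
      (coeffAt r s.1 p x).mulVec (fun i => inner ℂ ξ (frame r E p x i)) = 0 := by
  rw [mu_eq_zero_iff g (s.1 x) ξ (exists_smul_coordVec hx.1 _),
    contract_eq_zero_iff hx.2 (s.1 x (coordVec p x)).2]
  rfl

theorem exists_ker_iff_det (g : SurfaceMetric S) (s : QuadSection r E) {p x : S}
    (hx : x ∈ locDomain r E p) :
    (∃ ξ : E x, ξ ≠ 0 ∧ (mu (s.1 x) ξ : KbarE g E x) = 0) ↔ (coeffAt r s.1 p x).det = 0 := by
  rw [← Matrix.exists_mulVec_eq_zero_iff]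
  constructor
  · rintro ⟨ξ, hξ, h⟩
    refine ⟨_, fun h0 => hξ (eq_zero_of_inner_frame hx.2 (congrFun h0)),
      (mu_eq_zero_iff_mulVec g s hx ξ).1 h⟩
  · rintro ⟨w, hw, h⟩
    obtain ⟨ξ, hξ⟩ := exists_inner_frame hx.2 w
    obtain rfl : (fun i => inner ℂ ξ (frame r E p x i)) = w := funext hξ
    refine ⟨ξ, ?_, (mu_eq_zero_iff_mulVec g s hx ξ).2 h⟩
    rintro rfl
    exact hw (funext fun i => inner_zero_left _)

theorem finrank_fibre (x : S) : Module.finrank ℂ (E x) = r := by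
  have e := (trivializationAt (Fib r) E x).continuousLinearEquivAt ℂ x
    (mem_baseSet_trivializationAt (Fib r) E x)
  rw [e.toLinearEquiv.finrank_eq]
  simp

theorem detCoeff_chart (g : SurfaceMetric S) (s : QuadSection r E) {p x : S}
    (hx : x ∈ (chartAt ℂ p).source) :
    detCoeff g s p (chartAt ℂ p x) = (coeffAt r s.1 p x).det := by
  rw [detCoeff_eq, of_coeff, (chartAt ℂ p).left_inv hx]

/-- This passes from the invariant `det μ` to kernels: one direction uses the determinant in the
frame at `x`, the other the vanishing of the top exterior power of a non-injective map. -/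
theorem mem_detZeros_iff_ker (g : SurfaceMetric S) (s : QuadSection r E) {x : S} :
    x ∈ detZeros g s ↔ ∃ ξ : E x, ξ ≠ 0 ∧ (mu (s.1 x) ξ : KbarE g E x) = 0 := by
  constructor
  · intro h
    rw [exists_ker_iff_det g s (mem_locDomain_self x), ← detCoeff_chart g s (mem_chart_source ℂ x),
      detCoeff, (chartAt ℂ x).left_inv (mem_chart_source ℂ x), h]
    simp
  · rintro ⟨ξ, hξ, h⟩ v
    refine exteriorPower.linearMap_ext (AlternatingMap.ext fun φ => ?_)
    change exteriorPower.map r (muSharp g (s.1 x) v) (exteriorPower.ιMulti ℂ r φ) = 0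
    rw [exteriorPower.map_apply_ιMulti]
    -- If the images of the `r` covectors were independent, the covectors would be a basis of the
    -- dual. The covector `ψ` dual to `ξ` would then have zero coefficients, since its image
    -- vanishes, contradicting `ψ ξ ≠ 0`.
    refine AlternatingMap.map_linearDependent _ _ fun hli => ?_
    have hφ : LinearIndependent ℂ φ := hli.of_comp _
    have hspan : Submodule.span ℂ (Set.range φ) = ⊤ :=
      hφ.span_eq_top_of_card_eq_finrank' (by
        rw [Fintype.card_fin, Subspace.dual_finrank_eq, finrank_fibre (r := r) x])
    let ψ : Module.Dual ℂ (E x) := (InnerProductSpace.toDual ℂ (E x) ξ).toLinearMap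
    have hψ0 : muSharp g (s.1 x) v ψ = 0 := by
      change KbarE.ev v (mu (s.1 x) ((InnerProductSpace.toDual ℂ (E x)).symm
        (InnerProductSpace.toDual ℂ (E x) ξ)) : KbarE g E x) = 0
      rw [LinearIsometryEquiv.symm_apply_apply, h, map_zero]
    have hψ : ψ ∈ Submodule.span ℂ (Set.range φ) := hspan ▸ Submodule.mem_top
    obtain ⟨c, hc⟩ := (Submodule.mem_span_range_iff_exists_fun ℂ).1 hψ
    have hc0 : ∀ i, c i = 0 := by
      refine Fintype.linearIndependent_iff.1 hli c ?_
      rw [← hψ0, ← hc, map_sum]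
      simp
    refine hξ (inner_self_eq_zero (𝕜 := ℂ).1 ?_)
    change ψ ξ = 0
    rw [← hc]
    simp [hc0]

theorem mem_detZeros_iff (g : SurfaceMetric S) (s : QuadSection r E) {p x : S}
    (hx : x ∈ locDomain r E p) : x ∈ detZeros g s ↔ (coeffAt r s.1 p x).det = 0 :=
  (mem_detZeros_iff_ker g s).trans (exists_ker_iff_det g s hx)

theorem muAdj_eq_zero_iff (g : SurfaceMetric S) {x : S} (s : QuadFibre E x) (η : KbarE g E x) :
    muAdj g s η = 0 ↔ (mu s (KbarE.ev (tanOne x) η) : KbarE g E x) = 0 := by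
  rw [muAdj_apply, smul_eq_zero, mu_eq_zero_iff g s _ ⟨1, (one_smul ℂ _).symm⟩]
  have h : ((2 / metricAt g x (tanOne x) (tanOne x) : ℝ) : ℂ) ≠ 0 :=
    Complex.ofReal_ne_zero.2 (div_pos two_pos (metricAt_tanOne_pos g x)).ne'
  exact or_iff_right h

/-- The kernel of `𝒜` is `ker μ ⊕ ker μ*`, and evaluation on a tangent vector carries `ker μ*` into
`ker μ`, so either summand detects a zero. -/
theorem singularSet_eq_detZeros (g : SurfaceMetric S) (s : QuadSection r E) :
    singularSet g s = detZeros g s := by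
  ext x
  rw [mem_detZeros_iff_ker]
  constructor
  · intro h
    obtain ⟨⟨ξ, η⟩, hker, h0⟩ := Submodule.exists_mem_ne_zero_of_ne_bot h
    have h1 : muAdj g (s.1 x) η = 0 := congrArg Prod.fst (LinearMap.mem_ker.1 hker)
    have h2 : muR g (s.1 x) ξ = 0 := congrArg Prod.snd (LinearMap.mem_ker.1 hker)
    by_cases hξ : ξ = 0
    · refine ⟨KbarE.ev (tanOne x) η, fun h3 => h0 ?_, (muAdj_eq_zero_iff g _ η).1 h1⟩
      rw [hξ, KbarE.ext_one h3]
      rfl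
    · exact ⟨ξ, hξ, h2⟩
  · rintro ⟨ξ, hξ, h⟩ hbot
    have : ((ξ, 0) : E x × KbarE g E x) ∈ LinearMap.ker (bigA g (s.1 x)) := by
      rw [LinearMap.mem_ker]
      exact Prod.ext (map_zero (muAdj g (s.1 x))) h
    rw [hbot, Submodule.mem_bot] at this
    exact hξ (congrArg Prod.fst this)

end Zeros

end Local

/-! ### Change of coordinate and frame -/

section Transition

variable {S : Type*} [TopologicalSpace S] [ChartedSpace ℂ S] [IsManifold 𝓘(ℂ, ℂ) ω S]
  {r : ℕ} {E : S → Type*} [TopologicalSpace (TotalSpace (Fib r) E)]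
  [∀ x, NormedAddCommGroup (E x)] [∀ x, InnerProductSpace ℂ (E x)]
  [FiberBundle (Fib r) E] [VectorBundle ℂ (Fib r) E] [∀ x, FiniteDimensional ℂ (E x)]

/-- The matrix of the change from the local frame at `p` to the local frame at `q`. -/
def transMat (r : ℕ) (E : S → Type*) [TopologicalSpace (TotalSpace (Fib r) E)]
    [∀ x, NormedAddCommGroup (E x)] [∀ x, InnerProductSpace ℂ (E x)]
    [FiberBundle (Fib r) E] [VectorBundle ℂ (Fib r) E] (p q x : S) : Matrix (Fin r) (Fin r) ℂ :=
  Matrix.of fun i a => coframe r E q x i (frame r E p x a)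

/-- The coordinate vector at `q`, as a multiple of the coordinate vector at `p`. -/
def transTan (p q x : S) : ℂ :=
  (trivializationAt ℂ (fun y : S => TangentSpace 𝓘(ℂ, ℂ) y) p).continuousLinearMapAt ℂ x
    (coordVec q x)

theorem coordVec_eq_transTan_smul {p x : S} (hx : x ∈ (chartAt ℂ p).source) (q : S) :
    coordVec q x = transTan p q x • coordVec p x := by
  have h := (trivializationAt ℂ (fun y : S => TangentSpace 𝓘(ℂ, ℂ) y)
    p).symmL_continuousLinearMapAt (R := ℂ) (b := x) hx (coordVec q x)
  have h1 : transTan p q x = transTan p q x • (1 : ℂ) := (mul_one _).symm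
  change (trivializationAt ℂ (fun y : S => TangentSpace 𝓘(ℂ, ℂ) y) p).symmL ℂ x
    (transTan p q x) = _ at h
  rw [h1, map_smul] at h
  exact h.symm

theorem transTan_ne_zero {p q x : S} (hp : x ∈ (chartAt ℂ p).source)
    (hq : x ∈ (chartAt ℂ q).source) : transTan p q x ≠ 0 := fun h =>
  coordVec_ne_zero hq (by rw [coordVec_eq_transTan_smul hp q, h, zero_smul])

theorem transMat_mul {p q x : S} (hp : x ∈ (trivializationAt (Fib r) E p).baseSet)
    (hq : x ∈ (trivializationAt (Fib r) E q).baseSet) :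
    transMat r E p q x * transMat r E q p x = 1 := by
  ext i j
  rw [Matrix.mul_apply, Matrix.one_apply, ← coframe_frame hq]
  conv_rhs => rw [← sum_coframe_smul_frame hp (frame r E q x j), map_sum]
  refine Finset.sum_congr rfl fun a _ => ?_
  rw [map_smul, smul_eq_mul, mul_comm]
  rfl

theorem tensorCoeff_trans {p x : S} (hp : x ∈ (trivializationAt (Fib r) E p).baseSet) (q : S)
    (t : E x ⊗[ℂ] E x) :
    Matrix.of (tensorCoeff r q x t) =
      transMat r E p q x * Matrix.of (tensorCoeff r p x t) * (transMat r E p q x).transpose := by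
  ext i j
  have h : tensorCoeff r q x t i j =
      ∑ a, ∑ b, tensorCoeff r p x t a b * (transMat r E p q x i a * transMat r E p q x j b) := by
    conv_lhs => rw [← sum_tensorCoeff hp t]
    simp only [tensorCoeff, map_sum, map_smul, TensorProduct.map_tmul, TensorProduct.lid_tmul,
      smul_eq_mul]
    rfl
  rw [Matrix.of_apply, h, Finset.sum_comm]
  simp only [Matrix.mul_apply, Matrix.transpose_apply, Finset.sum_mul, Matrix.of_apply]
  exact Finset.sum_congr rfl fun b _ => Finset.sum_congr rfl fun a _ => by ring

/-- The conjugated scalar comes from `dz̄`, and each tensor factor contributes one transition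
matrix. -/
theorem coeffAt_trans (s : ∀ x, QuadFibre E x) {p x : S} (hp : x ∈ locDomain r E p) (q : S) :
    coeffAt r s q x = starRingEnd ℂ (transTan p q x) •
      (transMat r E p q x * coeffAt r s p x * (transMat r E p q x).transpose) := by
  have h1 : (s x (coordVec q x) : E x ⊗[ℂ] E x) =
      starRingEnd ℂ (transTan p q x) • (s x (coordVec p x) : E x ⊗[ℂ] E x) := by
    rw [coordVec_eq_transTan_smul hp.1 q, LinearMap.map_smulₛₗ, Submodule.coe_smul]
  have h2 := tensorCoeff_trans (r := r) hp.2 q (s x (coordVec p x) : E x ⊗[ℂ] E x)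
  rw [coeffAt, h1]
  refine Eq.trans ?_ (congrArg (starRingEnd ℂ (transTan p q x) • ·) h2)
  ext i j
  simp only [Matrix.of_apply, Matrix.smul_apply, tensorCoeff_smul, smul_eq_mul]

/-- The points of the chart domain at `q` that lie over the local domain at `p`. -/
def overlap (r : ℕ) (E : S → Type*) [TopologicalSpace (TotalSpace (Fib r) E)]
    [∀ x, NormedAddCommGroup (E x)] [∀ x, InnerProductSpace ℂ (E x)]
    [FiberBundle (Fib r) E] [VectorBundle ℂ (Fib r) E] (p q : S) : Set ℂ :=
  chartDomain r E q ∩ (chartAt ℂ q).symm ⁻¹' locDomain r E p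

theorem overlap_eq (p q : S) : overlap r E p q =
    (chartAt ℂ q).target ∩ (chartAt ℂ q).symm ⁻¹' (locDomain r E q ∩ locDomain r E p) := by
  ext z
  constructor
  · rintro ⟨hz, hz'⟩
    exact ⟨hz.1, chart_symm_mem_locDomain hz, hz'⟩
  · rintro ⟨hz, hz', hz''⟩
    exact ⟨⟨hz, hz'.2⟩, hz''⟩

theorem isOpen_overlap (p q : S) : IsOpen (overlap r E p q) := by
  rw [overlap_eq]
  exact (chartAt ℂ q).isOpen_inter_preimage_symm ((isOpen_locDomain q).inter (isOpen_locDomain p))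

theorem chart_mem_overlap {p q x : S} (hp : x ∈ locDomain r E p) (hq : x ∈ locDomain r E q) :
    chartAt ℂ q x ∈ overlap r E p q :=
  ⟨chart_mem_chartDomain hq, by rw [Set.mem_preimage, (chartAt ℂ q).left_inv hq.1]; exact hp⟩

theorem contDiffOn_chart_symm_comp {F : Type*} [NormedAddCommGroup F] [NormedSpace ℂ F]
    [NormedSpace ℝ F] [IsScalarTower ℝ ℂ F] {f : S → F} {U : Set S} {q : S}
    (hf : ContMDiffOn 𝓘(ℂ, ℂ) 𝓘(ℂ, F) ω f U) :
    ContDiffOn ℝ ∞ (f ∘ (chartAt ℂ q).symm) ((chartAt ℂ q).target ∩ (chartAt ℂ q).symm ⁻¹' U) := by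
  have h : ContMDiffOn 𝓘(ℂ, ℂ) 𝓘(ℂ, ℂ) ω (chartAt ℂ q).symm (chartAt ℂ q).target :=
    contMDiffOn_chart_symm
  have h1 := hf.comp (h.mono Set.inter_subset_left) (fun z hz => hz.2)
  exact ((contMDiffOn_iff_contDiffOn.1 h1).restrict_scalars ℝ).of_le le_top

theorem contDiffOn_coordChange (p q : S) :
    ContDiffOn ℝ ∞ (chartAt ℂ p ∘ (chartAt ℂ q).symm) (overlap r E p q) := by
  have h : ContMDiffOn 𝓘(ℂ, ℂ) 𝓘(ℂ, ℂ) ω (chartAt ℂ p) (chartAt ℂ p).source :=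
    contMDiffOn_chart
  exact (contDiffOn_chart_symm_comp h).mono fun z hz => ⟨hz.1.1, hz.2.1⟩

theorem contDiffOn_transMat [ContMDiffVectorBundle ω (Fib r) E 𝓘(ℂ, ℂ)] (p q : S) (i a : Fin r) :
    ContDiffOn ℝ ∞ (fun z => transMat r E p q ((chartAt ℂ q).symm z) i a) (overlap r E p q) := by
  have h := contMDiffOn_coordChangeL (n := ω) (IB := 𝓘(ℂ, ℂ)) (trivializationAt (Fib r) E p)
    (trivializationAt (Fib r) E q)
  have h1 := ((contDiffOn_chart_symm_comp (q := q) h).mono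
    fun z (hz : z ∈ overlap r E p q) => ⟨hz.1.1, hz.2.2, hz.1.2⟩)
  let ev : (Fib r →L[ℂ] Fib r) →L[ℝ] ℂ :=
    ((EuclideanSpace.proj i : Fib r →L[ℂ] ℂ) ∘L
      ContinuousLinearMap.apply ℂ (Fib r) (EuclideanSpace.single a (1 : ℂ))).restrictScalars ℝ
  refine (ev.contDiff.comp_contDiffOn h1).congr fun z hz => ?_
  simp only [transMat, Matrix.of_apply, coframe_apply, Function.comp_apply]
  change _ = ((trivializationAt (Fib r) E p).coordChangeL ℂ (trivializationAt (Fib r) E q)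
    ((chartAt ℂ q).symm z) (EuclideanSpace.single a (1 : ℂ))) i
  rw [(trivializationAt (Fib r) E p).coordChangeL_apply _ ⟨hz.2.2, hz.1.2⟩, toFib,
    Trivialization.continuousLinearMapAt_apply_of_mem ℂ _ hz.1.2, frame, ofFib,
    Trivialization.symmL_apply _ hz.2.2]

theorem contDiffOn_transTan (p q : S) :
    ContDiffOn ℝ ∞ (fun z => transTan p q ((chartAt ℂ q).symm z)) (overlap r E p q) := by
  have h := contMDiffOn_coordChangeL (n := ω) (IB := 𝓘(ℂ, ℂ))
    (trivializationAt ℂ (fun y : S => TangentSpace 𝓘(ℂ, ℂ) y) q)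
    (trivializationAt ℂ (fun y : S => TangentSpace 𝓘(ℂ, ℂ) y) p)
  have h1 := ((contDiffOn_chart_symm_comp (q := q) h).mono
    fun z (hz : z ∈ overlap r E p q) => ⟨hz.1.1, (chart_symm_mem_locDomain hz.1).1, hz.2.1⟩)
  let ev : (ℂ →L[ℂ] ℂ) →L[ℝ] ℂ := (ContinuousLinearMap.apply ℂ ℂ (1 : ℂ)).restrictScalars ℝ
  refine (ev.contDiff.comp_contDiffOn h1).congr fun z hz => ?_
  change _ = (trivializationAt ℂ (fun y : S => TangentSpace 𝓘(ℂ, ℂ) y) q).coordChangeL ℂ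
    (trivializationAt ℂ (fun y : S => TangentSpace 𝓘(ℂ, ℂ) y) p) ((chartAt ℂ q).symm z) 1
  rw [Trivialization.coordChangeL_apply _ _ ⟨(chart_symm_mem_locDomain hz.1).1, hz.2.1⟩, transTan,
    Trivialization.continuousLinearMapAt_apply_of_mem ℂ _ hz.2.1, coordVec,
    Trivialization.symmL_apply _ (chart_symm_mem_locDomain hz.1).1]

/-- The opposite coordinate change is a local right inverse, so its derivative is a right inverse.
-/
theorem hasFDerivAt_coordChange_surjective {p q x : S} (hp : x ∈ locDomain r E p)
    (hq : x ∈ locDomain r E q) :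
    Function.Surjective (fderiv ℝ (chartAt ℂ p ∘ (chartAt ℂ q).symm) (chartAt ℂ q x)) := by
  have h1 : DifferentiableAt ℝ (chartAt ℂ p ∘ (chartAt ℂ q).symm) (chartAt ℂ q x) :=
    ((contDiffOn_coordChange (E := E) p q).contDiffAt
      ((isOpen_overlap p q).mem_nhds (chart_mem_overlap hp hq))).differentiableAt (by simp)
  have h2 : DifferentiableAt ℝ (chartAt ℂ q ∘ (chartAt ℂ p).symm) (chartAt ℂ p x) :=
    ((contDiffOn_coordChange (E := E) q p).contDiffAt
      ((isOpen_overlap q p).mem_nhds (chart_mem_overlap hq hp))).differentiableAt (by simp)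
  have hx : (chartAt ℂ q ∘ (chartAt ℂ p).symm) (chartAt ℂ p x) = chartAt ℂ q x := by
    simp [(chartAt ℂ p).left_inv hp.1]
  rw [← hx] at h1 ⊢
  have h3 := h1.hasFDerivAt.comp _ h2.hasFDerivAt
  have h4 : HasFDerivAt ((chartAt ℂ p ∘ (chartAt ℂ q).symm) ∘ (chartAt ℂ q ∘ (chartAt ℂ p).symm))
      (ContinuousLinearMap.id ℝ ℂ) (chartAt ℂ p x) := by
    refine (hasFDerivAt_id _).congr_of_eventuallyEq ?_
    filter_upwards [(isOpen_overlap q p).mem_nhds (chart_mem_overlap hq hp)] with z hz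
    simp only [Function.comp_apply, id]
    rw [(chartAt ℂ q).left_inv hz.2.1, (chartAt ℂ p).right_inv hz.1.1]
  intro c
  exact ⟨fderiv ℝ (chartAt ℂ q ∘ (chartAt ℂ p).symm) (chartAt ℂ p x) c,
    congrArg (fun L => L c) (h3.unique h4)⟩

theorem contDiffAt_detCoeff (g : SurfaceMetric S) (s : QuadSection r E) {p : S} {z : ℂ}
    (hz : z ∈ chartDomain r E p) : ContDiffAt ℝ ∞ (detCoeff g s p) z := by
  have h : ContDiffAt ℝ ∞ (coeff r s.1 p) z :=
    (s.2 p).contDiffAt ((isOpen_chartDomain p).mem_nhds hz)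
  have : detCoeff g s p = fun z => (Matrix.of (coeff r s.1 p z)).det := funext (detCoeff_eq g s p)
  rw [this]
  simp only [Matrix.det_apply, Matrix.of_apply]
  refine ContDiffAt.sum fun σ _ => ContDiffAt.const_smul _ (contDiffAt_prod fun i _ => ?_)
  exact contDiffAt_pi.1 (contDiffAt_pi.1 h _) _

/-- Transversality of a zero of `det μ` does not depend on the coordinate and the frame. -/
theorem planeDet_detCoeff_ne_zero [ContMDiffVectorBundle ω (Fib r) E 𝓘(ℂ, ℂ)]
    (g : SurfaceMetric S) (s : QuadSection r E) {p q x : S} (hp : x ∈ locDomain r E p)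
    (hq : x ∈ locDomain r E q) (hx : x ∈ detZeros g s)
    (h : planeDet (fderiv ℝ (detCoeff g s p) (chartAt ℂ p x)) ≠ 0) :
    planeDet (fderiv ℝ (detCoeff g s q) (chartAt ℂ q x)) ≠ 0 := by
  rw [← surjective_iff_planeDet_ne_zero] at h ⊢
  have hov := chart_mem_overlap hp hq
  have hnhds := (isOpen_overlap p q).mem_nhds hov
  -- This is the transition function of `L`: the determinant of the transformation law for the
  -- coefficient matrix.
  let J : ℂ → ℂ := fun z => starRingEnd ℂ (transTan p q ((chartAt ℂ q).symm z)) ^ r *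
    (transMat r E p q ((chartAt ℂ q).symm z)).det ^ 2
  have hJ : DifferentiableAt ℝ J (chartAt ℂ q x) := by
    have h1 : DifferentiableAt ℝ (fun z => transTan p q ((chartAt ℂ q).symm z))
        (chartAt ℂ q x) :=
      ((contDiffOn_transTan (E := E) p q).contDiffAt hnhds).differentiableAt (by simp)
    have h2 : ∀ i a, DifferentiableAt ℝ
        (fun z => transMat r E p q ((chartAt ℂ q).symm z) i a) (chartAt ℂ q x) := fun i a =>
      ((contDiffOn_transMat p q i a).contDiffAt hnhds).differentiableAt (by simp)
    have h3 : DifferentiableAt ℝ (fun z => (transMat r E p q ((chartAt ℂ q).symm z)).det)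
        (chartAt ℂ q x) := by
      have h4 : DifferentiableAt ℝ
          (fun z => fun i a => transMat r E p q ((chartAt ℂ q).symm z) i a) (chartAt ℂ q x) :=
        differentiableAt_pi.2 fun i => differentiableAt_pi.2 fun a => h2 i a
      obtain ⟨L, hL, -⟩ := hasFDerivAt_det h4.hasFDerivAt
      exact hL.differentiableAt
    have h5 : DifferentiableAt ℝ (fun z => starRingEnd ℂ (transTan p q ((chartAt ℂ q).symm z)))
        (chartAt ℂ q x) :=
      (Complex.conjCLE : ℂ →L[ℝ] ℂ).differentiableAt.comp _ h1
    exact (h5.pow r).mul (h3.pow 2)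
  have hJ0 : J (chartAt ℂ q x) ≠ 0 := by
    simp only [J]
    rw [(chartAt ℂ q).left_inv hq.1]
    refine mul_ne_zero (pow_ne_zero _ ?_) (pow_ne_zero _ fun h0 => ?_)
    · exact (map_ne_zero _).2 (transTan_ne_zero hp.1 hq.1)
    · have := congrArg Matrix.det (transMat_mul hp.2 hq.2)
      rw [Matrix.det_mul, h0, zero_mul, Matrix.det_one] at this
      exact zero_ne_one this
  have hτ : (chartAt ℂ p ∘ (chartAt ℂ q).symm) (chartAt ℂ q x) = chartAt ℂ p x := by
    simp [(chartAt ℂ q).left_inv hq.1]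
  have hd : DifferentiableAt ℝ (detCoeff g s p)
      ((chartAt ℂ p ∘ (chartAt ℂ q).symm) (chartAt ℂ q x)) := by
    rw [hτ]
    exact (contDiffAt_detCoeff g s (chart_mem_chartDomain hp)).differentiableAt (by simp)
  have hτd : DifferentiableAt ℝ (chartAt ℂ p ∘ (chartAt ℂ q).symm) (chartAt ℂ q x) :=
    ((contDiffOn_coordChange (E := E) p q).contDiffAt hnhds).differentiableAt (by simp)
  have hcomp := hd.hasFDerivAt.comp _ hτd.hasFDerivAt
  have hprod := hJ.hasFDerivAt.mul hcomp
  -- At a zero the term of the product rule that differentiates `J` drops out.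
  have hzero : detCoeff g s p (chartAt ℂ p x) = 0 := by
    rw [detCoeff_chart g s hp.1]
    exact (mem_detZeros_iff g s hp).1 hx
  have heq : HasFDerivAt (detCoeff g s q) _ (chartAt ℂ q x) :=
    hprod.congr_of_eventuallyEq (by
      filter_upwards [hnhds] with z hz
      simp only [Pi.mul_apply, Function.comp_apply, detCoeff_eq, of_coeff, J]
      rw [(chartAt ℂ p).left_inv hz.2.1, coeffAt_trans s.1 hz.2 q, Matrix.det_smul,
        Matrix.det_mul, Matrix.det_mul, Matrix.det_transpose, Fintype.card_fin]
      ring)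
  rw [heq.fderiv]
  intro c
  obtain ⟨u, hu⟩ := h (c / J (chartAt ℂ q x))
  obtain ⟨v, hv⟩ := hasFDerivAt_coordChange_surjective hp hq u
  refine ⟨v, ?_⟩
  simp only [add_apply, smul_apply,
    ContinuousLinearMap.comp_apply, Function.comp_apply, hv]
  rw [(chartAt ℂ q).left_inv hq.1, hzero, hu]
  simp only [smul_eq_mul, zero_mul, add_zero]
  field_simp

end Transition

/-! ### Finiteness of the zero set, and openness of transversality -/

section Generic

variable {S : Type*} [TopologicalSpace S] [ChartedSpace ℂ S] [IsManifold 𝓘(ℂ, ℂ) ω S]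
  {r : ℕ} {E : S → Type*} [TopologicalSpace (TotalSpace (Fib r) E)]
  [∀ x, NormedAddCommGroup (E x)] [∀ x, InnerProductSpace ℂ (E x)]
  [FiberBundle (Fib r) E] [VectorBundle ℂ (Fib r) E] [∀ x, FiniteDimensional ℂ (E x)]

theorem hasTransverseZeros_iff (g : SurfaceMetric S) (s : QuadSection r E) :
    HasTransverseZeros g s ↔ ∀ p ∈ detZeros g s,
      planeDet (fderiv ℝ (detCoeff g s p) (chartAt ℂ p p)) ≠ 0 := by
  refine forall₂_congr fun p _ => ?_
  rw [bijective_iff_det_ne_zero, det_eq_planeDet]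
  rfl

theorem contDiffAt_coeff (s : QuadSection r E) {p : S} {z : ℂ} (hz : z ∈ chartDomain r E p) :
    ContDiffAt ℝ ∞ (coeff r s.1 p) z :=
  (s.2 p).contDiffAt ((isOpen_chartDomain p).mem_nhds hz)

/-! ### Finiteness of the zero set -/

/-- At a zero the derivative is injective, hence bounded below, so there are no other zeros nearby.
At other points continuity suffices. -/
theorem exists_nhds_inter_detZeros_subset (g : SurfaceMetric S) {s : QuadSection r E}
    (hs : HasTransverseZeros g s) (p : S) :
    ∃ U ∈ nhds p, U ∩ detZeros g s ⊆ {p} := by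
  have hp := mem_locDomain_self (r := r) (E := E) p
  have hcd := contDiffAt_detCoeff g s (chart_mem_chartDomain hp)
  have hloc : locDomain r E p ∈ nhds p := (isOpen_locDomain p).mem_nhds hp
  have hcont : Filter.Tendsto (chartAt ℂ p) (nhds p) (nhds (chartAt ℂ p p)) :=
    (chartAt ℂ p).continuousAt (mem_chart_source ℂ p)
  have hne : ∀ᶠ z in nhdsWithin (chartAt ℂ p p) {chartAt ℂ p p}ᶜ, detCoeff g s p z ≠ 0 := by
    by_cases h0 : detCoeff g s p (chartAt ℂ p p) = 0
    · have hz : p ∈ detZeros g s := by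
        rw [mem_detZeros_iff g s hp, ← detCoeff_chart g s hp.1, h0]
      have hbij := hs p hz
      refine (hcd.differentiableAt (by simp)).hasFDerivAt.eventually_ne ?_
      obtain ⟨C, -, hC⟩ := (LinearMap.exists_antilipschitzWith
        (detDeriv g s p : ℂ →ₗ[ℝ] ℂ) (LinearMap.ker_eq_bot.2 hbij.1))
      exact ⟨C, hC⟩
    · exact Filter.Eventually.filter_mono nhdsWithin_le_nhds
        (hcd.continuousAt.eventually_ne h0)
  rw [eventually_nhdsWithin_iff] at hne
  refine ⟨_, Filter.inter_mem hloc (hcont hne), ?_⟩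
  rintro x ⟨⟨hx, hx'⟩, hxz⟩
  by_contra hxp
  refine hx' (fun h => hxp ((chartAt ℂ p).injOn hx.1 hp.1 h)) ?_
  rw [detCoeff_chart g s hx.1]
  exact (mem_detZeros_iff g s hx).1 hxz

theorem finite_detZeros [CompactSpace S] (g : SurfaceMetric S) {s : QuadSection r E}
    (hs : HasTransverseZeros g s) : (detZeros g s).Finite := by
  choose U hU hU' using exists_nhds_inter_detZeros_subset g hs
  obtain ⟨t, ht⟩ := CompactSpace.elim_nhds_subcover U hU
  refine t.finite_toSet.subset fun x hx => ?_
  obtain ⟨p, hpt, hxp⟩ := Set.mem_iUnion₂.1 (ht ▸ Set.mem_univ x : x ∈ ⋃ p ∈ t, U p)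
  rw [hU' p ⟨hxp, hx⟩]
  exact hpt

/-! ### The `C^∞` topology -/

theorem eventually_dist_iteratedFDeriv_lt (s₀ : QuadSection r E) {p : S} {K : Set ℂ}
    (hK : IsCompact K) (hKp : K ⊆ chartDomain r E p) (n : ℕ) {ε : ℝ} (hε : 0 < ε) :
    ∀ᶠ s : QuadSection r E in nhds s₀, ∀ z ∈ K,
      dist (iteratedFDeriv ℝ n (coeff r s₀.1 p) z) (iteratedFDeriv ℝ n (coeff r s.1 p) z) < ε := by
  have h : Continuous (fun s : QuadSection r E =>
      UniformOnFun.ofFun {K : Set ℂ | IsCompact K ∧ K ⊆ chartDomain r E p}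
        (iteratedFDeriv ℝ n (coeff r s.1 p))) :=
    continuous_iInf_dom (i := p) (continuous_iInf_dom (i := n) continuous_induced_dom)
  have h1 := UniformOnFun.tendsto_iff_tendstoUniformlyOn.1 (h.tendsto s₀) K ⟨hK, hKp⟩
  exact Metric.tendstoUniformlyOn_iff.1 h1 ε hε

/-- Finite-dimensional families of sections are continuous. -/
theorem continuous_linearFamily {ι : Type*} [Fintype ι] (s₀ : QuadSection r E)
    (σ : ι → QuadSection r E) {F : (ι → ℂ) → QuadSection r E}
    (hF : ∀ B p, coeff r (F B).1 p = coeff r s₀.1 p + ∑ e, B e • coeff r (σ e).1 p) :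
    Continuous F := by
  refine continuous_iInf_rng.2 fun p => continuous_iInf_rng.2 fun n => continuous_induced_rng.2 ?_
  refine continuous_iff_continuousAt.2 fun B₀ => ?_
  refine UniformOnFun.tendsto_iff_tendstoUniformlyOn.2 fun K hK => ?_
  refine Metric.tendstoUniformlyOn_iff.2 fun ε hε => ?_
  have hn : ((n : ℕ) : WithTop ℕ∞) ≤ ∞ := by exact_mod_cast le_top
  have hbound : ∀ e, ∃ M, ∀ z ∈ K, ‖iteratedFDeriv ℝ n (coeff r (σ e).1 p) z‖ ≤ M := fun e =>
    hK.1.exists_bound_of_continuousOn fun z hz =>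
      ((contDiffAt_coeff (σ e) (hK.2 hz)).continuousAt_iteratedFDeriv hn).continuousWithinAt
  choose M hM using hbound
  have hexp : ∀ B, ∀ z ∈ K, iteratedFDeriv ℝ n (coeff r (F B).1 p) z =
      iteratedFDeriv ℝ n (coeff r s₀.1 p) z +
        ∑ e, B e • iteratedFDeriv ℝ n (coeff r (σ e).1 p) z := fun B z hz => by
    have hσ : ∀ e, ContDiffAt ℝ n (coeff r (σ e).1 p) z := fun e =>
      (contDiffAt_coeff (σ e) (hK.2 hz)).of_le hn
    have hσ' : ∀ e, ContDiffAt ℝ n (B e • coeff r (σ e).1 p) z := fun e =>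
      ContDiffAt.const_smul (B e) (hσ e)
    rw [hF, iteratedFDeriv_add_apply ((contDiffAt_coeff s₀ (hK.2 hz)).of_le hn)
      (by
        have := ContDiffAt.sum (s := Finset.univ) (fun e _ => hσ' e)
        convert this using 1
        ext1 y
        rw [Finset.sum_apply]),
      iteratedFDeriv_sum_apply (fun e _ => hσ' e)]
    congr 1
    exact Finset.sum_congr rfl fun e _ => iteratedFDeriv_const_smul_apply (hσ e)
  -- This sum bounds the difference of the `n`-th derivatives uniformly on `K`.
  have hlim : Filter.Tendsto (fun B : ι → ℂ => ∑ e, ‖B₀ e - B e‖ * M e) (nhds B₀) (nhds 0) := by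
    have : Continuous fun B : ι → ℂ => ∑ e, ‖B₀ e - B e‖ * M e := by fun_prop
    simpa using this.tendsto B₀
  filter_upwards [hlim (Iio_mem_nhds hε)] with B hB z hz
  refine lt_of_le_of_lt ?_ hB
  change dist (iteratedFDeriv ℝ n (coeff r (F B₀).1 p) z)
    (iteratedFDeriv ℝ n (coeff r (F B).1 p) z) ≤ _
  rw [hexp B₀ z hz, hexp B z hz, dist_add_left, dist_eq_norm, ← Finset.sum_sub_distrib]
  refine (norm_sum_le _ _).trans (Finset.sum_le_sum fun e _ => ?_)
  rw [← sub_smul]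
  exact (norm_smul_le _ _).trans (mul_le_mul_of_nonneg_left (hM e z hz) (norm_nonneg _))

/-! ### Openness -/

/-- The sections for which `det μ` has transverse zeros over the subset `K` of the coordinate
domain at `p`. -/
def transverseOn (g : SurfaceMetric S) (p : S) (K : Set ℂ) : Set (QuadSection r E) :=
  {s | ∀ z ∈ K, detCoeff g s p z = 0 → planeDet (fderiv ℝ (detCoeff g s p) z) ≠ 0}

/-- The 1-jets of a transverse section over `K` form a compact subset of an open set of good jets. A
thickening stays inside, and it contains the jets of all sections that are `C¹`-close on `K`. -/
theorem isOpen_transverseOn (g : SurfaceMetric S) {p : S} {K : Set ℂ} (hK : IsCompact K)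
    (hKp : K ⊆ chartDomain r E p) : IsOpen (transverseOn g p K : Set (QuadSection r E)) := by
  let Y := (ℂ [×0]→L[ℝ] (Fin r → Fin r → ℂ)) × (ℂ [×1]→L[ℝ] (Fin r → Fin r → ℂ))
  let jet : QuadSection r E → ℂ → Y := fun s z =>
    (iteratedFDeriv ℝ 0 (coeff r s.1 p) z, iteratedFDeriv ℝ 1 (coeff r s.1 p) z)
  -- Good jets: nonzero determinant, or nonzero Jacobian of it. The adjugate formula makes the
  -- Jacobian continuous in the jet.
  let O : Set Y := {y | (Matrix.of (y.1 0)).det ≠ 0} ∪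
    {y | planeDet (fun v => ∑ a, ∑ b,
      (Matrix.of (y.1 0)).adjugate b a * y.2 (fun _ => v) a b) ≠ 0}
  have hmat : Continuous fun y : Y => Matrix.of (y.1 0) := by
    exact (ContinuousMultilinearMap.apply ℝ (fun _ : Fin 0 => ℂ) (Fin r → Fin r → ℂ)
      0).continuous.comp continuous_fst
  have hO : IsOpen O := by
    refine IsOpen.union (isOpen_ne_fun hmat.matrix_det continuous_const)
      (isOpen_ne_fun ?_ continuous_const)
    have hv : ∀ v : ℂ, Continuous fun y : Y => ∑ a, ∑ b,
        (Matrix.of (y.1 0)).adjugate b a * y.2 (fun _ => v) a b := fun v => by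
      refine continuous_finsetSum _ fun a _ => continuous_finsetSum _ fun b _ => ?_
      refine (hmat.matrix_adjugate.matrix_elem b a).mul ?_
      have h1 : Continuous fun y : Y => y.2 (fun _ => v) :=
        (ContinuousMultilinearMap.apply ℝ (fun _ : Fin 1 => ℂ) (Fin r → Fin r → ℂ)
          fun _ => v).continuous.comp continuous_snd
      exact (continuous_apply b).comp ((continuous_apply a).comp h1)
    exact Complex.continuous_im.comp ((Complex.continuous_conj.comp (hv 1)).mul (hv Complex.I))
  have hjet : ∀ s, ∀ z ∈ K, (detCoeff g s p z = 0 →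
      planeDet (fderiv ℝ (detCoeff g s p) z) ≠ 0) ↔ jet s z ∈ O := fun s z hz => by
    have hd : DifferentiableAt ℝ (coeff r s.1 p) z :=
      (contDiffAt_coeff s (hKp hz)).differentiableAt (by simp)
    obtain ⟨L, hL, hLv⟩ := hasFDerivAt_det hd.hasFDerivAt
    have hdet : detCoeff g s p = fun z => (Matrix.of (coeff r s.1 p z)).det :=
      funext (detCoeff_eq g s p)
    have hfd : (fderiv ℝ (detCoeff g s p) z : ℂ → ℂ) = fun v => ∑ a, ∑ b,
        (Matrix.of ((jet s z).1 0)).adjugate b a * (jet s z).2 (fun _ => v) a b := by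
      rw [hdet, hL.fderiv]
      funext v
      rw [hLv]
      simp only [jet, iteratedFDeriv_zero_apply, iteratedFDeriv_one_apply]
    rw [hfd, hdet]
    simp only [O, Set.mem_union, Set.mem_ofPred_eq, imp_iff_not_or]
    simp only [jet, iteratedFDeriv_zero_apply]
  rw [isOpen_iff_mem_nhds]
  intro s₀ hs₀
  have hcont : ContinuousOn (jet s₀) K := fun z hz =>
    (((contDiffAt_coeff s₀ (hKp hz)).continuousAt_iteratedFDeriv (by simp)).prodMk
      ((contDiffAt_coeff s₀ (hKp hz)).continuousAt_iteratedFDeriv (by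
        simp))).continuousWithinAt
  obtain ⟨δ, hδ, hsub⟩ := (hK.image_of_continuousOn hcont).exists_thickening_subset_open hO (by
    rintro _ ⟨z, hz, rfl⟩
    exact (hjet s₀ z hz).1 (hs₀ z hz))
  filter_upwards [eventually_dist_iteratedFDeriv_lt s₀ hK hKp 0 hδ,
    eventually_dist_iteratedFDeriv_lt s₀ hK hKp 1 hδ] with s h0 h1 z hz
  refine (hjet s z hz).2 (hsub ?_)
  rw [Metric.mem_thickening_iff]
  refine ⟨jet s₀ z, ⟨z, hz, rfl⟩, ?_⟩
  rw [dist_comm, Prod.dist_eq]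
  exact max_lt (h0 z hz) (h1 z hz)

end Generic

/-! ### Density of transversality by cut-off perturbations -/

section Density

variable {S : Type*} [TopologicalSpace S] [ChartedSpace ℂ S] [IsManifold 𝓘(ℂ, ℂ) ω S]
  {r : ℕ} {E : S → Type*} [TopologicalSpace (TotalSpace (Fib r) E)]
  [∀ x, NormedAddCommGroup (E x)] [∀ x, InnerProductSpace ℂ (E x)]
  [FiberBundle (Fib r) E] [VectorBundle ℂ (Fib r) E] [∀ x, FiniteDimensional ℂ (E x)]

/-- The symmetric tensor `∑ B^{ij} e_i ⊗ e_j` in the local frame at `p`. -/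
def frameTensor (r : ℕ) (E : S → Type*) [TopologicalSpace (TotalSpace (Fib r) E)]
    [∀ x, NormedAddCommGroup (E x)] [∀ x, InnerProductSpace ℂ (E x)]
    [FiberBundle (Fib r) E] [VectorBundle ℂ (Fib r) E] (p : S) (B : Sym2 (Fin r) → ℂ) (x : S) :
    symTensors (E x) :=
  ⟨∑ i, ∑ j, B s(i, j) • (frame r E p x i ⊗ₜ[ℂ] frame r E p x j), by
    rw [symTensors, LinearMap.mem_ker, LinearMap.sub_apply, sub_eq_zero]
    simp only [LinearEquiv.coe_coe, map_sum, map_smul, TensorProduct.comm_tmul, LinearMap.id_apply]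
    rw [Finset.sum_comm]
    exact Finset.sum_congr rfl fun i _ => Finset.sum_congr rfl fun j _ => by rw [Sym2.eq_swap]⟩

/-- The section `χ dz̄ ⊗ ∑ B^{ij} e_i ⊗ e_j` in the coordinate and frame at `p`. -/
def cutoffFibre (r : ℕ) (E : S → Type*) [TopologicalSpace (TotalSpace (Fib r) E)]
    [∀ x, NormedAddCommGroup (E x)] [∀ x, InnerProductSpace ℂ (E x)]
    [FiberBundle (Fib r) E] [VectorBundle ℂ (Fib r) E] (p : S) (χ : S → ℂ)
    (B : Sym2 (Fin r) → ℂ) (x : S) : QuadFibre E x where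
  toFun v := (starRingEnd ℂ ((show ℂ from v) / (show ℂ from coordVec p x)) * χ x) •
    frameTensor r E p B x
  map_add' v w := by
    rw [← add_smul, ← add_mul, ← map_add, ← add_div]; rfl
  map_smul' c v := by
    rw [← mul_smul, ← mul_assoc, ← map_mul, ← mul_div_assoc]; rfl

theorem tensorCoeff_frameTensor {p x : S} (hx : x ∈ (trivializationAt (Fib r) E p).baseSet)
    (B : Sym2 (Fin r) → ℂ) (i j : Fin r) :
    tensorCoeff r p x (frameTensor r E p B x : E x ⊗[ℂ] E x) i j = B s(i, j) := by
  simp only [frameTensor, tensorCoeff, map_sum, map_smul, TensorProduct.map_tmul,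
    TensorProduct.lid_tmul, smul_eq_mul, coframe_frame hx]
  simp

theorem coeffAt_cutoffFibre {p x : S} (hx : x ∈ locDomain r E p) (χ : S → ℂ)
    (B : Sym2 (Fin r) → ℂ) : coeffAt r (cutoffFibre r E p χ B) p x = χ x • symMat B := by
  ext i j
  have h : (show ℂ from coordVec p x) ≠ 0 := coordVec_ne_zero hx.1
  have h1 : (cutoffFibre r E p χ B x (coordVec p x) : E x ⊗[ℂ] E x) =
      χ x • (frameTensor r E p B x : E x ⊗[ℂ] E x) := by
    change ((starRingEnd ℂ ((show ℂ from coordVec p x) / (show ℂ from coordVec p x)) * χ x) •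
      (frameTensor r E p B x : E x ⊗[ℂ] E x)) = _
    rw [div_self h, map_one, one_mul]
  rw [coeffAt, Matrix.of_apply, h1, tensorCoeff_smul, tensorCoeff_frameTensor hx.2]
  rfl

theorem coeffAt_cutoffFibre_eq_zero {p x : S} {χ : S → ℂ} (hχ : χ x = 0)
    (B : Sym2 (Fin r) → ℂ) (q : S) : coeffAt r (cutoffFibre r E p χ B) q x = 0 := by
  ext i j
  have h1 : (cutoffFibre r E p χ B x (coordVec q x) : E x ⊗[ℂ] E x) = 0 := by
    change ((_ * χ x) • (frameTensor r E p B x : E x ⊗[ℂ] E x)) = _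
    rw [hχ, mul_zero, zero_smul]
  rw [coeffAt, Matrix.of_apply, h1, tensorCoeff_zero]
  rfl

theorem frameTensor_eq_sum (p : S) (B : Sym2 (Fin r) → ℂ) (x : S) :
    (frameTensor r E p B x : E x ⊗[ℂ] E x) =
      ∑ e, B e • (frameTensor r E p (Pi.single e 1) x : E x ⊗[ℂ] E x) := by
  simp only [frameTensor, Finset.smul_sum]
  conv_rhs => rw [Finset.sum_comm]
  refine Finset.sum_congr rfl fun i _ => ?_
  conv_rhs => rw [Finset.sum_comm]
  refine Finset.sum_congr rfl fun j _ => ?_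
  rw [Finset.sum_eq_single s(i, j)]
  · simp
  · intro e _ he
    simp [he.symm]
  · simp

theorem coeff_cutoffFibre_eq_sum (p : S) (χ : S → ℂ) (B : Sym2 (Fin r) → ℂ) (q : S) :
    coeff r (cutoffFibre r E p χ B) q =
      ∑ e, B e • coeff r (cutoffFibre r E p χ (Pi.single e 1)) q := by
  funext z i j
  rw [Finset.sum_apply, Finset.sum_apply, Finset.sum_apply]
  simp only [Pi.smul_apply, coeff_eq, smul_eq_mul]
  set x := (chartAt ℂ q).symm z
  have h : ∀ B, (cutoffFibre r E p χ B x (coordVec q x) : E x ⊗[ℂ] E x) =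
    (starRingEnd ℂ ((show ℂ from coordVec q x) / (show ℂ from coordVec p x)) * χ x) •
      (frameTensor r E p B x : E x ⊗[ℂ] E x) := fun _ => rfl
  simp only [h, tensorCoeff_smul]
  rw [frameTensor_eq_sum]
  simp only [tensorCoeff, map_sum, map_smul, smul_eq_mul, Finset.mul_sum]
  exact Finset.sum_congr rfl fun e _ => by ring

open Classical in
/-- A bump function in the coordinate at `p`, extended by zero. -/
def cutoff (r : ℕ) (E : S → Type*) [TopologicalSpace (TotalSpace (Fib r) E)]
    [∀ x, NormedAddCommGroup (E x)] [∀ x, InnerProductSpace ℂ (E x)]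
    [FiberBundle (Fib r) E] [VectorBundle ℂ (Fib r) E] (p : S)
    (b : ContDiffBump (chartAt ℂ p p)) (x : S) : ℂ :=
  if x ∈ locDomain r E p then ((b (chartAt ℂ p x) : ℝ) : ℂ) else 0

theorem cutoff_of_mem {p x : S} (hx : x ∈ locDomain r E p) (b : ContDiffBump (chartAt ℂ p p)) :
    cutoff r E p b x = ((b (chartAt ℂ p x) : ℝ) : ℂ) :=
  if_pos hx

/-- Over the domain at `p` the coefficients at `q` follow from the transformation law. Elsewhere the
section vanishes nearby, since its support lies in a compact, hence closed, subset of that domain.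
-/
theorem contDiffOn_coeff_cutoffFibre [T2Space S] [ContMDiffVectorBundle ω (Fib r) E 𝓘(ℂ, ℂ)]
    {p : S} {b : ContDiffBump (chartAt ℂ p p)}
    (hb : Metric.closedBall (chartAt ℂ p p) b.rOut ⊆ chartDomain r E p)
    (B : Sym2 (Fin r) → ℂ) (q : S) :
    ContDiffOn ℝ ∞ (coeff r (cutoffFibre r E p (cutoff r E p b) B) q) (chartDomain r E q) := by
  intro z hz
  refine ContDiffAt.contDiffWithinAt ?_
  by_cases hx : (chartAt ℂ q).symm z ∈ locDomain r E p
  · have hov : z ∈ overlap r E p q := ⟨hz, hx⟩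
    have hnhds := (isOpen_overlap p q).mem_nhds hov
    have hτ : ContDiffAt ℝ ∞ (chartAt ℂ p ∘ (chartAt ℂ q).symm) z :=
      (contDiffOn_coordChange (E := E) p q).contDiffAt hnhds
    have hf : ContDiffAt ℝ ∞ (fun z => starRingEnd ℂ (transTan p q ((chartAt ℂ q).symm z))) z :=
      (Complex.conjCLE : ℂ →L[ℝ] ℂ).contDiff.contDiffAt.comp z
        ((contDiffOn_transTan (E := E) p q).contDiffAt hnhds)
    have hT : ∀ i a, ContDiffAt ℝ ∞
        (fun z => transMat r E p q ((chartAt ℂ q).symm z) i a) z := fun i a =>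
      (contDiffOn_transMat p q i a).contDiffAt hnhds
    have hχ : ContDiffAt ℝ ∞
        (fun z => ((b ((chartAt ℂ p ∘ (chartAt ℂ q).symm) z) : ℝ) : ℂ)) z :=
      Complex.ofRealCLM.contDiff.contDiffAt.comp z (b.contDiffAt.comp z hτ)
    refine contDiffAt_pi.2 fun i => contDiffAt_pi.2 fun j => ?_
    have hsm : ContDiffAt ℝ ∞ (fun z => starRingEnd ℂ (transTan p q ((chartAt ℂ q).symm z)) *
        ∑ c, (∑ a, transMat r E p q ((chartAt ℂ q).symm z) i a *
          (((b ((chartAt ℂ p ∘ (chartAt ℂ q).symm) z) : ℝ) : ℂ) * B s(a, c))) *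
            transMat r E p q ((chartAt ℂ q).symm z) j c) z :=
      hf.mul (ContDiffAt.sum fun c _ => (ContDiffAt.sum fun a _ =>
        (hT i a).mul (hχ.mul contDiffAt_const)).mul (hT j c))
    refine hsm.congr_of_eventuallyEq ?_
    filter_upwards [hnhds] with y hy
    change coeffAt r (cutoffFibre r E p (cutoff r E p b) B) q ((chartAt ℂ q).symm y) i j = _
    rw [coeffAt_trans _ hy.2 q, coeffAt_cutoffFibre hy.2, cutoff_of_mem hy.2]
    simp only [Matrix.smul_apply, Matrix.mul_apply, Matrix.transpose_apply, smul_eq_mul, symMat,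
      Matrix.of_apply, Function.comp_apply]
  · let C : Set S := (chartAt ℂ p).symm '' Metric.closedBall (chartAt ℂ p p) b.rOut
    have hC : IsClosed C := ((isCompact_closedBall _ _).image_of_continuousOn
      ((chartAt ℂ p).continuousOn_symm.mono fun y hy => (hb hy).1)).isClosed
    have hxC : (chartAt ℂ q).symm z ∉ C := by
      rintro ⟨y, hy, hyx⟩
      exact hx (hyx ▸ chart_symm_mem_locDomain (hb hy))
    have hev : ∀ᶠ y in nhds z, (chartAt ℂ q).symm y ∈ Cᶜ :=
      ((chartAt ℂ q).continuousAt_symm hz.1) (hC.isOpen_compl.mem_nhds hxC)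
    refine (contDiffAt_const (c := (0 : Fin r → Fin r → ℂ))).congr_of_eventuallyEq ?_
    filter_upwards [hev] with y hy
    have h0 : cutoff r E p b ((chartAt ℂ q).symm y) = 0 := by
      by_cases h : (chartAt ℂ q).symm y ∈ locDomain r E p
      · rw [cutoff_of_mem h, b.zero_of_le_dist, Complex.ofReal_zero]
        by_contra! hlt
        exact hy ⟨_, Metric.mem_closedBall.2 hlt.le, (chartAt ℂ p).left_inv h.1⟩
      · rw [cutoff, if_neg h]
    exact coeffAt_cutoffFibre_eq_zero h0 B q

/-- The perturbation of `s₀` by a cut-off constant symmetric matrix. -/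
def perturb [T2Space S] [ContMDiffVectorBundle ω (Fib r) E 𝓘(ℂ, ℂ)]
    {p : S} {b : ContDiffBump (chartAt ℂ p p)}
    (hb : Metric.closedBall (chartAt ℂ p p) b.rOut ⊆ chartDomain r E p)
    (s₀ : QuadSection r E) (B : Sym2 (Fin r) → ℂ) : QuadSection r E :=
  ⟨fun x => s₀.1 x + cutoffFibre r E p (cutoff r E p b) B x, fun q => by
    have h := (s₀.2 q).add (contDiffOn_coeff_cutoffFibre hb B q)
    refine h.congr fun z _ => ?_
    funext i j
    exact tensorCoeff_add _ _ _ _ i j⟩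

theorem coeff_perturb [T2Space S] [ContMDiffVectorBundle ω (Fib r) E 𝓘(ℂ, ℂ)]
    {p : S} {b : ContDiffBump (chartAt ℂ p p)}
    (hb : Metric.closedBall (chartAt ℂ p p) b.rOut ⊆ chartDomain r E p)
    (s₀ : QuadSection r E) (B : Sym2 (Fin r) → ℂ) (q : S) :
    coeff r (perturb hb s₀ B).1 q =
      coeff r s₀.1 q + coeff r (cutoffFibre r E p (cutoff r E p b) B) q := by
  funext z i j
  exact tensorCoeff_add _ _ _ _ i j

theorem perturb_zero [T2Space S] [ContMDiffVectorBundle ω (Fib r) E 𝓘(ℂ, ℂ)]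
    {p : S} {b : ContDiffBump (chartAt ℂ p p)}
    (hb : Metric.closedBall (chartAt ℂ p p) b.rOut ⊆ chartDomain r E p)
    (s₀ : QuadSection r E) : perturb hb s₀ 0 = s₀ := by
  refine Subtype.ext (funext fun x => ?_)
  have h : frameTensor r E p 0 x = 0 := Subtype.ext (by simp [frameTensor])
  refine LinearMap.ext fun v => ?_
  change s₀.1 x v + (_ : ℂ) • frameTensor r E p 0 x = s₀.1 x v
  rw [h, smul_zero, add_zero]

theorem continuous_perturb [T2Space S] [ContMDiffVectorBundle ω (Fib r) E 𝓘(ℂ, ℂ)]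
    {p : S} {b : ContDiffBump (chartAt ℂ p p)}
    (hb : Metric.closedBall (chartAt ℂ p p) b.rOut ⊆ chartDomain r E p)
    (s₀ : QuadSection r E) : Continuous (perturb hb s₀) := by
  refine continuous_linearFamily s₀ (fun e => ⟨cutoffFibre r E p (cutoff r E p b) (Pi.single e 1),
    contDiffOn_coeff_cutoffFibre hb _⟩) fun B q => ?_
  rw [coeff_perturb, coeff_cutoffFibre_eq_sum]

/-- On the inner ball the bump function is `1`, so the perturbed matrix is `N + B` there. Almost
every `B` is good, hence good `B` accumulate at `0`, and the section depends continuously on `B`. -/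
theorem dense_transverseOn [T2Space S] [ContMDiffVectorBundle ω (Fib r) E 𝓘(ℂ, ℂ)]
    (g : SurfaceMetric S) {p : S} {b : ContDiffBump (chartAt ℂ p p)}
    (hb : Metric.closedBall (chartAt ℂ p p) b.rOut ⊆ chartDomain r E p) :
    Dense (transverseOn g p (Metric.closedBall (chartAt ℂ p p) (b.rIn / 2)) :
      Set (QuadSection r E)) := by
  intro s₀
  have hball : ∀ z ∈ Metric.ball (chartAt ℂ p p) b.rIn, z ∈ chartDomain r E p := fun z hz =>
    hb (Metric.closedBall_subset_closedBall b.rIn_lt_rOut.le (Metric.ball_subset_closedBall hz))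
  have hae := ae_planeDet_ne_zero (m := coeff r s₀.1 p)
    (Ω := Metric.ball (chartAt ℂ p p) b.rIn)
    (fun z hz => (contDiffAt_coeff s₀ (hball z hz)).differentiableAt (by simp))
    (fun z _ => coeff_symm s₀.1 p z)
  have hdense := MeasureTheory.Measure.dense_of_ae hae
  have h0 : s₀ ∈ closure (perturb hb s₀ '' {B | ∀ z ∈ Metric.ball (chartAt ℂ p p) b.rIn,
      (Matrix.of (coeff r s₀.1 p z) + symMat B).det = 0 →
      planeDet (fderiv ℝ (fun z => (Matrix.of (coeff r s₀.1 p z) + symMat B).det) z) ≠ 0}) := by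
    have := image_closure_subset_closure_image (continuous_perturb hb s₀)
      (Set.mem_image_of_mem _ (hdense 0))
    rwa [perturb_zero] at this
  refine closure_mono ?_ h0
  rintro _ ⟨B, hB, rfl⟩ z hz
  have heq : ∀ y ∈ Metric.ball (chartAt ℂ p p) b.rIn, detCoeff g (perturb hb s₀ B) p y =
      (Matrix.of (coeff r s₀.1 p y) + symMat B).det := fun y hy => by
    rw [detCoeff_eq, coeff_perturb]
    congr 1
    have hloc := chart_symm_mem_locDomain (hball y hy)
    have h1 := coeffAt_cutoffFibre hloc (cutoff r E p b) B
    rw [cutoff_of_mem hloc, (chartAt ℂ p).right_inv (hball y hy).1,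
      b.one_of_mem_closedBall (Metric.ball_subset_closedBall hy), Complex.ofReal_one,
      one_smul] at h1
    ext i j
    have := congrFun (congrFun h1 i) j
    exact congrArg (coeff r s₀.1 p y i j + ·) this
  -- Halving the radius puts a whole neighbourhood of `z` where the bump function is `1`, so the
  -- derivatives agree too.
  have hz' : z ∈ Metric.ball (chartAt ℂ p p) b.rIn :=
    Metric.closedBall_subset_ball (half_lt_self b.rIn_pos) hz
  have hev : detCoeff g (perturb hb s₀ B) p =ᶠ[nhds z]
      fun y => (Matrix.of (coeff r s₀.1 p y) + symMat B).det := by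
    filter_upwards [Metric.isOpen_ball.mem_nhds hz'] with y hy using heq y hy
  rw [hev.fderiv_eq, heq z hz']
  exact hB z hz'

theorem exists_bump (r : ℕ) (E : S → Type*) [TopologicalSpace (TotalSpace (Fib r) E)]
    [∀ x, NormedAddCommGroup (E x)] [∀ x, InnerProductSpace ℂ (E x)]
    [FiberBundle (Fib r) E] [VectorBundle ℂ (Fib r) E] [∀ x, FiniteDimensional ℂ (E x)] (p : S) :
    ∃ b : ContDiffBump (chartAt ℂ p p),
      Metric.closedBall (chartAt ℂ p p) b.rOut ⊆ chartDomain r E p := by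
  obtain ⟨ε, hε, h⟩ := Metric.nhds_basis_closedBall.mem_iff.1
    ((isOpen_chartDomain (r := r) (E := E) p).mem_nhds
      (chart_mem_chartDomain (mem_locDomain_self p)))
  exact ⟨⟨ε / 2, ε, half_pos hε, half_lt_self hε⟩, h⟩

/-- Transversality of all zeros is open and dense. -/
theorem isOpen_and_dense_hasTransverseZeros [CompactSpace S] [T2Space S]
    [ContMDiffVectorBundle ω (Fib r) E 𝓘(ℂ, ℂ)] (g : SurfaceMetric S) :
    IsOpen {s : QuadSection r E | HasTransverseZeros g s} ∧
      Dense {s : QuadSection r E | HasTransverseZeros g s} := by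
  choose b hb using exists_bump r E
  let K : S → Set ℂ := fun p => Metric.closedBall (chartAt ℂ p p) ((b p).rIn / 2)
  have hK : ∀ p, K p ⊆ chartDomain r E p := fun p =>
    (Metric.closedBall_subset_closedBall
      ((half_lt_self (b p).rIn_pos).le.trans (b p).rIn_lt_rOut.le)).trans (hb p)
  obtain ⟨t, ht⟩ := CompactSpace.elim_nhds_subcover
    (fun p => locDomain r E p ∩ chartAt ℂ p ⁻¹' K p) (fun p => Filter.inter_mem
      ((isOpen_locDomain p).mem_nhds (mem_locDomain_self p))
      ((chartAt ℂ p).continuousAt (mem_chart_source ℂ p)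
        (Metric.closedBall_mem_nhds _ (half_pos (b p).rIn_pos))))
  -- Transversality in the frame centred at the zero may be tested in any frame of the finite cover.
  have heq : {s : QuadSection r E | HasTransverseZeros g s} =
      ⋂ p ∈ t, transverseOn g p (K p) := by
    ext s
    rw [Set.mem_iInter₂, Set.mem_ofPred_eq, hasTransverseZeros_iff]
    constructor
    · intro h p _ z hz h0
      have hx := chart_symm_mem_locDomain (hK p hz)
      have hpx : chartAt ℂ p ((chartAt ℂ p).symm z) = z := (chartAt ℂ p).right_inv (hK p hz).1
      have hmem : (chartAt ℂ p).symm z ∈ detZeros g s := by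
        rw [mem_detZeros_iff g s hx, ← detCoeff_chart g s hx.1, hpx, h0]
      have := planeDet_detCoeff_ne_zero g s (mem_locDomain_self _) hx hmem (h _ hmem)
      rwa [hpx] at this
    · intro h x hx
      obtain ⟨p, hpt, hxp, hxK⟩ := Set.mem_iUnion₂.1 (ht ▸ Set.mem_univ x :
        x ∈ ⋃ p ∈ t, locDomain r E p ∩ chartAt ℂ p ⁻¹' K p)
      refine planeDet_detCoeff_ne_zero g s hxp (mem_locDomain_self x) hx
        (h p hpt _ hxK ?_)
      rw [detCoeff_chart g s hxp.1]
      exact (mem_detZeros_iff g s hxp).1 hx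
  have hopen : ∀ p, IsOpen (transverseOn g p (K p) : Set (QuadSection r E)) := fun p =>
    isOpen_transverseOn g (isCompact_closedBall _ _) (hK p)
  -- Finitely many open dense sets are intersected, so no Baire property of the space of sections is
  -- needed.
  have hdense : ∀ u : Finset S, Dense (⋂ p ∈ u, transverseOn g p (K p) :
      Set (QuadSection r E)) := fun u => by
    classical
    induction u using Finset.induction_on with
    | empty => simp
    | insert p u _ ih =>
      rw [Finset.set_biInter_insert]
      exact (dense_transverseOn g (hb p)).inter_of_isOpen_left ih (hopen p)
  rw [heq]
  exact ⟨isOpen_biInter_finset fun p _ => hopen p, hdense t⟩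

end Density

/-! ### Compatible metrics and orthonormal frames -/

section Metric

variable {S : Type*} [TopologicalSpace S] [ChartedSpace ℂ S] [IsManifold 𝓘(ℂ, ℂ) ω S]

theorem metricAt_symm (g : SurfaceMetric S) {x : S} (v w : Tan x) :
    metricAt g x v w = metricAt g x w v := g.symm x _ _

theorem metricAt_I_smul_self {g : SurfaceMetric S} (hg : IsCompatible g) {x : S} (v : Tan x) :
    metricAt g x v (Complex.I • v) = 0 := by
  have h1 := hg x v (Complex.I • v)
  rw [smul_smul, Complex.I_mul_I, metricAt_smul, metricAt_symm g (Complex.I • v) v] at h1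
  simp at h1
  linarith

theorem metricAt_smul_smul {g : SurfaceMetric S} (hg : IsCompatible g) {x : S} (v : Tan x)
    (c : ℂ) : metricAt g x (c • v) (c • v) = ‖c‖ ^ 2 * metricAt g x v v := by
  have h0 := metricAt_I_smul_self hg v
  rw [metricAt_smul g (c • v) v c, metricAt_symm g (c • v) v, metricAt_smul g v v c,
    metricAt_symm g (c • v) (Complex.I • v), metricAt_smul g (Complex.I • v) v c, hg,
    metricAt_symm g (Complex.I • v) v, h0, ← Complex.normSq_eq_norm_sq, Complex.normSq_apply]
  ring

theorem form01_tanOne {g : SurfaceMetric S} (hg : IsCompatible g) {x : S} (c : ℂ) :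
    form01 g (c • tanOne x) (tanOne x) =
      ((metricAt g x (tanOne x) (tanOne x) / 2 : ℝ) : ℂ) * c := by
  have h0 := metricAt_I_smul_self hg (tanOne x)
  rw [form01, metricAt_symm g (c • tanOne x), metricAt_symm g (c • tanOne x),
    metricAt_smul g (tanOne x) (tanOne x) c, metricAt_smul g (Complex.I • tanOne x) (tanOne x) c,
    hg, metricAt_symm g (Complex.I • tanOne x), h0]
  apply Complex.ext <;> simp <;> ring

/-- The second vector of an orthonormal frame is obtained from the first by a quarter turn. -/
theorem IsOrthonormalFrame.exists_sign {g : SurfaceMetric S} (hg : IsCompatible g) {x : S}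
    {e : Fin 2 → Tan x} (he : IsOrthonormalFrame g x e) :
    ∃ ε : ℝ, ε ^ 2 = 1 ∧ e 1 = ((ε : ℂ) * Complex.I) • e 0 := by
  have h00 : metricAt g x (e 0) (e 0) = 1 := by simpa using he 0 0
  have h11 : metricAt g x (e 1) (e 1) = 1 := by simpa using he 1 1
  have h01 : metricAt g x (e 0) (e 1) = 0 := by simpa using he 0 1
  have hne : (show ℂ from e 0) ≠ 0 := fun h => by
    have h' : e 0 = (0 : ℂ) • e 0 := by rw [zero_smul]; exact h
    rw [h', metricAt_smul_smul hg] at h00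
    simp at h00
  obtain ⟨c, hc⟩ : ∃ c : ℂ, e 1 = c • e 0 :=
    ⟨(show ℂ from e 1) / (show ℂ from e 0), (div_mul_cancel₀ (show ℂ from e 1) hne).symm⟩
  rw [hc, metricAt_smul, h00, metricAt_I_smul_self hg] at h01
  have hre : c.re = 0 := by linarith
  rw [hc, metricAt_smul_smul hg, h00, ← Complex.normSq_eq_norm_sq, Complex.normSq_apply, hre] at h11
  refine ⟨c.im, by linarith, ?_⟩
  rw [hc]
  congr 1
  apply Complex.ext <;> simp [hre]

theorem isOrthonormalFrame_pair {g : SurfaceMetric S} (hg : IsCompatible g) {x : S} {v : Tan x}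
    (hv : metricAt g x v v = 1) : IsOrthonormalFrame g x ![v, Complex.I • v] := by
  have h0 := metricAt_I_smul_self hg v
  intro i j
  fin_cases i <;> fin_cases j
  · simpa using hv
  · simpa using h0
  · simpa [metricAt_symm g _ v] using h0
  · simpa [hg x v v] using hv

/-- The real derivative of a holomorphic coordinate change is its complex derivative with restricted
scalars. -/
theorem trivializationAt_real_eq {p x : S} (hx : x ∈ (chartAt ℂ p).source) (v : ℂ) :
    (trivializationAt ℂ (fun y : S => TangentSpace 𝓘(ℝ, ℂ) y) p ⟨x, v⟩).2 =
      (trivializationAt ℂ (fun y : S => TangentSpace 𝓘(ℂ, ℂ) y) p ⟨x, v⟩).2 := by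
  rw [TangentBundle.trivializationAt_apply, TangentBundle.trivializationAt_apply]
  have h := hasFDerivWithinAt_tangentCoordChange (I := 𝓘(ℂ, ℂ)) (x := x) (y := p) (z := x)
    ⟨mem_extChartAt_source x, by simpa using hx⟩
  have h1 := h.restrictScalars ℝ
  have h2 : UniqueDiffWithinAt ℝ (Set.range 𝓘(ℂ, ℂ)) (extChartAt 𝓘(ℂ, ℂ) x x) := by
    simp [uniqueDiffWithinAt_univ]
  have h3 := h1.fderivWithin h2
  exact congrArg (fun L : ℂ →L[ℝ] ℂ => L v) h3

theorem contMDiffAt_coordVec (p : S) :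
    ContMDiffAt 𝓘(ℝ, ℂ) (𝓘(ℝ, ℂ).prod 𝓘(ℝ, ℂ)) ∞
      (fun x => TotalSpace.mk' ℂ (E := fun y : S => TangentSpace 𝓘(ℝ, ℂ) y) x
        (show TangentSpace 𝓘(ℝ, ℂ) x from coordVec p x)) p := by
  rw [contMDiffAt_section]
  refine (contMDiffAt_const (c := (1 : ℂ))).congr_of_eventuallyEq ?_
  filter_upwards [(chartAt ℂ p).open_source.mem_nhds (mem_chart_source ℂ p)] with x hx
  refine (trivializationAt_real_eq hx (coordVec p x)).trans ?_
  have h1 := (trivializationAt ℂ (fun y : S => TangentSpace 𝓘(ℂ, ℂ) y)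
    p).continuousLinearMapAt_symmL (R := ℂ) (b := x) hx (1 : ℂ)
  rw [Trivialization.continuousLinearMapAt_apply_of_mem ℂ _ hx] at h1
  exact h1

/-- The length of `dz̄` enters `μ*`, so its coefficient has to be differentiated when `∇μ*` is
computed. -/
theorem differentiableAt_metricAt_coordVec (g : SurfaceMetric S) (p : S) :
    DifferentiableAt ℝ (fun z : ℂ => metricAt g ((chartAt ℂ p).symm z)
      (coordVec p ((chartAt ℂ p).symm z)) (coordVec p ((chartAt ℂ p).symm z)))
      (chartAt ℂ p p) := by
  have h : ContMDiffAt 𝓘(ℝ, ℂ) (𝓘(ℝ, ℂ).prod 𝓘(ℝ)) ∞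
      (fun x => TotalSpace.mk' ℝ (E := Bundle.Trivial S ℝ) x
        (metricAt g x (coordVec p x) (coordVec p x))) p :=
    ContMDiffAt.clm_bundle_apply₂ (F₁ := ℂ) (F₂ := ℂ) (b := fun x : S => x)
      (E₁ := fun y : S => TangentSpace 𝓘(ℝ, ℂ) y) (E₂ := fun y : S => TangentSpace 𝓘(ℝ, ℂ) y)
      g.contMDiff.contMDiffAt (contMDiffAt_coordVec p) (contMDiffAt_coordVec p)
  rw [contMDiffAt_section] at h
  have h1 : ContMDiffAt 𝓘(ℝ, ℂ) 𝓘(ℝ) ∞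
      (fun x => metricAt g x (coordVec p x) (coordVec p x)) p := h
  have hsymm : ContMDiffAt 𝓘(ℝ, ℂ) 𝓘(ℝ, ℂ) ∞ (chartAt ℂ p).symm (chartAt ℂ p p) :=
    (contMDiffOn_chart_symm (I := 𝓘(ℝ, ℂ)) (n := ∞) (x := p)).contMDiffAt
      ((chartAt ℂ p).open_target.mem_nhds (mem_chart_target ℂ p))
  have h2 := ContMDiffAt.comp (chartAt ℂ p p)
    (g := fun x => metricAt g x (coordVec p x) (coordVec p x))
    (by rw [(chartAt ℂ p).left_inv (mem_chart_source ℂ p)]; exact h1) hsymm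
  exact (contMDiffAt_iff_contDiffAt.1 h2).differentiableAt (by simp)

end Metric

/-! ### Conjugate-linear maps of a complex line -/

section ConjugateLinearModel

open ComplexConjugate

theorem exists_mul_self_eq (c : ℂ) : ∃ u : ℂ, u * u = c := by
  obtain ⟨u, hu⟩ := IsAlgClosed.exists_pow_nat_eq c (n := 2) two_pos
  exact ⟨u, by rw [← sq, hu]⟩

/-- Two complex numbers with real quotient are real multiples of each other. -/
theorem eq_real_mul_of_im_eq_zero {c d : ℂ} (hc : c ≠ 0) (h : (c * conj d).im = 0) :
    d = (((c * conj d).re / ‖c‖ ^ 2 : ℝ) : ℂ) * c := by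
  have hn : ((‖c‖ : ℂ) ^ 2) ≠ 0 := by simpa using hc
  have h1 : c * conj d = ((c * conj d).re : ℂ) := Complex.ext (by simp) (by simpa using h)
  have h2 : conj c * d = ((c * conj d).re : ℂ) := by
    rw [← Complex.conj_ofReal, ← h1, map_mul, Complex.conj_conj]
  rw [Complex.ofReal_div, ← h2, Complex.ofReal_pow, eq_comm, div_mul_eq_mul_div,
    div_eq_iff hn, ← Complex.conj_mul']
  ring

variable {V : Type*} [AddCommGroup V] [Module ℝ V] (ψ : ℂ ≃ₗ[ℝ] V)

/-- Taking norms in `c l̄ = t l` with `l ≠ 0` forces `t = |c|` for positive `t`. -/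
theorem positiveSpace_eq_eigenspace {T : Module.End ℝ V} {c : ℂ} (hc : c ≠ 0)
    (hT : ∀ l, T (ψ l) = ψ (c * conj l)) : positiveSpace T = T.eigenspace ‖c‖ := by
  refine le_antisymm (iSup_le fun t v hv => ?_)
    (le_iSup (fun t : {t : ℝ // 0 < t} => T.eigenspace t.1) ⟨‖c‖, norm_pos_iff.2 hc⟩)
  obtain ⟨l, rfl⟩ := ψ.surjective v
  by_cases hl : l = 0
  · rw [hl, map_zero]
    exact Submodule.zero_mem _
  have h1 := Module.End.mem_eigenspace_iff.1 hv
  rw [hT, ← map_smul] at h1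
  have h2 := congrArg norm (ψ.injective h1)
  rw [norm_mul, RCLike.norm_conj, norm_smul, Real.norm_of_nonneg t.2.le] at h2
  rw [mul_right_cancel₀ (norm_ne_zero_iff.2 hl) h2]
  exact hv

theorem mem_positiveSpace_iff {T : Module.End ℝ V} {c : ℂ} (hc : c ≠ 0)
    (hT : ∀ l, T (ψ l) = ψ (c * conj l)) (l : ℂ) :
    ψ l ∈ positiveSpace T ↔ c * conj l = ‖c‖ * l := by
  rw [positiveSpace_eq_eigenspace ψ hc hT, Module.End.mem_eigenspace_iff, hT, ← map_smul,
    ψ.injective.eq_iff, Complex.real_smul]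

variable {T : Fin 2 → Module.End ℝ V} {c : Fin 2 → ℂ}

/-- The two products are multiplication by `c 0 * conj (c 1)` and by its conjugate. -/
theorem commute_iff_im_eq_zero (hT : ∀ α l, T α (ψ l) = ψ (c α * conj l)) :
    (∀ α β, Commute (T α) (T β)) ↔ (c 0 * conj (c 1)).im = 0 := by
  have hcomp : ∀ α β l, (T α * T β) (ψ l) = ψ (c α * conj (c β) * l) := fun α β l => by
    rw [Module.End.mul_apply, hT, hT, map_mul (starRingEnd ℂ), Complex.conj_conj, mul_assoc]
  have hflip : c 1 * conj (c 0) = conj (c 0 * conj (c 1)) := by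
    rw [map_mul, Complex.conj_conj, mul_comm]
  constructor
  · intro h
    have h1 : (T 0 * T 1) (ψ 1) = (T 1 * T 0) (ψ 1) := by rw [(h 0 1).eq]
    rw [hcomp, hcomp, mul_one, mul_one, hflip] at h1
    exact Complex.conj_eq_iff_im.1 (ψ.injective h1).symm
  · intro h
    have h01 : Commute (T 0) (T 1) := by
      refine LinearMap.ext fun v => ?_
      obtain ⟨l, rfl⟩ := ψ.surjective v
      rw [hcomp, hcomp, hflip, Complex.conj_eq_iff_im.2 h]
    intro α β
    fin_cases α <;> fin_cases β
    · exact Commute.refl _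
    · exact h01
    · exact h01.symm
    · exact Commute.refl _

/-- Here `c 1` is a positive multiple of `c 0`, so both maps have the same positive line. -/
theorem nonempty_iInf_positiveSpace_equiv (hT : ∀ α l, T α (ψ l) = ψ (c α * conj l))
    (him : (c 0 * conj (c 1)).im = 0) (hre : 0 < (c 0 * conj (c 1)).re) :
    Nonempty ((⨅ α, positiveSpace (T α) : Submodule ℝ V) ≃ₗ[ℝ] ℝ) := by
  have h0 : c 0 ≠ 0 := fun h => by simp [h] at hre
  have h1 : c 1 ≠ 0 := fun h => by simp [h] at hre
  set t : ℝ := (c 0 * conj (c 1)).re / ‖c 0‖ ^ 2 with ht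
  have htpos : 0 < t := div_pos hre (pow_pos (norm_pos_iff.2 h0) 2)
  have hd : c 1 = (t : ℂ) * c 0 := eq_real_mul_of_im_eq_zero h0 him
  have hn : ‖c 1‖ = t * ‖c 0‖ := by
    rw [hd, norm_mul, Complex.norm_real, Real.norm_of_nonneg htpos.le]
  have hmem : ∀ l, ψ l ∈ (⨅ α, positiveSpace (T α) : Submodule ℝ V) ↔
      c 0 * conj l = ‖c 0‖ * l := by
    intro l
    rw [Submodule.mem_iInf, Fin.forall_fin_two, mem_positiveSpace_iff ψ h0 (hT 0),
      mem_positiveSpace_iff ψ h1 (hT 1), and_iff_left_of_imp]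
    intro h
    rw [hn, hd, mul_assoc, h, Complex.ofReal_mul, mul_assoc]
  -- A square root `u` of `c` spans the positive line: `c ū = u² ū = |u|² u = |c| u`.
  obtain ⟨u, hu⟩ := exists_mul_self_eq (c 0)
  have hu0 : u ≠ 0 := fun h => h0 (by rw [← hu, h, mul_zero])
  have hnc : (‖c 0‖ : ℂ) ≠ 0 := by simpa using h0
  have hcu : c 0 * conj u = ‖c 0‖ * u := by
    rw [← hu, mul_assoc, Complex.mul_conj', norm_mul, Complex.ofReal_mul]
    ring
  have hrank : Module.finrank ℝ (⨅ α, positiveSpace (T α) : Submodule ℝ V) = 1 := by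
    refine (finrank_eq_one_iff_of_nonzero' (⟨ψ u, (hmem u).2 hcu⟩ : (⨅ α, positiveSpace (T α) :
      Submodule ℝ V)) ?_).2 ?_
    · intro h
      exact hu0 (ψ.map_eq_zero_iff.1 (congrArg Subtype.val h))
    · rintro ⟨v, hv⟩
      obtain ⟨l, rfl⟩ := ψ.surjective v
      have hl := (hmem l).1 hv
      -- Two solutions of `c l̄ = |c| l` have a real quotient, so the solutions form a single real
      -- line.
      have hr : conj (l / u) = l / u := by
        rw [map_div₀, div_eq_div_iff ((map_ne_zero _).2 hu0) hu0]
        refine mul_left_cancel₀ (mul_ne_zero h0 hnc) ?_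
        linear_combination (‖c 0‖ * u) * hl - (‖c 0‖ * l) * hcu
      obtain ⟨q, hq⟩ := Complex.conj_eq_iff_real.1 hr
      refine ⟨q, Subtype.ext ?_⟩
      change q • ψ u = ψ l
      rw [← map_smul, Complex.real_smul, ← hq, div_mul_cancel₀ _ hu0]
  have : Module.Finite ℝ V := Module.Finite.equiv ψ
  exact FiniteDimensional.nonempty_linearEquiv_of_finrank_eq (by rw [hrank, Module.finrank_self])

/-- Here `c 1` is a negative multiple of `c 0`, so the positive line of one map is the negative line
of the other. -/
theorem iInf_positiveSpace_eq_bot (hT : ∀ α l, T α (ψ l) = ψ (c α * conj l))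
    (him : (c 0 * conj (c 1)).im = 0) (hre : (c 0 * conj (c 1)).re < 0) :
    (⨅ α, positiveSpace (T α) : Submodule ℝ V) = ⊥ := by
  have h0 : c 0 ≠ 0 := fun h => by simp [h] at hre
  have h1 : c 1 ≠ 0 := fun h => by simp [h] at hre
  rw [Submodule.eq_bot_iff]
  intro v hv
  obtain ⟨l, rfl⟩ := ψ.surjective v
  rw [Submodule.mem_iInf, Fin.forall_fin_two, mem_positiveSpace_iff ψ h0 (hT 0),
      mem_positiveSpace_iff ψ h1 (hT 1)] at hv
  set t : ℝ := (c 0 * conj (c 1)).re / ‖c 0‖ ^ 2 with ht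
  have htneg : t < 0 := div_neg_of_neg_of_pos hre (pow_pos (norm_pos_iff.2 h0) 2)
  have hd : c 1 = (t : ℂ) * c 0 := eq_real_mul_of_im_eq_zero h0 him
  have hn : ‖c 1‖ = -t * ‖c 0‖ := by
    rw [hd, norm_mul, Complex.norm_real, Real.norm_of_nonpos htneg.le]
  have hnc : (‖c 0‖ : ℂ) ≠ 0 := by simpa using h0
  have htc : (t : ℂ) ≠ 0 := Complex.ofReal_ne_zero.2 htneg.ne
  obtain ⟨ha, hb⟩ := hv
  rw [hn, hd, mul_assoc, ha] at hb
  push_cast at hb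
  have : (2 * t * ‖c 0‖ : ℂ) * l = 0 := by linear_combination hb
  rw [(mul_eq_zero.1 this).resolve_left (mul_ne_zero (mul_ne_zero two_ne_zero htc) hnc), map_zero]

end ConjugateLinearModel

/-! ### Coordinate and projection on a complex line -/

section ComplexLine

variable {V : Type*} [NormedAddCommGroup V] [InnerProductSpace ℂ V] {K : Submodule ℝ V} {k : V}

/-- The coordinate on a complex line spanned by a unit vector. -/
def lineEquiv (hk : ‖k‖ = 1) (hK : ∀ v, v ∈ K ↔ ∃ l : ℂ, v = l • k) : ℂ ≃ₗ[ℝ] K where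
  toFun l := ⟨l • k, (hK _).2 ⟨l, rfl⟩⟩
  map_add' l m := Subtype.ext (add_smul l m k)
  map_smul' t l := Subtype.ext (smul_assoc t l k)
  invFun v := inner ℂ k (v : V)
  left_inv l := by
    change inner ℂ k (l • k) = l
    rw [inner_smul_right, inner_self_eq_norm_sq_to_K, hk]
    simp
  right_inv v := by
    obtain ⟨l, hl⟩ := (hK _).1 v.2
    refine Subtype.ext ?_
    change (inner ℂ k (v : V) : ℂ) • k = v
    rw [hl, inner_smul_right, inner_self_eq_norm_sq_to_K, hk]
    simp

theorem coe_lineEquiv (hk : ‖k‖ = 1) (hK : ∀ v, v ∈ K ↔ ∃ l : ℂ, v = l • k) (l : ℂ) :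
    (lineEquiv hk hK l : V) = l • k := rfl

/-- The Hermitian residual is orthogonal to every complex multiple of `k`, hence also for the real
inner product. -/
theorem orthogonalProjectionOnto_eq [K.HasOrthogonalProjection] (hk : ‖k‖ = 1)
    (hK : ∀ v, v ∈ K ↔ ∃ l : ℂ, v = l • k) (y : V) :
    K.orthogonalProjectionOnto y = lineEquiv hk hK (inner ℂ k y) := by
  refine Subtype.ext ?_
  refine Submodule.eq_starProjection_of_mem_of_inner_eq_zero (Subtype.prop _) fun w hw => ?_
  obtain ⟨l, rfl⟩ := (hK _).1 hw
  rw [coe_lineEquiv, real_inner_eq_re_inner ℂ, inner_smul_right, ← inner_conj_symm,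
    inner_sub_right, inner_smul_right, inner_self_eq_norm_sq_to_K, hk]
  simp

end ComplexLine

/-! ### Derivatives of `μ` and `μ*` in local frames -/

section LocalDerivative

open ComplexConjugate

variable {S : Type*} [TopologicalSpace S] [ChartedSpace ℂ S] [IsManifold 𝓘(ℂ, ℂ) ω S]
  {r : ℕ} {E : S → Type*} [TopologicalSpace (TotalSpace (Fib r) E)]
  [∀ x, NormedAddCommGroup (E x)] [∀ x, InnerProductSpace ℂ (E x)]
  [FiberBundle (Fib r) E] [VectorBundle ℂ (Fib r) E] [∀ x, FiniteDimensional ℂ (E x)]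

theorem muLocal_apply (g : SurfaceMetric S) (s : QuadSection r E) {p : S} {z : ℂ}
    (hz : z ∈ chartDomain r E p) (b : Fib r) (j : Fin r) :
    muLocal g s p z b j = ∑ i, inner ℂ (ofFib r E p ((chartAt ℂ p).symm z) b)
      (frame r E p ((chartAt ℂ p).symm z) i) * coeff r s.1 p z i j :=
  coframe_contract hz.2 _ _ j

theorem contDiffOn_inner_frame (hE : IsSmoothHermitian r E) (p : S) (b : Fib r) (i : Fin r) :
    ContDiffOn ℝ ∞ (fun z => (inner ℂ (ofFib r E p ((chartAt ℂ p).symm z) b)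
      (frame r E p ((chartAt ℂ p).symm z) i) : ℂ)) (chartDomain r E p) :=
  hE p b (EuclideanSpace.single i 1)

theorem contDiffOn_muLocal (hE : IsSmoothHermitian r E) (g : SurfaceMetric S)
    (s : QuadSection r E) (p : S) : ContDiffOn ℝ ∞ (muLocal g s p) (chartDomain r E p) := by
  rw [contDiffOn_clm_apply]
  intro b
  rw [contDiffOn_piLp]
  intro j
  have h : ContDiffOn ℝ ∞ (fun z => ∑ i, (inner ℂ (ofFib r E p ((chartAt ℂ p).symm z) b)
      (frame r E p ((chartAt ℂ p).symm z) i) : ℂ) * coeff r s.1 p z i j) (chartDomain r E p) :=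
    ContDiffOn.sum fun i _ => (contDiffOn_inner_frame hE p b i).mul
      (contDiffOn_pi.1 (contDiffOn_pi.1 (s.2 p) i) j)
  exact h.congr fun z hz => muLocal_apply g s hz b j

theorem differentiableAt_muLocal (hE : IsSmoothHermitian r E) (g : SurfaceMetric S)
    (s : QuadSection r E) (p : S) : DifferentiableAt ℝ (muLocal g s p) (chartAt ℂ p p) :=
  ((contDiffOn_muLocal hE g s p).contDiffAt ((isOpen_chartDomain p).mem_nhds
    (chart_mem_chartDomain (mem_locDomain_self p)))).differentiableAt (by simp)

/-- On the kernel of `μ_p`, the derivative of `μ`, paired with the kernel, is given by the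
derivative of the coefficient matrix. -/
theorem inner_fderiv_muLocal (hE : IsSmoothHermitian r E) (g : SurfaceMetric S)
    (s : QuadSection r E) {p : S} {k : E p} (hk : (mu (s.1 p) k : KbarE g E p) = 0) (v l : ℂ) :
    inner ℂ k (ofFib r E p p (fderiv ℝ (muLocal g s p) (chartAt ℂ p p) v
      (toFib r E p p (l • k)))) =
      conj l * quadVal (fun i => inner ℂ k (frame r E p p i))
        (fderiv ℝ (coeff r s.1 p) (chartAt ℂ p p) v) := by
  set z₀ := chartAt ℂ p p with hz₀
  set w : Fin r → ℂ := fun i => inner ℂ k (frame r E p p i) with hw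
  set b := toFib r E p p (l • k) with hb
  have hdom : z₀ ∈ chartDomain r E p := chart_mem_chartDomain (mem_locDomain_self p)
  have hnhds : chartDomain r E p ∈ nhds z₀ := (isOpen_chartDomain p).mem_nhds hdom
  let h : Fin r → ℂ → ℂ := fun i z => inner ℂ (ofFib r E p ((chartAt ℂ p).symm z) b)
      (frame r E p ((chartAt ℂ p).symm z) i)
  have hh : ∀ i, HasFDerivAt (h i) (fderiv ℝ (h i) z₀) z₀ := fun i =>
    (((contDiffOn_inner_frame hE p b i).contDiffAt hnhds).differentiableAt (by simp)).hasFDerivAt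
  have hN : HasFDerivAt (coeff r s.1 p) (fderiv ℝ (coeff r s.1 p) z₀) z₀ :=
    ((contDiffAt_coeff s hdom).differentiableAt (by simp)).hasFDerivAt
  have hNij : ∀ i j, HasFDerivAt (fun z => coeff r s.1 p z i j)
      ((ContinuousLinearMap.proj j).comp ((ContinuousLinearMap.proj i).comp
        (fderiv ℝ (coeff r s.1 p) z₀))) z₀ := fun i j =>
    hasFDerivAt_pi'.1 (hasFDerivAt_pi'.1 hN i) j
  have h0 : ∀ i, h i z₀ = conj l * w i := fun i => by
    change inner ℂ (ofFib r E p ((chartAt ℂ p).symm (chartAt ℂ p p)) b)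
      (frame r E p ((chartAt ℂ p).symm (chartAt ℂ p p)) i) = _
    rw [(chartAt ℂ p).left_inv (mem_chart_source ℂ p), hb,
      ofFib_toFib (mem_baseSet_trivializationAt (Fib r) E p), inner_smul_left]
  -- The matrix annihilates `w`, so derivatives of the Hermitian metric, contained in `h`, vanish
  -- when paired with `k`.
  have hNw : ∀ i, ∑ j, coeff r s.1 p z₀ i j * w j = 0 := fun i => by
    have h1 := congrFun ((mu_eq_zero_iff_mulVec g s (mem_locDomain_self p) k).1 hk) i
    have h2 : coeffAt r s.1 p p = Matrix.of (coeff r s.1 p z₀) := by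
      rw [of_coeff, (chartAt ℂ p).left_inv (mem_chart_source ℂ p)]
    rw [h2] at h1
    exact h1
  have hmu : HasFDerivAt (muLocal g s p) (fderiv ℝ (muLocal g s p) z₀) z₀ :=
    (differentiableAt_muLocal hE g s p).hasFDerivAt
  have hj : ∀ j, (fderiv ℝ (muLocal g s p) z₀ v b) j =
      ∑ i, (h i z₀ * fderiv ℝ (coeff r s.1 p) z₀ v i j +
        coeff r s.1 p z₀ i j * fderiv ℝ (h i) z₀ v) := by
    intro j
    have h1 : HasFDerivAt (fun z => muLocal g s p z b j)
        (((EuclideanSpace.proj j : Fib r →L[ℂ] ℂ).restrictScalars ℝ).comp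
          ((ContinuousLinearMap.apply ℝ (Fib r) b).comp (fderiv ℝ (muLocal g s p) z₀))) z₀ :=
      ((EuclideanSpace.proj j : Fib r →L[ℂ] ℂ).restrictScalars ℝ).hasFDerivAt.comp z₀
        ((ContinuousLinearMap.apply ℝ (Fib r) b).hasFDerivAt.comp z₀ hmu)
    have h2 : HasFDerivAt (fun z => ∑ i, h i z * coeff r s.1 p z i j) _ z₀ :=
      HasFDerivAt.fun_sum fun i _ => (hh i).mul (hNij i j)
    have h3 := h2.congr_of_eventuallyEq (f₁ := fun z => muLocal g s p z b j)
      (Filter.mem_of_superset hnhds fun z hz => muLocal_apply g s hz b j)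
    have h4 := congrArg (fun L : ℂ →L[ℝ] ℂ => L v) (h1.unique h3)
    simpa using h4
  rw [ofFib_eq_sum, inner_sum]
  simp only [inner_smul_right, hj, quadVal]
  calc ∑ j, (∑ i, (h i z₀ * fderiv ℝ (coeff r s.1 p) z₀ v i j +
        coeff r s.1 p z₀ i j * fderiv ℝ (h i) z₀ v)) * w j
      = ∑ i, ∑ j, (h i z₀ * fderiv ℝ (coeff r s.1 p) z₀ v i j * w j) +
        ∑ i, fderiv ℝ (h i) z₀ v * ∑ j, coeff r s.1 p z₀ i j * w j := by
        rw [← Finset.sum_add_distrib, Finset.sum_congr rfl fun j _ => Finset.sum_mul _ _ _,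
          Finset.sum_comm]
        refine Finset.sum_congr rfl fun i _ => ?_
        rw [Finset.mul_sum, ← Finset.sum_add_distrib]
        refine Finset.sum_congr rfl fun j _ => ?_
        ring
    _ = _ := by
        simp only [hNw, mul_zero, Finset.sum_const_zero, add_zero, h0, Finset.mul_sum]
        refine Finset.sum_congr rfl fun i _ => Finset.sum_congr rfl fun j _ => ?_
        ring

theorem ev_ofFibK (g : SurfaceMetric S) {p x : S} {v : Tan x} {c : ℂ}
    (hx : x ∈ (chartAt ℂ p).source) (hv : v = c • coordVec p x) (b : Fib r) :
    KbarE.ev v (ofFibK g E p x b) = conj c • ofFib r E p x b := by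
  have h : (show ℂ from v) / (show ℂ from coordVec p x) = c := by
    subst hv
    exact mul_div_cancel_right₀ c (coordVec_ne_zero hx)
  exact congrArg (fun t : ℂ => conj t • ofFib r E p x b) h

/-- By symmetry of the tensor, `μ*` is `μ` rescaled by `|dz̄|²`. Compatibility of the metric lets
this factor be expressed by the moving coordinate vector, whatever the preferred chart at the point.
-/
theorem muAdjLocal_eq {g : SurfaceMetric S} (hg : IsCompatible g) (s : QuadSection r E) {p : S}
    {z : ℂ} (hz : z ∈ chartDomain r E p) :
    muAdjLocal g s p z = (2 / metricAt g ((chartAt ℂ p).symm z)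
      (coordVec p ((chartAt ℂ p).symm z)) (coordVec p ((chartAt ℂ p).symm z))) •
        muLocal g s p z := by
  refine ContinuousLinearMap.ext fun b => ?_
  have hx := (chart_symm_mem_locDomain hz).1
  change toFib r E p ((chartAt ℂ p).symm z) (muAdj g (s.1 ((chartAt ℂ p).symm z))
    (ofFibK g E p ((chartAt ℂ p).symm z) b)) = (2 / metricAt g ((chartAt ℂ p).symm z)
      (coordVec p ((chartAt ℂ p).symm z)) (coordVec p ((chartAt ℂ p).symm z))) •
    toFib r E p ((chartAt ℂ p).symm z) (contract (ofFib r E p ((chartAt ℂ p).symm z) b)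
      (s.1 ((chartAt ℂ p).symm z) (coordVec p ((chartAt ℂ p).symm z)) : _ ⊗[ℂ] _))
  generalize (chartAt ℂ p).symm z = x at hx ⊢
  obtain ⟨c, hc⟩ := exists_smul_coordVec hx (tanOne x)
  have hc0 : c ≠ 0 := by
    rintro rfl
    rw [zero_smul] at hc
    exact one_ne_zero (α := ℂ) hc
  have hn : (‖c‖ : ℂ) ≠ 0 := by simpa using hc0
  rw [muAdj_apply, ev_ofFibK g hx hc, hc, metricAt_smul_smul hg, LinearMap.map_smulₛₗ (s.1 x),
    Submodule.coe_smul, LinearMap.map_smulₛₗ contract, LinearMap.smul_apply, map_smul (contract _),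
    smul_smul, smul_smul, map_smul, RCLike.real_smul_eq_coe_smul (K := ℂ)]
  congr 1
  rw [Complex.conj_conj, mul_assoc, Complex.mul_conj']
  push_cast
  rw [div_mul_eq_mul_div, mul_comm ((‖c‖ : ℂ) ^ 2), mul_div_mul_right _ _ (pow_ne_zero 2 hn)]
  rfl

end LocalDerivative

/-! ### Covariant derivatives on the kernel lines -/

section KernelLines

open ComplexConjugate

variable {S : Type*} [TopologicalSpace S] [ChartedSpace ℂ S] [IsManifold 𝓘(ℂ, ℂ) ω S]
  {r : ℕ} {E : S → Type*} [TopologicalSpace (TotalSpace (Fib r) E)]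
  [∀ x, NormedAddCommGroup (E x)] [∀ x, InnerProductSpace ℂ (E x)]
  [FiberBundle (Fib r) E] [VectorBundle ℂ (Fib r) E] [∀ x, FiniteDimensional ℂ (E x)]

/-- The coordinate of a tangent vector in the preferred chart. -/
def tanCoord {x : S} (v : Tan x) : ℂ := v

theorem tanCoord_smul {x : S} (c : ℂ) (v : Tan x) : tanCoord (c • v) = c * tanCoord v := rfl

theorem tanCoord_tanOne (x : S) : tanCoord (tanOne x) = 1 := rfl

theorem tanCoord_smul_tanOne {x : S} (v : Tan x) : tanCoord v • tanOne x = v :=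
  mul_one (tanCoord v)

/-- The length of `(∂/∂x) ⊗ (1/√2)`, the reciprocal of the length of `dz̄`. -/
def formScale (g : SurfaceMetric S) (p : S) : ℝ := √(metricAt g p (tanOne p) (tanOne p) / 2)

theorem formScale_pos (g : SurfaceMetric S) (p : S) : 0 < formScale g p :=
  Real.sqrt_pos.2 (half_pos (metricAt_tanOne_pos g p))

theorem formScale_sq (g : SurfaceMetric S) (p : S) :
    formScale g p ^ 2 = metricAt g p (tanOne p) (tanOne p) / 2 :=
  Real.sq_sqrt (half_pos (metricAt_tanOne_pos g p)).le

theorem two_div_metricAt (g : SurfaceMetric S) (p : S) :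
    2 / metricAt g p (tanOne p) (tanOne p) = (formScale g p)⁻¹ * (formScale g p)⁻¹ := by
  rw [← mul_inv, ← sq, formScale_sq, inv_div]

theorem formScale_ne_zero (g : SurfaceMetric S) (p : S) : (formScale g p : ℂ) ≠ 0 :=
  Complex.ofReal_ne_zero.2 (formScale_pos g p).ne'

theorem metricAt_self {g : SurfaceMetric S} (hg : IsCompatible g) {p : S} (v : Tan p) :
    metricAt g p v v = 2 * formScale g p ^ 2 * ‖tanCoord v‖ ^ 2 := by
  conv_lhs => rw [← tanCoord_smul_tanOne v, metricAt_smul_smul hg]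
  rw [formScale_sq]
  ring

theorem ev_cliffUp {g : SurfaceMetric S} (hg : IsCompatible g) {p : S} (v : Tan p) (ξ : E p) :
    KbarE.ev (tanOne p) (cliffUp g v ξ) =
      ((formScale g p : ℂ) * formScale g p * tanCoord v) • ξ := by
  change form01 g v (tanOne p) • ξ = _
  conv_lhs => rw [← tanCoord_smul_tanOne v, form01_tanOne hg, ← formScale_sq]
  rw [sq, Complex.ofReal_mul]

/-- The unit vector of `K̄E` in the direction `dz̄ ⊗ ξ`, for a unit vector `ξ`. -/
def unitForm (g : SurfaceMetric S) {p : S} (ξ : E p) : KbarE g E p :=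
  ((formScale g p : ℂ)⁻¹) • cliffUp g (tanOne p) ξ

theorem ev_unitForm {g : SurfaceMetric S} (hg : IsCompatible g) {p : S} (ξ : E p) :
    KbarE.ev (tanOne p) (unitForm g ξ) = (formScale g p : ℂ) • ξ := by
  rw [unitForm, map_smul, ev_cliffUp hg, smul_smul, tanCoord_tanOne, mul_one,
    inv_mul_cancel_left₀ (formScale_ne_zero g p)]

theorem eq_of_ev_eq {g : SurfaceMetric S} {p : S} {η ζ : KbarE g E p}
    (h : KbarE.ev (tanOne p) η = KbarE.ev (tanOne p) ζ) : η = ζ := by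
  rw [← sub_eq_zero]
  exact KbarE.ext_one (by rw [map_sub, h, sub_self])

theorem cliffUp_eq_smul_unitForm {g : SurfaceMetric S} (hg : IsCompatible g) {p : S} (v : Tan p)
    (ξ : E p) : cliffUp g v ξ = ((formScale g p : ℂ) * tanCoord v) • unitForm g ξ :=
  eq_of_ev_eq (by
    rw [ev_cliffUp hg, map_smul, ev_unitForm hg, smul_smul]
    congr 1
    ring)

theorem inner_unitForm {g : SurfaceMetric S} (hg : IsCompatible g) {p : S} (ξ : E p)
    (η : KbarE g E p) : (inner ℂ (unitForm g ξ) η : ℂ) =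
      (formScale g p : ℂ)⁻¹ * inner ℂ ξ (KbarE.ev (tanOne p) η) := by
  have h := formScale_ne_zero g p
  rw [inner_kbarE, ev_unitForm hg, inner_smul_left, two_div_metricAt, Complex.conj_ofReal]
  push_cast
  field_simp

theorem norm_unitForm {g : SurfaceMetric S} (hg : IsCompatible g) {p : S} {ξ : E p}
    (hξ : ‖ξ‖ = 1) : ‖unitForm g ξ‖ = 1 := by
  have h : (inner ℂ (unitForm g ξ) (unitForm g ξ) : ℂ) = 1 := by
    rw [inner_unitForm hg, ev_unitForm hg, inner_smul_right, inner_self_eq_norm_sq_to_K, hξ]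
    simp [formScale_ne_zero g p]
  have h2 := inner_self_eq_norm_sq (𝕜 := ℂ) (unitForm g ξ)
  rw [h, RCLike.one_re] at h2
  exact (pow_eq_one_iff_of_nonneg (norm_nonneg _) two_ne_zero).1 h2.symm

/-- Evaluation on a tangent vector identifies `ker μ*` with `ker μ`. -/
theorem mem_kerMuAdj_iff {g : SurfaceMetric S} (hg : IsCompatible g) {s : QuadSection r E} {p : S}
    {k : E p} (hK : ∀ ξ, ξ ∈ kerMu g s p ↔ ∃ l : ℂ, ξ = l • k) (η : KbarE g E p) :
    η ∈ kerMuAdj g s p ↔ ∃ l : ℂ, η = l • unitForm g k := by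
  have h := formScale_ne_zero g p
  rw [LinearMap.mem_ker, muAdj_eq_zero_iff]
  refine (hK (KbarE.ev (tanOne p) η)).trans ⟨?_, ?_⟩
  · rintro ⟨l, hl⟩
    refine ⟨l * (formScale g p : ℂ)⁻¹, eq_of_ev_eq ?_⟩
    rw [hl, map_smul, ev_unitForm hg, smul_smul, inv_mul_cancel_right₀ h]
  · rintro ⟨l, rfl⟩
    exact ⟨l * formScale g p, by rw [map_smul, ev_unitForm hg, smul_smul]⟩

/-- The derivative of `μ` at `p` on the kernel, as a complex function of the tangent vector. -/
def kernelDeriv (g : SurfaceMetric S) (s : QuadSection r E) {p : S} (k : E p) (v : ℂ) : ℂ :=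
  (formScale g p : ℂ)⁻¹ * quadVal (fun i => inner ℂ k (frame r E p p i))
    (fderiv ℝ (coeff r s.1 p) (chartAt ℂ p p) v)

theorem inner_contract_eq_zero (g : SurfaceMetric S) {p : S} {s : QuadFibre E p} {k : E p}
    (hk : (mu s k : KbarE g E p) = 0) (ξ : E p) :
    inner ℂ k (contract ξ (s (tanOne p) : E p ⊗[ℂ] E p)) = (0 : ℂ) := by
  rw [inner_contract_symm (s (tanOne p)).2, ← ev_mu g, hk, map_zero, inner_zero_right]

/-- Both connection terms drop out: one is applied to `μ (l • k) = 0`, the other lies in the image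
of `μ`, which is orthogonal to `ker μ*`. -/
theorem inner_nablaMu (hE : IsSmoothHermitian r E) {g : SurfaceMetric S} (hg : IsCompatible g)
    (s : QuadSection r E) {p : S} (A : ConnectionsAt g E p) {k : E p}
    (hk : (mu (s.1 p) k : KbarE g E p) = 0) (v : Tan p) (l : ℂ) :
    inner ℂ (unitForm g k) (nablaMu g s A v (l • k)) =
      kernelDeriv g s k (tanCoord v) * conj l := by
  have h1 : muR g (s.1 p) (l • k) = 0 := by
    change mu (s.1 p) (l • k) = 0
    rw [LinearMap.map_smulₛₗ, hk, smul_zero]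
  have h2 : nablaMu g s A v (l • k) = ofFibK g E p p (fderiv ℝ (muLocal g s p) (chartAt ℂ p p)
      (tanCoord v) (toFib r E p p (l • k))) + A.b v (muR g (s.1 p) (l • k)) -
      mu (s.1 p) (A.a v (l • k)) := rfl
  rw [h2, h1, map_zero, add_zero, inner_unitForm hg, map_sub, inner_sub_right, ev_mu,
    inner_contract_eq_zero g hk, sub_zero, ev_ofFibK g (mem_chart_source ℂ p) (c := 1)
      (by rw [one_smul, coordVec_self]), map_one, one_smul, inner_fderiv_muLocal hE g s hk,
    kernelDeriv]
  ring

/-- The same function as for `μ` appears: the factor `|dz̄|²` in `μ*` is balanced by the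
normalizations of the two unit vectors. -/
theorem inner_nablaMuAdj (hE : IsSmoothHermitian r E) {g : SurfaceMetric S} (hg : IsCompatible g)
    (s : QuadSection r E) {p : S} (A : ConnectionsAt g E p) {k : E p}
    (hk : (mu (s.1 p) k : KbarE g E p) = 0) (v : Tan p) (l : ℂ) :
    inner ℂ k (nablaMuAdj g s A v (l • unitForm g k)) =
      kernelDeriv g s k (tanCoord v) * conj l := by
  have hs := formScale_ne_zero g p
  have hev : KbarE.ev (tanOne p) (l • unitForm g k) = (l * formScale g p) • k := by
    rw [map_smul, ev_unitForm hg, smul_smul]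
  have hmu : ∀ c : ℂ, (mu (s.1 p) (c • k) : KbarE g E p) = 0 := fun c => by
    rw [LinearMap.map_smulₛₗ, hk, smul_zero]
  have h1 : muAdj g (s.1 p) (l • unitForm g k) = 0 := by
    rw [muAdj_eq_zero_iff, hev, hmu]
  set b := toFib r E p p ((l * formScale g p) • k) with hb
  have hb' : toFibK g E p p (l • unitForm g k) = b := by
    change toFib r E p p (KbarE.ev (coordVec p p) (l • unitForm g k)) = b
    rw [coordVec_self, hev]
  have h2 : nablaMuAdj g s A v (l • unitForm g k) = ofFib r E p p
      (fderiv ℝ (muAdjLocal g s p) (chartAt ℂ p p) (tanCoord v)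
        (toFibK g E p p (l • unitForm g k))) + A.a v (muAdj g (s.1 p) (l • unitForm g k)) -
      muAdj g (s.1 p) (A.b v (l • unitForm g k)) := rfl
  set ρ : ℂ → ℝ := fun z => 2 / metricAt g ((chartAt ℂ p).symm z)
      (coordVec p ((chartAt ℂ p).symm z)) (coordVec p ((chartAt ℂ p).symm z)) with hρ
  have hρ0 : ρ (chartAt ℂ p p) = 2 / metricAt g p (tanOne p) (tanOne p) := by
    rw [hρ]
    simp only
    rw [(chartAt ℂ p).left_inv (mem_chart_source ℂ p), coordVec_self]
  have hρd : DifferentiableAt ℝ ρ (chartAt ℂ p p) := by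
    simp only [hρ, div_eq_mul_inv]
    refine ((differentiableAt_metricAt_coordVec g p).fun_inv ?_).const_mul 2
    rw [(chartAt ℂ p).left_inv (mem_chart_source ℂ p), coordVec_self]
    exact (metricAt_tanOne_pos g p).ne'
  have hder : HasFDerivAt (muAdjLocal g s p) _ (chartAt ℂ p p) :=
    (hρd.hasFDerivAt.smul (differentiableAt_muLocal hE g s p).hasFDerivAt).congr_of_eventuallyEq
      (Filter.mem_of_superset ((isOpen_chartDomain p).mem_nhds
        (chart_mem_chartDomain (mem_locDomain_self p))) fun z hz => muAdjLocal_eq hg s hz)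
  -- On the kernel the derivative of the metric factor `ρ` does not contribute.
  have hzero : muLocal g s p (chartAt ℂ p p) b = 0 := by
    change toFibK g E p ((chartAt ℂ p).symm (chartAt ℂ p p))
      (mu (s.1 ((chartAt ℂ p).symm (chartAt ℂ p p)))
        (ofFib r E p ((chartAt ℂ p).symm (chartAt ℂ p p)) b)) = 0
    rw [(chartAt ℂ p).left_inv (mem_chart_source ℂ p), hb,
      ofFib_toFib (mem_baseSet_trivializationAt (Fib r) E p), hmu, map_zero]
  have hval : fderiv ℝ (muAdjLocal g s p) (chartAt ℂ p p) (tanCoord v) b =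
      ((ρ (chartAt ℂ p p) : ℝ) : ℂ) •
        fderiv ℝ (muLocal g s p) (chartAt ℂ p p) (tanCoord v) b := by
    rw [hder.fderiv]
    simp [hzero]
  rw [h2, h1, map_zero, add_zero, hb', hval, inner_sub_right, muAdj_apply, inner_smul_right,
    inner_contract_eq_zero g hk, mul_zero, sub_zero, map_smul, inner_smul_right,
    inner_fderiv_muLocal hE g s hk, hρ0, two_div_metricAt, kernelDeriv, map_mul,
    Complex.conj_ofReal]
  push_cast
  field_simp

end KernelLines

/-! ### Values of a plane map on a direction and its quarter turn -/

section PlaneMaps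

open ComplexConjugate

variable (L : ℂ →ₗ[ℝ] ℂ)

theorem planeMap_apply (z : ℂ) : L z = z.re * L 1 + z.im * L Complex.I := by
  have h : z = z.re • (1 : ℂ) + z.im • Complex.I := by
    simp only [Complex.real_smul, mul_one]
    exact (Complex.re_add_im z).symm
  conv_lhs => rw [h, map_add, map_smul, map_smul]
  simp only [Complex.real_smul]

theorem im_mul_conj_rotate (z : ℂ) :
    (L z * conj (L (Complex.I * z))).im = -(‖z‖ ^ 2 * planeDet L) := by
  rw [planeMap_apply L z, planeMap_apply L (Complex.I * z), ← Complex.normSq_eq_norm_sq,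
    Complex.normSq_apply, planeDet]
  simp
  ring

theorem re_mul_conj_rotate (z : ℂ) :
    (L z * conj (L (Complex.I * z))).re =
      z.re * z.im * (‖L Complex.I‖ ^ 2 - ‖L 1‖ ^ 2) +
        (z.re ^ 2 - z.im ^ 2) * (L 1 * conj (L Complex.I)).re := by
  rw [planeMap_apply L z, planeMap_apply L (Complex.I * z), ← Complex.normSq_eq_norm_sq,
    ← Complex.normSq_eq_norm_sq, Complex.normSq_apply, Complex.normSq_apply]
  simp
  ring

/-- Some direction and its quarter turn have real-orthogonal images under a real-linear map. -/
theorem exists_re_mul_conj_rotate_eq_zero :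
    ∃ z : ℂ, z ≠ 0 ∧ (L z * conj (L (Complex.I * z))).re = 0 := by
  set a := ‖L Complex.I‖ ^ 2 - ‖L 1‖ ^ 2 with ha
  set b := (L 1 * conj (L Complex.I)).re with hb
  by_cases h : b = 0
  · refine ⟨1, one_ne_zero, ?_⟩
    rw [re_mul_conj_rotate, ← hb, h]
    simp
  · refine ⟨⟨-a + √(a ^ 2 + 4 * b ^ 2), 2 * b⟩, fun h0 => h ?_, ?_⟩
    · simpa using congrArg Complex.im h0
    · rw [re_mul_conj_rotate, ← ha, ← hb]
      have hs : √(a ^ 2 + 4 * b ^ 2) ^ 2 = a ^ 2 + 4 * b ^ 2 := Real.sq_sqrt (by positivity)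
      simp only
      linear_combination b * hs

/-- Polarization of the hypothesis at `z` and `i z`. -/
theorem re_mul_conj_rotate_eq_zero_of_conformal {m : ℝ} (h : ∀ z, ‖L z‖ ^ 2 = ‖z‖ ^ 2 * m)
    (z : ℂ) : (L z * conj (L (Complex.I * z))).re = 0 := by
  have h1 := h z
  have h2 := h (Complex.I * z)
  have h3 := h (z + Complex.I * z)
  have h4 : ‖z + Complex.I * z‖ ^ 2 = 2 * ‖z‖ ^ 2 := by
    simp only [← Complex.normSq_eq_norm_sq, Complex.normSq_apply]
    simp
    ring
  rw [map_add, h4, ← Complex.normSq_eq_norm_sq, Complex.normSq_add, Complex.normSq_eq_norm_sq,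
    Complex.normSq_eq_norm_sq, h1, h2, norm_mul, Complex.norm_I, one_mul] at h3
  linarith

/-- The orientation sign `ε` enters once through `τ 1` and once through `L (τ 1)`, so it cancels.
Without the conjugation on `τ`, as in `frame_product_neg`, the factor `i` turns into `-i`; this is
what separates `M` from `M̂`. -/
theorem frame_product_conj {τ : Fin 2 → ℂ} {ε : ℝ} (hε : ε ^ 2 = 1)
    (hτ : τ 1 = ((ε : ℂ) * Complex.I) * τ 0) (t : ℝ) :
    (conj ((t : ℂ) * τ 0) * L (τ 0)) * conj (conj ((t : ℂ) * τ 1) * L (τ 1)) =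
      ((t ^ 2 * ‖τ 0‖ ^ 2 : ℝ) : ℂ) * (Complex.I * (L (τ 0) * conj (L (Complex.I * τ 0)))) := by
  have h1 : L (τ 1) = (ε : ℂ) * L (Complex.I * τ 0) := by
    rw [hτ, mul_assoc, ← Complex.real_smul, map_smul, Complex.real_smul]
  have h2 : ((ε : ℂ)) ^ 2 = 1 := by exact_mod_cast congrArg (fun x : ℝ => (x : ℂ)) hε
  rw [h1, hτ]
  push_cast
  rw [← Complex.mul_conj']
  simp only [map_mul, Complex.conj_conj, Complex.conj_ofReal]
  linear_combination ((t : ℂ) ^ 2 * (τ 0 * conj (τ 0)) * (Complex.I * (L (τ 0) *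
    conj (L (Complex.I * τ 0))))) * h2

theorem frame_product_neg {τ : Fin 2 → ℂ} {ε : ℝ} (hε : ε ^ 2 = 1)
    (hτ : τ 1 = ((ε : ℂ) * Complex.I) * τ 0) (t : ℝ) :
    (-((t : ℂ) * τ 0) * L (τ 0)) * conj (-((t : ℂ) * τ 1) * L (τ 1)) =
      -(((t ^ 2 * ‖τ 0‖ ^ 2 : ℝ) : ℂ) *
        (Complex.I * (L (τ 0) * conj (L (Complex.I * τ 0))))) := by
  have h1 : L (τ 1) = (ε : ℂ) * L (Complex.I * τ 0) := by
    rw [hτ, mul_assoc, ← Complex.real_smul, map_smul, Complex.real_smul]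
  have h2 : ((ε : ℂ)) ^ 2 = 1 := by exact_mod_cast congrArg (fun x : ℝ => (x : ℂ)) hε
  rw [h1, hτ]
  push_cast
  rw [← Complex.mul_conj']
  simp only [map_mul, map_neg, Complex.conj_ofReal, Complex.conj_I]
  linear_combination (-(t : ℂ) ^ 2 * (τ 0 * conj (τ 0)) * (Complex.I * (L (τ 0) *
    conj (L (Complex.I * τ 0))))) * h2

end PlaneMaps

/-! ### The operators at a transverse zero -/

section Pointwise

open ComplexConjugate

variable {S : Type*} [TopologicalSpace S] [ChartedSpace ℂ S] [IsManifold 𝓘(ℂ, ℂ) ω S]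
  {r : ℕ} {E : S → Type*} [TopologicalSpace (TotalSpace (Fib r) E)]
  [∀ x, NormedAddCommGroup (E x)] [∀ x, InnerProductSpace ℂ (E x)]
  [FiberBundle (Fib r) E] [VectorBundle ℂ (Fib r) E] [∀ x, FiniteDimensional ℂ (E x)]

/-- `kernelDeriv` as a real-linear map. -/
def kernelDerivL (g : SurfaceMetric S) (s : QuadSection r E) {p : S} (k : E p) : ℂ →ₗ[ℝ] ℂ where
  toFun := kernelDeriv g s k
  map_add' v w := by
    simp only [kernelDeriv, quadVal, map_add, Pi.add_apply, mul_add, add_mul,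
      Finset.sum_add_distrib]
  map_smul' c v := by
    simp only [kernelDeriv, quadVal, map_smul, Pi.smul_apply]
    simp only [Finset.mul_sum, Finset.smul_sum, Complex.real_smul, RingHom.id_apply]
    refine Finset.sum_congr rfl fun i _ => Finset.sum_congr rfl fun j _ => ?_
    ring

/-- At a transverse zero of `det μ` the kernel of `μ` is a complex line, and the derivative of
`det μ` is a multiple of the derivative of `μ` on this line. -/
theorem exists_kernel_line (g : SurfaceMetric S) (s : QuadSection r E) {p : S}
    (hp : p ∈ detZeros g s) (ht : Function.Bijective (detDeriv g s p)) :
    ∃ k : E p, ‖k‖ = 1 ∧ (∀ ξ, ξ ∈ kerMu g s p ↔ ∃ l : ℂ, ξ = l • k) ∧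
      ∃ c : ℂ, ∀ v, detDeriv g s p v = c * kernelDeriv g s k v := by
  have hloc := mem_locDomain_self (r := r) (E := E) p
  have hcoeff : Matrix.of (coeff r s.1 p (chartAt ℂ p p)) = coeffAt r s.1 p p := by
    rw [of_coeff, (chartAt ℂ p).left_inv (mem_chart_source ℂ p)]
  obtain ⟨ξ, hξ, hmu⟩ := (mem_detZeros_iff_ker g s).1 hp
  obtain ⟨j, hj⟩ : ∃ j, inner ℂ ξ (frame r E p p j) ≠ (0 : ℂ) := by
    by_contra! h
    exact hξ (eq_zero_of_inner_frame hloc.2 h)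
  have hmem : ∀ ζ : E p, ζ ∈ kerMu g s p ↔ (coeffAt r s.1 p p).mulVec
      (fun i => inner ℂ ζ (frame r E p p i)) = 0 := mu_eq_zero_iff_mulVec g s hloc
  set d : ℂ := inner ℂ ξ (frame r E p p j) with hd
  set w : Fin r → ℂ := fun i => d⁻¹ * inner ℂ ξ (frame r E p p i) with hw
  have hwj : w j = 1 := inv_mul_cancel₀ hj
  have hNw : (coeffAt r s.1 p p).mulVec w = 0 := by
    have : w = d⁻¹ • fun i => inner ℂ ξ (frame r E p p i) := rfl
    rw [this, Matrix.mulVec_smul, (hmem ξ).1 hmu, smul_zero]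
  have hD : HasFDerivAt (coeff r s.1 p) (fderiv ℝ (coeff r s.1 p) (chartAt ℂ p p))
      (chartAt ℂ p p) := ((contDiffAt_coeff s (chart_mem_chartDomain hloc)).differentiableAt
        (by simp)).hasFDerivAt
  obtain ⟨L, hL, hLv⟩ := hasFDerivAt_det_of_ker hD (coeff_symm s.1 p _) hwj
    (by rw [hcoeff]; exact hNw)
  have hdet : detDeriv g s p = L := by
    rw [detDeriv, funext (detCoeff_eq g s p)]
    exact hL.fderiv
  rw [hcoeff] at hLv
  -- The derivative of the determinant carries this cofactor as a factor, so transversality excludes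
  -- a larger kernel.
  have hadj : (coeffAt r s.1 p p).adjugate j j ≠ 0 := by
    intro h
    have h1 : (1 : ℂ) = 0 := ht.1 (by rw [hdet, hLv, h, zero_mul, map_zero])
    exact one_ne_zero h1
  have hn : (‖ξ‖ : ℂ) ≠ 0 := by simpa using hξ
  have hker : ∀ ζ, ζ ∈ kerMu g s p → ∃ l : ℂ, ζ = l • ξ := by
    intro ζ hζ
    have h1 := eq_smul_of_adjugate_ne_zero hwj hNw hadj ((hmem ζ).1 hζ)
    -- Pairing with the frame is conjugate linear in the vector, hence the conjugate.
    refine ⟨conj (inner ℂ ζ (frame r E p p j) * d⁻¹), ?_⟩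
    rw [← sub_eq_zero]
    refine eq_zero_of_inner_frame hloc.2 fun i => ?_
    have h2 := congrFun h1 i
    simp only [Pi.smul_apply, smul_eq_mul, hw] at h2
    rw [inner_sub_left, inner_smul_left, Complex.conj_conj, h2]
    ring
  refine ⟨((‖ξ‖ : ℂ)⁻¹) • ξ, ?_, fun ζ => ⟨fun hζ => ?_, ?_⟩,
    -- The constant converts the kernel vector normalized at `j` into the one of the unit vector
    -- `k`, quadratically, and removes the scale in `kernelDeriv`.
    (coeffAt r s.1 p p).adjugate j j * d⁻¹ ^ 2 * ‖ξ‖ ^ 2 * formScale g p, fun v => ?_⟩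
  · rw [norm_smul, norm_inv, Complex.norm_real, norm_norm,
      inv_mul_cancel₀ (norm_ne_zero_iff.2 hξ)]
  · obtain ⟨l, rfl⟩ := hker ζ hζ
    exact ⟨l * ‖ξ‖, by rw [smul_smul, mul_assoc, mul_inv_cancel₀ hn, mul_one]⟩
  · rintro ⟨l, rfl⟩
    change (mu (s.1 p) _ : KbarE g E p) = 0
    rw [LinearMap.map_smulₛₗ, LinearMap.map_smulₛₗ, hmu, smul_zero, smul_zero]
  · rw [hdet, hLv, kernelDeriv]
    have hs := formScale_ne_zero g p
    simp only [quadVal, hw, inner_smul_left, map_inv₀, Complex.conj_ofReal, Finset.mul_sum]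
    refine Finset.sum_congr rfl fun i _ => Finset.sum_congr rfl fun i' _ => ?_
    field_simp

/-- `M_α` is `l ↦ c l̄` in the complex coordinate on the kernel of `μ_p`, with this `c`. -/
def coefM (g : SurfaceMetric S) (s : QuadSection r E) {p : S} (k : E p) (e : Fin 2 → Tan p)
    (α : Fin 2) : ℂ :=
  conj ((formScale g p : ℂ) * tanCoord (e α)) * kernelDerivL g s k (tanCoord (e α))

/-- `M̂_α` is `l ↦ c l̄` in the complex coordinate on the kernel of `μ_p*`, with this `c`. -/
def coefMHat (g : SurfaceMetric S) (s : QuadSection r E) {p : S} (k : E p) (e : Fin 2 → Tan p)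
    (α : Fin 2) : ℂ :=
  -((formScale g p : ℂ) * tanCoord (e α)) * kernelDerivL g s k (tanCoord (e α))

theorem opM_lineEquiv (hE : IsSmoothHermitian r E) {g : SurfaceMetric S} (hg : IsCompatible g)
    (s : QuadSection r E) {p : S} (A : ConnectionsAt g E p) {k : E p} (hk : ‖k‖ = 1)
    (hK : ∀ ξ, ξ ∈ kerMu g s p ↔ ∃ l : ℂ, ξ = l • k) (e : Fin 2 → Tan p) (α : Fin 2) (l : ℂ) :
    opM g s A e α (lineEquiv hk hK l) = lineEquiv hk hK (coefM g s k e α * conj l) := by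
  have hmu : (mu (s.1 p) k : KbarE g E p) = 0 := (hK k).2 ⟨1, (one_smul ℂ k).symm⟩
  have h1 : opM g s A e α (lineEquiv hk hK l) = (kerMu g s p).orthogonalProjectionOnto
      (-(-(LinearMap.adjoint (cliffUp g (e α)) (nablaMu g s A (e α) (l • k))))) := rfl
  rw [h1, neg_neg, orthogonalProjectionOnto_eq hk hK, LinearMap.adjoint_inner_right,
    cliffUp_eq_smul_unitForm hg, inner_smul_left, inner_nablaMu hE hg s A hmu, ← mul_assoc]
  rfl

theorem opMHat_lineEquiv (hE : IsSmoothHermitian r E) {g : SurfaceMetric S} (hg : IsCompatible g)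
    (s : QuadSection r E) {p : S} (A : ConnectionsAt g E p) {k : E p} (hk : ‖k‖ = 1)
    (hK : ∀ ξ, ξ ∈ kerMu g s p ↔ ∃ l : ℂ, ξ = l • k) (e : Fin 2 → Tan p) (α : Fin 2) (l : ℂ) :
    opMHat g s A e α (lineEquiv (norm_unitForm hg hk) (mem_kerMuAdj_iff hg hK) l) =
      lineEquiv (norm_unitForm hg hk) (mem_kerMuAdj_iff hg hK)
        (coefMHat g s k e α * conj l) := by
  have hmu : (mu (s.1 p) k : KbarE g E p) = 0 := (hK k).2 ⟨1, (one_smul ℂ k).symm⟩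
  have h1 : opMHat g s A e α (lineEquiv (norm_unitForm hg hk) (mem_kerMuAdj_iff hg hK) l) =
      (kerMuAdj g s p).orthogonalProjectionOnto
        (-(cliffUp g (e α) (nablaMuAdj g s A (e α) (l • unitForm g k)))) := rfl
  have hs := formScale_ne_zero g p
  rw [h1, orthogonalProjectionOnto_eq (norm_unitForm hg hk) (mem_kerMuAdj_iff hg hK),
    inner_neg_right, inner_unitForm hg, ev_cliffUp hg, inner_smul_right,
    inner_nablaMuAdj hE hg s A hmu]
  congr 1
  change _ = -((formScale g p : ℂ) * tanCoord (e α)) * kernelDeriv g s k (tanCoord (e α)) * conj l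
  field_simp

theorem exists_pos_coefM_mul_conj {g : SurfaceMetric S} (hg : IsCompatible g)
    (s : QuadSection r E) {p : S} (k : E p) {e : Fin 2 → Tan p} (he : IsOrthonormalFrame g p e) :
    ∃ q : ℝ, 0 < q ∧
      coefM g s k e 0 * conj (coefM g s k e 1) =
        q * (Complex.I * (kernelDerivL g s k (tanCoord (e 0)) *
          conj (kernelDerivL g s k (Complex.I * tanCoord (e 0))))) ∧
      coefMHat g s k e 0 * conj (coefMHat g s k e 1) =
        -(q * (Complex.I * (kernelDerivL g s k (tanCoord (e 0)) *
          conj (kernelDerivL g s k (Complex.I * tanCoord (e 0)))))) := by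
  obtain ⟨ε, hε, h1⟩ := he.exists_sign hg
  have hτ : tanCoord (e 1) = ((ε : ℂ) * Complex.I) * tanCoord (e 0) := congrArg tanCoord h1
  refine ⟨formScale g p ^ 2 * ‖tanCoord (e 0)‖ ^ 2, ?_,
    frame_product_conj (kernelDerivL g s k) (τ := fun α => tanCoord (e α)) hε hτ _,
    frame_product_neg (kernelDerivL g s k) (τ := fun α => tanCoord (e α)) hε hτ _⟩
  have h2 := metricAt_self hg (e 0)
  rw [he 0 0, if_pos rfl] at h2
  linarith

/-- The products `c_0 c̄_1` for `M` and `M̂` are opposite, so the two families commute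
simultaneously, and the factor `i` turns the imaginary part into a real part. -/
theorem isCommutingFrame_iff (hE : IsSmoothHermitian r E) {g : SurfaceMetric S}
    (hg : IsCompatible g) (s : QuadSection r E) {p : S} (A : ConnectionsAt g E p) {k : E p}
    (hk : ‖k‖ = 1) (hK : ∀ ξ, ξ ∈ kerMu g s p ↔ ∃ l : ℂ, ξ = l • k) {e : Fin 2 → Tan p}
    (he : IsOrthonormalFrame g p e) :
    IsCommutingFrame g s A e ↔ (kernelDerivL g s k (tanCoord (e 0)) *
      conj (kernelDerivL g s k (Complex.I * tanCoord (e 0)))).re = 0 := by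
  obtain ⟨q, hq, hc, hd⟩ := exists_pos_coefM_mul_conj hg s k he
  rw [IsCommutingFrame, commute_iff_im_eq_zero _ (opM_lineEquiv hE hg s A hk hK e),
    commute_iff_im_eq_zero _ (opMHat_lineEquiv hE hg s A hk hK e), hc, hd, Complex.neg_im,
    neg_eq_zero, and_self, Complex.im_ofReal_mul, Complex.I_mul_im, mul_eq_zero,
    or_iff_right hq.ne']

theorem exists_isCommutingFrame (hE : IsSmoothHermitian r E) {g : SurfaceMetric S}
    (hg : IsCompatible g) (s : QuadSection r E) {p : S} (A : ConnectionsAt g E p) {k : E p}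
    (hk : ‖k‖ = 1) (hK : ∀ ξ, ξ ∈ kerMu g s p ↔ ∃ l : ℂ, ξ = l • k) :
    ∃ e, IsOrthonormalFrame g p e ∧ IsCommutingFrame g s A e := by
  obtain ⟨z, hz, h⟩ := exists_re_mul_conj_rotate_eq_zero (kernelDerivL g s k)
  set n : ℝ := metricAt g p (z • tanOne p) (z • tanOne p) with hn
  have hnpos : 0 < n := by
    rw [hn, metricAt_smul_smul hg]
    exact mul_pos (pow_pos (norm_pos_iff.2 hz) 2) (metricAt_tanOne_pos g p)
  set t : ℝ := (√n)⁻¹ with ht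
  have hu : metricAt g p ((t : ℂ) • z • tanOne p) ((t : ℂ) • z • tanOne p) = 1 := by
    rw [metricAt_smul_smul hg, ← hn, Complex.norm_real, Real.norm_eq_abs, sq_abs, ht, inv_pow,
      Real.sq_sqrt hnpos.le, inv_mul_cancel₀ hnpos.ne']
  refine ⟨_, isOrthonormalFrame_pair hg hu, ?_⟩
  rw [isCommutingFrame_iff hE hg s A hk hK (isOrthonormalFrame_pair hg hu)]
  have h1 : tanCoord ((t : ℂ) • z • tanOne p) = t • z := by
    rw [tanCoord_smul, tanCoord_smul, tanCoord_tanOne, mul_one, Complex.real_smul]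
  rw [Matrix.cons_val_zero, h1, mul_smul_comm, map_smul, map_smul, Complex.real_smul,
    Complex.real_smul, map_mul, Complex.conj_ofReal, mul_mul_mul_comm, ← Complex.ofReal_mul,
    Complex.re_ofReal_mul, h, mul_zero]

/-- On the kernel line non-degeneracy says that `|D(v)|²` is a fixed multiple of `|v|²`, so `D` is
conformal. -/
theorem commuting_of_isNondegenerate (hE : IsSmoothHermitian r E) {g : SurfaceMetric S}
    (hg : IsCompatible g) (s : QuadSection r E) {p : S} (A : ConnectionsAt g E p) {k : E p}
    (hk : ‖k‖ = 1) (hK : ∀ ξ, ξ ∈ kerMu g s p ↔ ∃ l : ℂ, ξ = l • k)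
    (hA : IsNondegenerate g s A) {e : Fin 2 → Tan p} (he : IsOrthonormalFrame g p e) :
    IsCommutingFrame g s A e := by
  obtain ⟨M, -, -, hM⟩ := hA
  have hkmem : k ∈ kerMu g s p := (hK k).2 ⟨1, (one_smul ℂ k).symm⟩
  rw [isCommutingFrame_iff hE hg s A hk hK he]
  refine re_mul_conj_rotate_eq_zero_of_conformal _
    (m := 2 * formScale g p ^ 2 * inner ℝ (M ⟨k, hkmem⟩) ⟨k, hkmem⟩) (fun z => ?_) _
  have h1 := hM (z • tanOne p) ⟨k, hkmem⟩
  have h2 : tanCoord (z • tanOne p) = z := mul_one z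
  have h3 := inner_nablaMu hE hg s A hkmem (z • tanOne p) 1
  rw [one_smul, map_one, mul_one, h2] at h3
  rw [orthogonalProjectionOnto_eq (norm_unitForm hg hk) (mem_kerMuAdj_iff hg hK),
    ← Submodule.norm_coe, coe_lineEquiv, norm_smul, norm_unitForm hg hk, mul_one, h3,
    metricAt_self hg, h2] at h1
  change ‖kernelDeriv g s k z‖ ^ 2 = _
  rw [h1]
  ring

/-- For a commuting frame `c_0 c̄_1` is real and a positive multiple of `det D`, while the product
for `M̂` is its negative. -/
theorem calK_of_planeDet (hE : IsSmoothHermitian r E) {g : SurfaceMetric S}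
    (hg : IsCompatible g) (s : QuadSection r E) {p : S} (A : ConnectionsAt g E p) {k : E p}
    (hk : ‖k‖ = 1) (hK : ∀ ξ, ξ ∈ kerMu g s p ↔ ∃ l : ℂ, ξ = l • k) {e : Fin 2 → Tan p}
    (he : IsOrthonormalFrame g p e) (hcomm : IsCommutingFrame g s A e) :
    (0 < planeDet (kernelDerivL g s k) →
      Nonempty (calK g s A e ≃ₗ[ℝ] ℝ) ∧ calKHat g s A e = ⊥) ∧
    (planeDet (kernelDerivL g s k) < 0 →
      calK g s A e = ⊥ ∧ Nonempty (calKHat g s A e ≃ₗ[ℝ] ℝ)) := by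
  obtain ⟨q, hq, hc, hd⟩ := exists_pos_coefM_mul_conj hg s k he
  have h0 := (isCommutingFrame_iff hE hg s A hk hK he).1 hcomm
  have hne : 0 < ‖tanCoord (e 0)‖ ^ 2 := by
    have h2 := metricAt_self hg (e 0)
    rw [he 0 0, if_pos rfl] at h2
    refine (sq_nonneg _).lt_of_ne fun h3 => ?_
    rw [← h3] at h2
    norm_num at h2
  have hcim : (coefM g s k e 0 * conj (coefM g s k e 1)).im = 0 := by
    rw [hc, Complex.im_ofReal_mul, Complex.I_mul_im, h0, mul_zero]
  have hdim : (coefMHat g s k e 0 * conj (coefMHat g s k e 1)).im = 0 := by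
    rw [hd, Complex.neg_im, Complex.im_ofReal_mul, Complex.I_mul_im, h0, mul_zero, neg_zero]
  have hcre : (coefM g s k e 0 * conj (coefM g s k e 1)).re =
      q * ‖tanCoord (e 0)‖ ^ 2 * planeDet (kernelDerivL g s k) := by
    rw [hc, Complex.re_ofReal_mul, Complex.I_mul_re, im_mul_conj_rotate, neg_neg, mul_assoc]
  have hdre : (coefMHat g s k e 0 * conj (coefMHat g s k e 1)).re =
      -(q * ‖tanCoord (e 0)‖ ^ 2 * planeDet (kernelDerivL g s k)) := by
    rw [hd, Complex.neg_re, Complex.re_ofReal_mul, Complex.I_mul_re, im_mul_conj_rotate, neg_neg,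
      mul_assoc]
  have hpos := mul_pos hq hne
  have hM := opM_lineEquiv hE hg s A hk hK e
  have hMHat := opMHat_lineEquiv hE hg s A hk hK e
  refine ⟨fun h => ⟨?_, ?_⟩, fun h => ⟨?_, ?_⟩⟩
  · exact nonempty_iInf_positiveSpace_equiv _ hM hcim (by rw [hcre]; exact mul_pos hpos h)
  · exact iInf_positiveSpace_eq_bot _ hMHat hdim
      (by rw [hdre]; exact neg_neg_of_pos (mul_pos hpos h))
  · exact iInf_positiveSpace_eq_bot _ hM hcim (by rw [hcre]; exact mul_neg_of_pos_of_neg hpos h)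
  · exact nonempty_iInf_positiveSpace_equiv _ hMHat hdim
      (by rw [hdre]; exact neg_pos_of_neg (mul_neg_of_pos_of_neg hpos h))

/-- The sign of the zero is thereby the sign of `det D`. -/
theorem det_detDeriv_eq (g : SurfaceMetric S) (s : QuadSection r E) {p : S} {k : E p} {c : ℂ}
    (h : ∀ v, detDeriv g s p v = c * kernelDeriv g s k v) :
    LinearMap.det (detDeriv g s p : ℂ →ₗ[ℝ] ℂ) = ‖c‖ ^ 2 * planeDet (kernelDerivL g s k) := by
  rw [det_eq_planeDet, ← planeDet_smul]
  exact congrArg planeDet (funext h)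

end Pointwise

end CrrLemma

end

/-! ### The main theorem -/

open CrrLemma in
theorem mainTheorem6
    (S : Type*) [TopologicalSpace S] [CompactSpace S] [T2Space S] [ChartedSpace ℂ S]
    [IsManifold 𝓘(ℂ, ℂ) ω S]
    (g : SurfaceMetric S) (hg : IsCompatible g)
    (r : ℕ) (E : S → Type*) [TopologicalSpace (TotalSpace (Fib r) E)]
    [∀ x, NormedAddCommGroup (E x)] [∀ x, InnerProductSpace ℂ (E x)]
    [∀ x, FiniteDimensional ℂ (E x)]
    [FiberBundle (Fib r) E] [VectorBundle ℂ (Fib r) E]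
    [ContMDiffVectorBundle ω (Fib r) E 𝓘(ℂ, ℂ)]
    (hE : IsSmoothHermitian r E) :
    IsOpen {s : QuadSection r E | HasTransverseZeros g s} ∧
    Dense {s : QuadSection r E | HasTransverseZeros g s} ∧
    ∀ s : QuadSection r E, HasTransverseZeros g s →
      (singularSet g s).Finite ∧
      singularSet g s = detZeros g s ∧
      ∀ p ∈ singularSet g s,
        (IsPositive g s p ∨ IsNegative g s p) ∧
        ∀ A : ConnectionsAt g E p,
          (∃ e, IsOrthonormalFrame g p e ∧ IsCommutingFrame g s A e) ∧
          (IsNondegenerate g s A → ∀ e, IsOrthonormalFrame g p e → IsCommutingFrame g s A e) ∧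
          ∀ e, IsOrthonormalFrame g p e → IsCommutingFrame g s A e →
            (IsPositive g s p →
              Nonempty (calK g s A e ≃ₗ[ℝ] ℝ) ∧ calKHat g s A e = ⊥) ∧
            (IsNegative g s p →
              calK g s A e = ⊥ ∧ Nonempty (calKHat g s A e ≃ₗ[ℝ] ℝ)) := by
  obtain ⟨hopen, hdense⟩ := isOpen_and_dense_hasTransverseZeros (r := r) (E := E) g
  refine ⟨hopen, hdense, fun s hs => ?_⟩
  rw [singularSet_eq_detZeros]
  refine ⟨finite_detZeros g hs, rfl, fun p hp => ⟨?_, fun A => ?_⟩⟩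
  · exact ((bijective_iff_det_ne_zero _).1 (hs p hp)).lt_or_gt.symm
  obtain ⟨k, hk, hK, c, hc⟩ := exists_kernel_line g s hp (hs p hp)
  have hdet := det_detDeriv_eq g s hc
  refine ⟨exists_isCommutingFrame hE hg s A hk hK,
    fun hA e he => commuting_of_isNondegenerate hE hg s A hk hK hA he,
    fun e he hcomm => ⟨fun h => ?_, fun h => ?_⟩⟩
  · rw [IsPositive, hdet] at h
    exact (calK_of_planeDet hE hg s A hk hK he hcomm).1 (pos_of_mul_pos_right h (sq_nonneg _))
  · rw [IsNegative, hdet] at h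
    exact (calK_of_planeDet hE hg s A hk hK he hcomm).2 (neg_of_mul_neg_right h (sq_nonneg _))
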